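/- Let $\Gamma=\mathrm{SL}_2(\mathbb Z)$, $T=\left(\begin{smallmatrix}1&1\\0&1\end{smallmatrix}\right)$, $B=\{\pm T^n:n\in\mathbb Z\}$, and for $\gamma=\left(\begin{smallmatrix}a_\gamma&b_\gamma\\c_\gamma&d_\gamma\end{smallmatrix}\right)\in\Gamma$ put $j(\gamma,w)=c_\gamma w+d_\gamma$. Let $k$ be an even positive integer, let $r,s$ be integers with $r+s$ even and $r+s>k$, and let $f$ be a holomorphic cusp form of weight $k$ for $\Gamma$. For $z=x+iy$ in the upper half-plane $\mathfrak H$ set $$F_f^+(z,X)=\int_{i\infty}^z f(w)(w-X)^{k-2}\,dw,\qquad F_f^-(z,X)=\overline{\int_{i\infty}^z f(w)(w-X)^{k-2}\,dw}$$ (polynomials in $X$; the bar conjugates coefficients and fixes $X$), $$\phi^{\pm}_{r,s}(z,X)=\sum_{\gamma\in B\backslash\Gamma}\frac{F_f^{\pm}(\gamma z,\gamma X)\,j(\gamma,X)^{k-2}}{j(\gamma,z)^r j(\gamma,\bar z)^s},\qquad \mathcal E_{r,s}(z)=\sum_{\gamma\in B\backslash\Gamma}\frac1{j(\gamma,z)^r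 j(\gamma,\bar z)^s},$$ $$\Lambda_f(\sigma,x)=\int_0^\infty f(x+it)\,t^{\sigma-1}\,dt\quad(x\in\mathbb Q).$$ Let $\mathcal M_{p,q}$ ($p,q\in\mathbb Z$) be the space of real-analytic functions $g:\mathfrak H\to\mathbb C$ such that: $g(z)=O(y^C)$ as $y\to\infty$, uniformly in $x$, for some $C>0$; $g(\gamma z)=j(\gamma,z)^p j(\gamma,\bar z)^q g(z)$ for all $\gamma\in\Gamma$, $z\in\mathfrak H$; and, for some $M\in\mathbb N$ and $a^{(i)}_{m,n}\in\mathbb C$, $$g(z)=\sum_{|i|\le M}y^i\sum_{m,n\ge0}a^{(i)}_{m,n}\,q^m\bar q^n,\qquad q=e^{2\pi iz}, \tag{FE}$$ with absolutely convergent double series. Put $\mathcal M=\bigoplus_{p,q}\mathcal M_{p,q}$. Then all the integrals above and below converge absolutely, and all the sums over $B\backslash\Gamma$ above (coefficientwise in $X$) and below have terms that depend only on the coset and converge absolutely. There are unique functions $\phi^{\pm}_{r,s}(l;z)$, $0\le l\le k-2$, with $$\phi^{\pm}_{r,s}(z,X)=\sum_{l=0}^{k-2}\phi^{\pm}_{r,s}(l;z)\,(X-z)^l(X-\bar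 z)^{k-2-l},$$ and, for $0\le l\le k-2$, with $\alpha_{m,n}=i^{1-2l-m-n}\binom{k-2}{l}\binom lm\binom{k-2-l}n$, $$\phi^{+}_{r,s}(l;z)=(-1)^l\binom{k-2}l(2iy)^{2-k}\left(\int_{i\infty}^z f(w)(w-\bar z)^l(w-z)^{k-2-l}\,dw\right)\mathcal E_{r,s}(z)+\sum_{m=0}^{l}\sum_{n=0}^{k-2-l}\alpha_{m,n}(2iy)^{2-k}\sum_{1\ne\gamma\in B\backslash\Gamma}\frac{\Lambda_f(m+n+1,\gamma^{-1}\infty)\,c_\gamma^{m+n-k+2}}{j(\gamma,z)^{r+l+n+2-k}\,j(\gamma,\bar z)^{s+m-l}},$$ $$\phi^{-}_{r,s}(l;z)=(-1)^l\binom{k-2}l(2iy)^{2-k}\,\overline{\left(\int_{i\infty}^z f(w)(w-\bar z)^{k-2-l}(w-z)^{l}\,dw\right)}\,\mathcal E_{r,s}(z)+\sum_{m=0}^{l}\sum_{n=0}^{k-2-l}\overline{\alpha_{m,n}}\,(2iy)^{2-k}\sum_{1\ne\gamma\in B\backslash\Gamma}\frac{\overline{\Lambda_f(m+n+1,\gamma^{-1}\infty)}\,c_\gamma^{m+n-k+2}}{j(\gamma,z)^{r+l+n+2-k}\,j(\gamma,\bar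 z)^{s+m-l}}.$$ Moreover each $\phi^{\pm}_{r,s}(l;\cdot)$ has a Fourier expansion of the form (FE) and belongs to $\mathcal M_{r+l,\,s+k-2-l}\subset\mathcal M$. -/

import Mathlib

open scoped UpperHalfPlane MatrixGroups ModularForm ComplexConjugate

namespace ModIter

noncomputable section

/-- The subgroup `B = {± T ^ n : n ∈ ℤ}` of `SL(2, ℤ)`. -/
def B : Subgroup SL(2, ℤ) where
  carrier := {γ | ∃ n : ℤ, γ = ModularGroup.T ^ n ∨ γ = -ModularGroup.T ^ n}
  one_mem' := ⟨0, Or.inl (by simp)⟩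
  mul_mem' := by
    rintro a b ⟨m, hm⟩ ⟨n, hn⟩
    refine ⟨m + n, ?_⟩
    rcases hm with rfl | rfl <;> rcases hn with rfl | rfl <;> simp [zpow_add]
  inv_mem' := by
    rintro a ⟨m, hm⟩
    refine ⟨-m, ?_⟩
    rcases hm with rfl | rfl
    · simp
    · right
      rw [inv_eq_iff_mul_eq_one]
      simp

/-- The set `B \ Γ` of cosets `B γ`, `Γ = SL(2, ℤ)`. -/
abbrev Cosets : Type := Quotient (QuotientGroup.rightRel B)

/-- The sum `∑_{γ ∈ B \ Γ} g γ`. It is used for functions `g` with `CosetSummable g`, for which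
it does not depend on the representatives. -/
def cosetSum (g : SL(2, ℤ) → ℂ) : ℂ := ∑' q : Cosets, g q.out

/-- The function `g` is well defined on `B \ Γ` and its sum over `B \ Γ` converges absolutely. -/
def CosetSummable (g : SL(2, ℤ) → ℂ) : Prop :=
  (∀ b ∈ B, ∀ γ : SL(2, ℤ), g (b * γ) = g γ) ∧ Summable fun q : Cosets => g q.out

/-- `j(γ, w) = c w + d`; it is used at `w = z` and at `w = conj z`. -/
def j (γ : SL(2, ℤ)) (w : ℂ) : ℂ := (γ 1 0 : ℂ) * w + (γ 1 1 : ℂ)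

/-- The rational number `γ⁻¹ ∞`, for `γ ∉ B`. -/
def invInfty (γ : SL(2, ℤ)) : ℚ := ((γ⁻¹) 0 0 : ℚ) / ((γ⁻¹) 1 0 : ℚ)

/-! ### Real-analytic modular forms -/

/-- A Fourier expansion
`f z = ∑_{|i| ≤ M} y ^ i ∑_{m, n ≥ 0} a i m n * q ^ m * conj q ^ n`, `q = exp (2 π i z)`,
whose double series converge absolutely. -/
def HasFourierExpansion (f : ℍ → ℂ) : Prop :=
  ∃ (M : ℕ) (a : ℤ → ℕ → ℕ → ℂ), ∀ z : ℍ,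
    let q : ℂ := Complex.exp (2 * Real.pi * Complex.I * z)
    (∀ i ∈ Finset.Icc (-(M : ℤ)) M,
      Summable fun p : ℕ × ℕ => a i p.1 p.2 * q ^ p.1 * (conj q) ^ p.2) ∧
    f z = ∑ i ∈ Finset.Icc (-(M : ℤ)) M,
      (z.im : ℂ) ^ i * ∑' p : ℕ × ℕ, a i p.1 p.2 * q ^ p.1 * (conj q) ^ p.2

/-- `f` belongs to the space `𝓜_{r,s}` of real-analytic modular forms of weights `(r, s)` for
`SL(2, ℤ)`. -/
structure IsRealAnalyticModularForm (r s : ℤ) (f : ℍ → ℂ) : Prop where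
  analytic : AnalyticOnNhd ℝ (fun w : ℂ => f (UpperHalfPlane.ofComplex w)) {w : ℂ | 0 < w.im}
  growth : ∃ C : ℝ, 0 < C ∧ f =O[UpperHalfPlane.atImInfty] fun z : ℍ => z.im ^ C
  invariant : ∀ (γ : SL(2, ℤ)) (z : ℍ), f (γ • z) = j γ z ^ r * j γ (conj (z : ℂ)) ^ s * f z
  fourier : HasFourierExpansion f

/-- The general term `j(γ, z) ^ (-r) j(γ, conj z) ^ (-s)` of the series `𝓔_{r,s}`. -/
def eisensteinTerm (r s : ℤ) (z : ℍ) (γ : SL(2, ℤ)) : ℂ :=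
  1 / (j γ z ^ r * j γ (conj (z : ℂ)) ^ s)

/-- The real-analytic Eisenstein series `𝓔_{r,s}`. -/
def eisenstein (r s : ℤ) (z : ℍ) : ℂ := cosetSum (eisensteinTerm r s z)

/-! ### Eichler integrals and additively twisted L-values -/

/-- The value at `w` of a function on the upper half-plane. -/
def ev (f : ℍ → ℂ) (w : ℂ) : ℂ := f (UpperHalfPlane.ofComplex w)

/-- The integral `∫_{i∞}^z g(w) dw` along the vertical line through `z`. -/
def intFromCusp (g : ℂ → ℂ) (z : ℂ) : ℂ :=
  -∫ t in Set.Ioi (0 : ℝ), g (z + Complex.I * t) * Complex.I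

/-- `F_f^+(z, X) = ∫_{i∞}^z f(w) (w - X) ^ (k - 2) dw`, a polynomial in `X`, integrated
coefficientwise. -/
def eichlerPlus (k : ℕ) (f : ℍ → ℂ) (z : ℍ) : Polynomial ℂ :=
  ∑ i ∈ Finset.range (k - 1), Polynomial.monomial i
    (intFromCusp
      (fun w => ev f w * ((Polynomial.C w - Polynomial.X) ^ (k - 2) : Polynomial ℂ).coeff i) z)

/-- `F_f^-(z, X)`: the complex conjugate of `F_f^+(z, X)`, where conjugation fixes `X`. -/
def eichlerMinus (k : ℕ) (f : ℍ → ℂ) (z : ℍ) : Polynomial ℂ :=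
  (eichlerPlus k f z).map (starRingEnd ℂ)

/-- `P(γ X) j(γ, X) ^ n`, for a polynomial `P` of degree at most `n`. -/
def polySlash (n : ℕ) (γ : SL(2, ℤ)) (P : Polynomial ℂ) : Polynomial ℂ :=
  ∑ i ∈ Finset.range (n + 1), Polynomial.C (P.coeff i) *
    (Polynomial.C (γ 0 0 : ℂ) * Polynomial.X + Polynomial.C (γ 0 1 : ℂ)) ^ i *
    (Polynomial.C (γ 1 0 : ℂ) * Polynomial.X + Polynomial.C (γ 1 1 : ℂ)) ^ (n - i)

/-- The coefficient of `X ^ i` in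
`F(γ z, γ X) j(γ, X) ^ (k - 2) / (j(γ, z) ^ r j(γ, conj z) ^ s)`. -/
def phiTerm (k : ℕ) (r s : ℤ) (F : ℍ → Polynomial ℂ) (z : ℍ) (i : ℕ) (γ : SL(2, ℤ)) : ℂ :=
  (polySlash (k - 2) γ (F (γ • z))).coeff i / (j γ z ^ r * j γ (conj (z : ℂ)) ^ s)

/-- `∑_{γ ∈ B \ Γ} F(γ z, γ X) j(γ, X) ^ (k - 2) / (j(γ, z) ^ r j(γ, conj z) ^ s)`, a polynomial
in `X`, summed coefficientwise. For `F = F_f^±` this is `φ_{r,s}^±(f; z, X)`. -/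
def phi (k : ℕ) (r s : ℤ) (F : ℍ → Polynomial ℂ) (z : ℍ) : Polynomial ℂ :=
  ∑ i ∈ Finset.range (k - 1), Polynomial.monomial i (cosetSum (phiTerm k r s F z i))

/-- `Φ(z, X) = ∑_{i=0}^{k-2} c_i(z) (X - z) ^ i (X - conj z) ^ (k - 2 - i)`. -/
def IsExpansion (k : ℕ) (Φ : ℍ → Polynomial ℂ) (c : Fin (k - 1) → ℍ → ℂ) : Prop :=
  ∀ z : ℍ, Φ z = ∑ i : Fin (k - 1), Polynomial.C (c i z) *
    (Polynomial.X - Polynomial.C (z : ℂ)) ^ (i : ℕ) *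
    (Polynomial.X - Polynomial.C (conj (z : ℂ))) ^ (k - 2 - (i : ℕ))

/-- The integrand `f(x + i t) t ^ (s - 1)` of `Λ_f(s, x)`. -/
def lambdaIntegrand (f : ℍ → ℂ) (s : ℂ) (x : ℚ) (t : ℝ) : ℂ :=
  ev f ((x : ℂ) + Complex.I * t) * (t : ℂ) ^ (s - 1)

/-- The completed additively twisted L-function `Λ_f(s, x) = ∫_0^∞ f(x + i t) t ^ (s - 1) dt`. -/
def Lambda (f : ℍ → ℂ) (s : ℂ) (x : ℚ) : ℂ :=
  ∫ t in Set.Ioi (0 : ℝ), lambdaIntegrand f s x t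

open Classical in
/-- `u(γ⁻¹ ∞) c ^ e / (j(γ, z) ^ p j(γ, conj z) ^ t)`, extended by `0` to the trivial coset, so
that its sum over `B \ Γ` is the sum over the cosets `≠ 1`. -/
def twistedTerm (u : ℚ → ℂ) (e p t : ℤ) (z : ℍ) (γ : SL(2, ℤ)) : ℂ :=
  if γ ∈ B then 0
  else u (invInfty γ) * (γ 1 0 : ℂ) ^ e / (j γ z ^ p * j γ (conj (z : ℂ)) ^ t)

/-- `α_{m,n} = i ^ (1 - 2 l - m - n) (k-2 choose l) (l choose m) (k-2-l choose n)`. -/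
def alpha (k l m n : ℕ) : ℂ :=
  Complex.I ^ (1 - 2 * (l : ℤ) - m - n) *
    ((k - 2).choose l : ℂ) * (l.choose m : ℂ) * ((k - 2 - l).choose n : ℂ)

end

end ModIter

open ModIter

/-! The differential `f(w) (w - X)^(k-2) dw` is invariant under `Γ` acting on `w` and `X` together.
Hence `F(γz, γX) j(γ, X)^(k-2)` is `F(z, X)` plus the integral of the same form from `γ⁻¹∞` to `i∞`,
which is absent when `γ ∈ B` (`eval_polySlash_eichlerPlus_smul`). Summed over cosets, `F(z, X)`
factors out and leaves `𝓔_{r,s}`; the periods produce the twisted series.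

The expansion in `X` comes from `2iy (w - X) = (X - conj z)(w - z) - (X - z)(w - conj z)` and the
binomial theorem. On the line `w = γ⁻¹∞ + it` one has `w - z = it - j(γ, z)/c`, and likewise for
`conj z`, so each period is a combination of the values `Λ_f(m+n+1, γ⁻¹∞)` (`cuspPeriod_dualBasis`).

Convergence rests on `Λ_f(n+1, x) = O(c^(k-1))` for `x` of denominator `c`
(`exists_norm_Lambda_le`). With `c ≤ |cz+d|/y`, a term of the twisted series is
`O(|cz+d|^(-(r+s-k+1)))` for fixed `z`, and parity turns `r+s > k` into `r+s ≥ k+2`, so the exponent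
is at most `-3`.

For the Fourier expansion, the pairs `(c, d)` are grouped by `d` modulo `c`. Each group is a weight
times `∑ (z+n)^(-p) (conj z+n)^(-t)` evaluated at a real translate of `z`. Partial fractions reduce
this sum to the Lipschitz formula and the cotangent series (`hasFourierExpansion_periodicSum`). A
real translation only rotates `q`, so a summable combination of translates still has an expansion
(`HasFourierExpansion.tsum_vadd`). Eichler integrals are expanded by integrating the `q`-series of
`f` termwise.

Analyticity and polynomial growth follow from the Fourier expansion alone. The weights follow by
reindexing the cosets and comparing coefficients in the basis `(X - z)^l (X - conj z)^(k-2-l)`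
(`IsExpansion.smul_eq`). The minus case is the complex conjugate of the plus case, with `l` replaced
by `k-2-l` and `i` by `-i`. -/

namespace ModIter

noncomputable section

/-! ### Fourier expansions -/

/-- The parameter `q = exp (2 π i z)`. -/
def nome (z : ℍ) : ℂ := Complex.exp (2 * Real.pi * Complex.I * z)

lemma norm_nome (z : ℍ) : ‖nome z‖ = Real.exp (-(2 * Real.pi * z.im)) := by
  rw [nome, Complex.norm_exp]
  congr 1
  simp [Complex.mul_re]

lemma norm_nome_lt_one (z : ℍ) : ‖nome z‖ < 1 := by
  rw [norm_nome, Real.exp_lt_one_iff]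
  have := z.im_pos
  have := Real.pi_pos
  have : 0 < 2 * Real.pi * z.im := by positivity
  linarith

lemma exists_norm_nome_eq {ρ : ℝ} (h0 : 0 < ρ) (h1 : ρ < 1) : ∃ z : ℍ, ‖nome z‖ = ρ := by
  have hl : 0 < -Real.log ρ / (2 * Real.pi) :=
    div_pos (neg_pos.2 (Real.log_neg h0 h1)) (by positivity)
  refine ⟨⟨⟨0, -Real.log ρ / (2 * Real.pi)⟩, hl⟩, ?_⟩
  rw [norm_nome]
  have : (2 * Real.pi * (-Real.log ρ / (2 * Real.pi))) = -Real.log ρ := by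
    field_simp
  change Real.exp (-(2 * Real.pi * (-Real.log ρ / (2 * Real.pi)))) = ρ
  rw [this, neg_neg, Real.exp_log h0]

/-- The function `g` is the sum of a double series in `q` and `conj q` converging absolutely on the
upper half-plane. -/
def IsDoubleSeries (g : ℍ → ℂ) : Prop :=
  ∃ a : ℕ × ℕ → ℂ, ∀ z : ℍ,
    HasSum (fun p : ℕ × ℕ => a p * nome z ^ p.1 * conj (nome z) ^ p.2) (g z)

lemma hasSum_sum_antidiagonal_mul {A : Type*} [AddCommMonoid A] [Finset.HasAntidiagonal A]
    {u v : A → ℂ} {s t : ℂ} (hu : HasSum u s) (hv : HasSum v t) :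
    HasSum (fun p => ∑ x ∈ Finset.HasAntidiagonal.antidiagonal p, u x.1 * v x.2) (s * t) := by
  have hs := summable_mul_of_summable_norm hu.summable.norm hv.summable.norm
  have h1 := (summable_sum_mul_antidiagonal_of_summable_mul hs).hasSum
  rwa [← hu.summable.tsum_mul_tsum_eq_tsum_sum_antidiagonal hv.summable hs,
    hu.tsum_eq, hv.tsum_eq] at h1

namespace IsDoubleSeries

variable {g h : ℍ → ℂ}

lemma zero : IsDoubleSeries 0 := ⟨0, fun z => by simp⟩

lemma add (hg : IsDoubleSeries g) (hh : IsDoubleSeries h) : IsDoubleSeries (g + h) := by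
  obtain ⟨a, ha⟩ := hg
  obtain ⟨b, hb⟩ := hh
  refine ⟨a + b, fun z => ?_⟩
  simpa [add_mul] using (ha z).add (hb z)

lemma smul (c : ℂ) (hg : IsDoubleSeries g) : IsDoubleSeries (c • g) := by
  obtain ⟨a, ha⟩ := hg
  refine ⟨c • a, fun z => ?_⟩
  simpa [mul_assoc] using (ha z).mul_left c

lemma star (hg : IsDoubleSeries g) : IsDoubleSeries fun z => conj (g z) := by
  obtain ⟨a, ha⟩ := hg
  refine ⟨fun p => conj (a p.swap), fun z => ?_⟩
  have := (Equiv.prodComm ℕ ℕ).hasSum_iff.2 ((ha z).map (starRingEnd ℂ) Complex.continuous_conj)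
  refine this.congr_fun fun p => ?_
  simp [mul_right_comm]

lemma mul (hg : IsDoubleSeries g) (hh : IsDoubleSeries h) : IsDoubleSeries (g * h) := by
  obtain ⟨a, ha⟩ := hg
  obtain ⟨b, hb⟩ := hh
  -- The product is a Cauchy product indexed by the monoid `ℕ × ℕ`, whose antidiagonals are finite
  -- because order intervals are.
  obtain ⟨_⟩ : Nonempty (Finset.HasAntidiagonal (ℕ × ℕ)) :=
    ⟨Finset.HasAntidiagonal.antidiagonalOfLocallyFinite⟩
  refine ⟨fun p => ∑ x ∈ Finset.HasAntidiagonal.antidiagonal p, a x.1 * b x.2, fun z => ?_⟩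
  rw [Pi.mul_apply]
  refine (hasSum_sum_antidiagonal_mul (ha z) (hb z)).congr_fun fun p => ?_
  rw [Finset.sum_mul, Finset.sum_mul]
  refine Finset.sum_congr rfl fun x hx => ?_
  have hx := Finset.HasAntidiagonal.mem_antidiagonal.1 hx
  have h1 : p.1 = x.1.1 + x.2.1 := by rw [← hx, Prod.fst_add]
  have h2 : p.2 = x.1.2 + x.2.2 := by rw [← hx, Prod.snd_add]
  rw [h1, h2, pow_add, pow_add]
  ring

lemma of_powerSeries {a : ℕ → ℂ} (h : ∀ z, HasSum (fun n => a n * nome z ^ n) (g z)) :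
    IsDoubleSeries g := by
  refine ⟨fun p => if p.2 = 0 then a p.1 else 0, fun z => ?_⟩
  have hi : Function.Injective fun n : ℕ => (n, 0) := fun _ _ h => by simpa using h
  rw [← hi.hasSum_iff]
  · simpa [Function.comp_def] using h z
  · rintro ⟨m, n⟩ hx
    have : n ≠ 0 := by
      rintro rfl
      exact hx ⟨m, rfl⟩
    simp [this]

lemma const (c : ℂ) : IsDoubleSeries fun _ => c := by
  refine of_powerSeries (a := fun n => if n = 0 then c else 0) fun z => ?_
  simpa using hasSum_ite_eq (0 : ℕ) c |>.congr_fun fun n => by split_ifs with h <;> simp [h]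

end IsDoubleSeries

/-- Hiding the coefficients inside functions `D i` turns closure properties into algebra of double
series. Outside `|i| ≤ M` the definition says nothing about convergence, so there `D i` is taken to
be `0`. -/
lemma hasFourierExpansion_iff {f : ℍ → ℂ} :
    HasFourierExpansion f ↔ ∃ (M : ℕ) (D : ℤ → ℍ → ℂ), (∀ i, IsDoubleSeries (D i)) ∧
      ∀ z, f z = ∑ i ∈ Finset.Icc (-(M : ℤ)) M, (z.im : ℂ) ^ i * D i z := by
  constructor
  · rintro ⟨M, a, h⟩
    refine ⟨M, fun i => if i ∈ Finset.Icc (-(M : ℤ)) M then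
      (fun z => ∑' p : ℕ × ℕ, a i p.1 p.2 * nome z ^ p.1 * conj (nome z) ^ p.2) else 0,
      fun i => ?_, fun z => ?_⟩
    · dsimp only
      split_ifs with hi
      · exact ⟨fun p => a i p.1 p.2, fun z => ((h z).1 i hi).hasSum⟩
      · exact .zero
    · rw [(h z).2]
      refine Finset.sum_congr rfl fun i hi => ?_
      simp only [if_pos hi]
      rfl
  · rintro ⟨M, D, hD, h⟩
    choose a ha using hD
    refine ⟨M, fun i m n => a i (m, n), fun z => ⟨fun i _ => (ha i z).summable, ?_⟩⟩
    rw [h]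
    exact Finset.sum_congr rfl fun i _ => by rw [← (ha i z).tsum_eq]; rfl

lemma hasFourierExpansion_of_finset {f : ℍ → ℂ} (s : Finset ℤ) (D : ℤ → ℍ → ℂ)
    (hD : ∀ i, IsDoubleSeries (D i)) (h : ∀ z, f z = ∑ i ∈ s, (z.im : ℂ) ^ i * D i z) :
    HasFourierExpansion f := by
  refine hasFourierExpansion_iff.2 ⟨s.sup Int.natAbs, fun i => if i ∈ s then D i else 0,
    fun i => ?_, fun z => ?_⟩
  · dsimp only
    split_ifs
    exacts [hD i, .zero]
  · rw [h]
    refine Finset.sum_subset_zero_on_sdiff (fun i hi => ?_) (fun i hi => ?_) fun i hi => ?_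
    · have := Finset.le_sup (f := Int.natAbs) hi
      rw [Finset.mem_Icc]
      omega
    · simp [(Finset.mem_sdiff.1 hi).2]
    · simp [hi]

lemma HasFourierExpansion.add {f g : ℍ → ℂ} (hf : HasFourierExpansion f)
    (hg : HasFourierExpansion g) : HasFourierExpansion (f + g) := by
  obtain ⟨M, D, hD, hf⟩ := hasFourierExpansion_iff.1 hf
  obtain ⟨N, E, hE, hg⟩ := hasFourierExpansion_iff.1 hg
  refine hasFourierExpansion_of_finset (Finset.Icc (-(M : ℤ)) M ∪ Finset.Icc (-(N : ℤ)) N)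
    (fun i => (if i ∈ Finset.Icc (-(M : ℤ)) M then D i else 0) +
      (if i ∈ Finset.Icc (-(N : ℤ)) N then E i else 0)) (fun i => ?_) fun z => ?_
  · refine .add ?_ ?_ <;> split_ifs
    exacts [hD i, .zero, hE i, .zero]
  · simp only [Pi.add_apply, mul_add, Finset.sum_add_distrib, hf, hg]
    congr 1
    · refine Finset.sum_subset_zero_on_sdiff Finset.subset_union_left (fun i hi => ?_) fun i hi => ?_
      · simp only [if_neg (Finset.mem_sdiff.1 hi).2, Pi.zero_apply, mul_zero]
      · rw [if_pos hi]
    · refine Finset.sum_subset_zero_on_sdiff Finset.subset_union_right (fun i hi => ?_) fun i hi => ?_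
      · simp only [if_neg (Finset.mem_sdiff.1 hi).2, Pi.zero_apply, mul_zero]
      · rw [if_pos hi]

lemma IsDoubleSeries.im_zpow_mul {g : ℍ → ℂ} (hg : IsDoubleSeries g) (i : ℤ) :
    HasFourierExpansion fun z => (z.im : ℂ) ^ i * g z :=
  hasFourierExpansion_of_finset {i} (fun _ => g) (fun _ => hg) fun z => by simp

lemma IsDoubleSeries.hasFourierExpansion {g : ℍ → ℂ} (hg : IsDoubleSeries g) :
    HasFourierExpansion g := by simpa using hg.im_zpow_mul 0

/-- The functions with a Fourier expansion form a vector space. -/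
def fourierSubmodule : Submodule ℂ (ℍ → ℂ) where
  carrier := {f | HasFourierExpansion f}
  zero_mem' := IsDoubleSeries.zero.hasFourierExpansion
  add_mem' := .add
  smul_mem' := by
    intro c f hf
    obtain ⟨M, D, hD, hf⟩ := hasFourierExpansion_iff.1 hf
    refine hasFourierExpansion_iff.2 ⟨M, fun i => c • D i, fun i => (hD i).smul c, fun z => ?_⟩
    simp [hf, Finset.mul_sum, mul_left_comm]

lemma mem_fourierSubmodule {f : ℍ → ℂ} : f ∈ fourierSubmodule ↔ HasFourierExpansion f := Iff.rfl

namespace HasFourierExpansion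

variable {f g : ℍ → ℂ}

lemma sum {ι : Type*} {s : Finset ι} {F : ι → ℍ → ℂ} (h : ∀ i ∈ s, HasFourierExpansion (F i)) :
    HasFourierExpansion fun z => ∑ i ∈ s, F i z := by
  have : (∑ i ∈ s, F i) ∈ fourierSubmodule := Submodule.sum_mem _ h
  simpa only [mem_fourierSubmodule, Finset.sum_fn] using this

lemma const_mul (c : ℂ) (hf : HasFourierExpansion f) : HasFourierExpansion fun z => c * f z :=
  fourierSubmodule.smul_mem c hf

lemma sub (hf : HasFourierExpansion f) (hg : HasFourierExpansion g) :
    HasFourierExpansion fun z => f z - g z :=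
  fourierSubmodule.sub_mem hf hg

lemma im_zpow_mul (j : ℤ) (hf : HasFourierExpansion f) :
    HasFourierExpansion fun z => (z.im : ℂ) ^ j * f z := by
  obtain ⟨M, D, hD, hf⟩ := hasFourierExpansion_iff.1 hf
  have : (fun z : ℍ => (z.im : ℂ) ^ j * f z) =
      fun z => ∑ i ∈ Finset.Icc (-(M : ℤ)) M, (z.im : ℂ) ^ (j + i) * D i z := by
    funext z
    rw [hf, Finset.mul_sum]
    refine Finset.sum_congr rfl fun i _ => ?_
    rw [zpow_add₀ (by exact_mod_cast z.im_ne_zero), mul_assoc]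
  rw [this]
  exact sum fun i _ => (hD i).im_zpow_mul _

lemma mul (hf : HasFourierExpansion f) (hg : HasFourierExpansion g) :
    HasFourierExpansion fun z => f z * g z := by
  obtain ⟨M, D, hD, hf⟩ := hasFourierExpansion_iff.1 hf
  obtain ⟨N, E, hE, hg⟩ := hasFourierExpansion_iff.1 hg
  have : (fun z => f z * g z) = fun z : ℍ => ∑ i ∈ Finset.Icc (-(M : ℤ)) M,
      ∑ j ∈ Finset.Icc (-(N : ℤ)) N, (z.im : ℂ) ^ (i + j) * (D i * E j) z := by
    funext z
    rw [hf, hg, Finset.sum_mul_sum]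
    refine Finset.sum_congr rfl fun i _ => Finset.sum_congr rfl fun j _ => ?_
    rw [zpow_add₀ (by exact_mod_cast z.im_ne_zero), Pi.mul_apply]
    ring
  rw [this]
  exact sum fun i _ => sum fun j _ => ((hD i).mul (hE j)).im_zpow_mul _

lemma star (hf : HasFourierExpansion f) : HasFourierExpansion fun z => conj (f z) := by
  obtain ⟨M, D, hD, hf⟩ := hasFourierExpansion_iff.1 hf
  refine hasFourierExpansion_iff.2 ⟨M, _, fun i => (hD i).star, fun z => ?_⟩
  simp [hf]

lemma const (c : ℂ) : HasFourierExpansion fun _ => c := (IsDoubleSeries.const c).hasFourierExpansion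

/-- Averaging over real translations preserves Fourier expansions. -/
lemma tsum_vadd {ι : Type*} {w : ι → ℂ} {x : ι → ℝ} (hw : Summable fun i => ‖w i‖)
    (hf : HasFourierExpansion f) : HasFourierExpansion fun z => ∑' i, w i * f (x i +ᵥ z) := by
  obtain ⟨M, D, hD, hf⟩ := hasFourierExpansion_iff.1 hf
  choose a ha using hD
  -- Translation by `x j` multiplies `q` by the unit complex number `e j`. Absolute values are
  -- unchanged, so the sum over `j` can be absorbed into the coefficients.
  let e : ι → ℂ := fun j => Complex.exp (2 * Real.pi * Complex.I * x j)
  have he : ∀ j, ‖e j‖ = 1 := fun j => by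
    have : (2 * Real.pi * Complex.I * x j : ℂ) = ((2 * Real.pi * x j : ℝ) : ℂ) * Complex.I := by
      push_cast; ring
    simp only [e, this, Complex.norm_exp_ofReal_mul_I]
  have hnome : ∀ j z, nome (x j +ᵥ z) = e j * nome z := fun j z => by
    simp only [nome, e, UpperHalfPlane.coe_vadd, ← Complex.exp_add, mul_add]
  have key : ∀ i (z : ℍ), HasSum (fun u : ι × (ℕ × ℕ) =>
      w u.1 * (a i u.2 * nome (x u.1 +ᵥ z) ^ u.2.1 * conj (nome (x u.1 +ᵥ z)) ^ u.2.2))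
      (∑' j, w j * D i (x j +ᵥ z)) := by
    intro i z
    have hs : Summable (fun u : ι × (ℕ × ℕ) =>
      w u.1 * (a i u.2 * nome (x u.1 +ᵥ z) ^ u.2.1 * conj (nome (x u.1 +ᵥ z)) ^ u.2.2)) := by
      refine Summable.of_norm ?_
      refine (Summable.mul_of_nonneg hw (ha i z).summable.norm (fun _ => norm_nonneg _)
        fun _ => norm_nonneg _).congr fun u => ?_
      simp [hnome, he]
    have h1 := hs.hasSum.prod_fiberwise fun j => (ha i (x j +ᵥ z)).mul_left (w j)
    rw [h1.tsum_eq]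
    exact hs.hasSum
  refine hasFourierExpansion_iff.2 ⟨M, fun i z => ∑' j, w j * D i (x j +ᵥ z),
    fun i => ⟨fun p => a i p * ∑' j, w j * (e j ^ p.1 * conj (e j) ^ p.2), fun z => ?_⟩,
    fun z => ?_⟩
  · have h1 := (Equiv.prodComm _ _).hasSum_iff.2 (key i z)
    have h2 : ∀ p : ℕ × ℕ, Summable fun j => w j * (e j ^ p.1 * conj (e j) ^ p.2) := fun p =>
      .of_norm <| hw.congr fun j => by simp [he]
    refine h1.prod_fiberwise fun p => ?_
    have h3 := (h2 p).hasSum.mul_left (a i p * nome z ^ p.1 * conj (nome z) ^ p.2)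
    have h4 : a i p * (∑' j, w j * (e j ^ p.1 * conj (e j) ^ p.2)) * nome z ^ p.1 *
        conj (nome z) ^ p.2 = a i p * nome z ^ p.1 * conj (nome z) ^ p.2 *
        ∑' j, w j * (e j ^ p.1 * conj (e j) ^ p.2) := by ring
    rw [h4]
    refine h3.congr_fun fun j => ?_
    simp only [Function.comp_apply, Equiv.prodComm_apply, Prod.swap, hnome, map_mul, mul_pow]
    ring
  · simp only [hf, UpperHalfPlane.vadd_im, Finset.mul_sum]
    rw [Summable.tsum_finsetSum]
    · refine Finset.sum_congr rfl fun i _ => ?_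
      rw [← tsum_mul_left]
      exact tsum_congr fun j => by ring
    · intro i _
      have h1 := (key i z).summable.prod.congr fun j =>
        ((ha i (x j +ᵥ z)).mul_left (w j)).tsum_eq
      exact (h1.mul_left ((z.im : ℂ) ^ i)).congr fun j => by ring

end HasFourierExpansion

end

end ModIter

namespace ModIter

noncomputable section

/-! ### Analyticity and growth of functions with a Fourier expansion -/

/-- The formal power series in two variables with coefficients `a`. -/
def twoVarSeries (a : ℕ × ℕ → ℂ) : FormalMultilinearSeries ℂ (ℂ × ℂ) ℂ := fun n =>
  ∑ p ∈ Finset.HasAntidiagonal.antidiagonal n,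
    a p • (ContinuousMultilinearMap.mkPiAlgebraFin ℂ n ℂ).compContinuousLinearMap fun t =>
      if (t : ℕ) < p.1 then ContinuousLinearMap.fst ℂ ℂ ℂ else ContinuousLinearMap.snd ℂ ℂ ℂ

lemma twoVarSeries_apply (a : ℕ × ℕ → ℂ) (n : ℕ) (w : ℂ × ℂ) :
    twoVarSeries a n (fun _ => w) =
      ∑ p ∈ Finset.HasAntidiagonal.antidiagonal n, a p * w.1 ^ p.1 * w.2 ^ p.2 := by
  simp only [twoVarSeries, sum_apply, smul_apply,
    ContinuousMultilinearMap.compContinuousLinearMap_apply,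
    ContinuousMultilinearMap.mkPiAlgebraFin_apply, smul_eq_mul, mul_assoc]
  refine Finset.sum_congr rfl fun p hp => ?_
  rw [List.prod_ofFn]
  congr 1
  have hp := Finset.HasAntidiagonal.mem_antidiagonal.1 hp
  subst hp
  rw [Fin.prod_univ_add]
  simp

lemma norm_twoVarSeries_le (a : ℕ × ℕ → ℂ) (n : ℕ) :
    ‖twoVarSeries a n‖ ≤ ∑ p ∈ Finset.HasAntidiagonal.antidiagonal n, ‖a p‖ := by
  refine (norm_sum_le _ _).trans (Finset.sum_le_sum fun p _ => ?_)
  rw [norm_smul]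
  refine mul_le_of_le_one_right (norm_nonneg _) ?_
  refine (ContinuousMultilinearMap.norm_compContinuousLinearMap_le _ _).trans ?_
  rw [ContinuousMultilinearMap.norm_mkPiAlgebraFin, one_mul]
  refine Finset.prod_le_one (fun _ _ => norm_nonneg _) fun t _ => ?_
  split_ifs
  exacts [ContinuousLinearMap.norm_fst_le .., ContinuousLinearMap.norm_snd_le ..]

/-- Grouping the double series by total degree gives a formal multilinear series; absolute
convergence at `(ρ, ρ)` bounds its radius below by `ρ`. -/
lemma analyticAt_tsum_two_var {a : ℕ × ℕ → ℂ} {ρ : NNReal}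
    (ha : Summable fun p : ℕ × ℕ => ‖a p‖ * (ρ : ℝ) ^ (p.1 + p.2)) {w : ℂ × ℂ} (hw : ‖w‖ < ρ) :
    AnalyticAt ℂ (fun v : ℂ × ℂ => ∑' p : ℕ × ℕ, a p * v.1 ^ p.1 * v.2 ^ p.2) w := by
  have hsig := (Finset.HasAntidiagonal.sigmaAntidiagonalEquivProd (A := ℕ)).summable_iff.2 ha
  have hrad : (ρ : ENNReal) ≤ (twoVarSeries a).radius := by
    refine FormalMultilinearSeries.le_radius_of_summable _ ?_
    refine Summable.of_nonneg_of_le (fun n => by positivity) (fun n => ?_) hsig.sigma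
    refine (mul_le_mul_of_nonneg_right (norm_twoVarSeries_le a n) (by positivity)).trans ?_
    rw [tsum_fintype, Finset.univ_eq_attach, Finset.sum_mul,
      ← Finset.sum_attach (Finset.HasAntidiagonal.antidiagonal n)]
    refine le_of_eq (Finset.sum_congr rfl fun p _ => ?_)
    have := Finset.HasAntidiagonal.mem_antidiagonal.1 p.2
    simp [this]
  have hρ : 0 < ρ := by
    have := (norm_nonneg w).trans_lt hw
    exact_mod_cast this
  have hball := (twoVarSeries a).hasFPowerSeriesOnBall
    ((ENNReal.coe_pos.2 hρ).trans_le hrad) |>.mono (ENNReal.coe_pos.2 hρ) hrad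
  have hw' : w ∈ Metric.eball (0 : ℂ × ℂ) ρ := by
    simpa using hw
  refine (hball.analyticAt_of_mem hw').congr ?_
  filter_upwards [Metric.isOpen_eball.mem_nhds hw'] with v hv
  have hv : ‖v‖ < ρ := by simpa using hv
  have hs : Summable fun p : ℕ × ℕ => a p * v.1 ^ p.1 * v.2 ^ p.2 := by
    refine Summable.of_norm (ha.of_nonneg_of_le (fun _ => norm_nonneg _) fun p => ?_)
    rw [norm_mul, norm_mul, norm_pow, norm_pow, mul_assoc, pow_add]
    have h1 : ‖v.1‖ ≤ ρ := (norm_fst_le v).trans hv.le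
    have h2 : ‖v.2‖ ≤ ρ := (norm_snd_le v).trans hv.le
    gcongr
  have hs' := ((Finset.HasAntidiagonal.sigmaAntidiagonalEquivProd (A := ℕ)).summable_iff.2
    hs).tsum_sigma
  rw [Function.comp_def] at hs'
  rw [← (Finset.HasAntidiagonal.sigmaAntidiagonalEquivProd (A := ℕ)).tsum_eq, hs',
    FormalMultilinearSeries.sum]
  refine tsum_congr fun n => ?_
  rw [twoVarSeries_apply, tsum_fintype, Finset.univ_eq_attach,
    ← Finset.sum_attach (Finset.HasAntidiagonal.antidiagonal n)]
  rfl

/-- The function is a holomorphic series in two variables composed with the real-analytic map `w ↦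
(q, conj q)`. -/
lemma IsDoubleSeries.analyticOnNhd {g : ℍ → ℂ} (hg : IsDoubleSeries g) :
    AnalyticOnNhd ℝ (fun w : ℂ => g (UpperHalfPlane.ofComplex w)) {w : ℂ | 0 < w.im} := by
  obtain ⟨a, ha⟩ := hg
  intro w hw
  let e : ℂ → ℂ := fun w => Complex.exp (2 * Real.pi * Complex.I * w)
  have hen : ∀ z : ℍ, e z = nome z := fun z => rfl
  have hew : ‖e w‖ < 1 := norm_nome_lt_one ⟨w, hw⟩
  -- Convergence at a point of `ℍ` where `‖q‖ = ρ` supplies the absolute convergence on a polydisc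
  -- strictly larger than needed.
  obtain ⟨ρ, hρ1, hρ2⟩ := exists_between hew
  have hρ0 : 0 < ρ := (norm_nonneg _).trans_lt hρ1
  obtain ⟨z, hz⟩ := exists_norm_nome_eq hρ0 hρ2
  have hs : Summable fun p : ℕ × ℕ => ‖a p‖ * ((⟨ρ, hρ0.le⟩ : NNReal) : ℝ) ^ (p.1 + p.2) :=
    (ha z).summable.norm.congr fun p => by
      simp [hz, pow_add, mul_assoc]
  have h1 := analyticAt_tsum_two_var hs (w := (e w, conj (e w))) (by
    rw [Prod.norm_def]
    rw [RCLike.norm_conj, max_self]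
    exact hρ1)
  have he : AnalyticAt ℝ e w := by
    have : AnalyticAt ℂ e w := by fun_prop
    exact this.restrictScalars
  have hc : AnalyticAt ℝ (fun w => conj (e w)) w :=
    (Complex.conjCLE : ℂ →L[ℝ] ℂ).analyticAt _ |>.comp he
  have h3 := AnalyticAt.fun_comp (f := fun w => (e w, conj (e w)))
    (h1.restrictScalars (𝕜 := ℝ)) (he.prod hc)
  refine h3.congr ?_
  filter_upwards [(isOpen_lt continuous_const Complex.continuous_im).mem_nhds hw] with v hv
  have hv : 0 < v.im := hv
  have h2 := (ha (UpperHalfPlane.ofComplex v)).tsum_eq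
  rw [← hen, UpperHalfPlane.ofComplex_apply_of_im_pos hv] at h2
  rw [UpperHalfPlane.ofComplex_apply_of_im_pos hv, ← h2]

lemma HasFourierExpansion.analyticOnNhd {f : ℍ → ℂ} (hf : HasFourierExpansion f) :
    AnalyticOnNhd ℝ (fun w : ℂ => f (UpperHalfPlane.ofComplex w)) {w : ℂ | 0 < w.im} := by
  obtain ⟨M, D, hD, hf⟩ := hasFourierExpansion_iff.1 hf
  intro w hw
  have him : AnalyticAt ℝ (fun v : ℂ => ((v.im : ℝ) : ℂ)) w :=
    (Complex.ofRealCLM ∘L Complex.imCLM).analyticAt w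
  have h1 : AnalyticAt ℝ (fun v : ℂ => ∑ i ∈ Finset.Icc (-(M : ℤ)) M,
      ((v.im : ℝ) : ℂ) ^ i * D i (UpperHalfPlane.ofComplex v)) w := by
    refine Finset.analyticAt_fun_sum _ fun i _ => (him.fun_zpow ?_).fun_mul ((hD i).analyticOnNhd w hw)
    exact_mod_cast (ne_of_gt hw)
  refine h1.congr ?_
  filter_upwards [(isOpen_lt continuous_const Complex.continuous_im).mem_nhds hw] with v hv
  rw [hf]
  simp [UpperHalfPlane.ofComplex_apply_of_im_pos hv]

lemma IsDoubleSeries.isBigO_one {g : ℍ → ℂ} (hg : IsDoubleSeries g) :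
    g =O[UpperHalfPlane.atImInfty] fun _ => (1 : ℝ) := by
  obtain ⟨a, ha⟩ := hg
  -- For `y ≥ 1` one has `‖q(z)‖ ≤ ‖q(i)‖`, so the sum of absolute values at `i` is a bound.
  refine Asymptotics.IsBigO.of_bound (∑' p : ℕ × ℕ, ‖a p * nome UpperHalfPlane.I ^ p.1 *
    conj (nome UpperHalfPlane.I) ^ p.2‖) ?_
  have : ∀ᶠ z : ℍ in UpperHalfPlane.atImInfty, 1 ≤ z.im :=
    Filter.eventually_comap.2 <| (Filter.eventually_ge_atTop 1).mono fun y hy z hz => hz ▸ hy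
  filter_upwards [this] with z hz
  rw [← (ha z).tsum_eq, norm_one, mul_one]
  have hle : ‖nome z‖ ≤ ‖nome UpperHalfPlane.I‖ := by
    rw [norm_nome, norm_nome, UpperHalfPlane.I_im]
    gcongr
  refine (norm_tsum_le_tsum_norm (ha z).summable.norm).trans
    ((ha z).summable.norm.tsum_le_tsum (fun p => ?_) (ha _).summable.norm)
  simp only [norm_mul, norm_pow, RCLike.norm_conj]
  gcongr

lemma HasFourierExpansion.growth {f : ℍ → ℂ} (hf : HasFourierExpansion f) :
    ∃ C : ℝ, 0 < C ∧ f =O[UpperHalfPlane.atImInfty] fun z : ℍ => z.im ^ C := by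
  obtain ⟨M, D, hD, hf⟩ := hasFourierExpansion_iff.1 hf
  -- The exponent `M` would bound the growth, but it may be `0`, while the definition wants a
  -- positive one.
  refine ⟨M + 1, by positivity, ?_⟩
  have : ∀ᶠ z : ℍ in UpperHalfPlane.atImInfty, 1 ≤ z.im :=
    Filter.eventually_comap.2 <| (Filter.eventually_ge_atTop 1).mono fun y hy z hz => hz ▸ hy
  have h1 : (fun z : ℍ => ∑ i ∈ Finset.Icc (-(M : ℤ)) M, (z.im : ℂ) ^ i * D i z)
      =O[UpperHalfPlane.atImInfty] fun z : ℍ => z.im ^ (M + 1 : ℝ) := by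
    refine Asymptotics.IsBigO.fun_sum fun i hi => ?_
    have h2 : (fun z : ℍ => (z.im : ℂ) ^ i) =O[UpperHalfPlane.atImInfty]
        fun z : ℍ => z.im ^ (M + 1 : ℝ) := by
      refine Asymptotics.IsBigO.of_bound 1 ?_
      filter_upwards [this] with z hz
      rw [norm_zpow, Complex.norm_real, Real.norm_of_nonneg z.im_pos.le, one_mul,
        Real.norm_of_nonneg (by have := z.im_pos; positivity), ← Real.rpow_intCast]
      refine Real.rpow_le_rpow_of_exponent_le hz ?_
      have h3 : i ≤ M + 1 := (Finset.mem_Icc.1 hi).2.trans (by omega)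
      exact_mod_cast h3
    simpa using h2.mul (hD i).isBigO_one
  exact h1.congr_left fun z => (hf z).symm

lemma HasFourierExpansion.isRealAnalyticModularForm {r s : ℤ} {f : ℍ → ℂ}
    (hf : HasFourierExpansion f)
    (h : ∀ (γ : SL(2, ℤ)) (z : ℍ), f (γ • z) = j γ z ^ r * j γ (conj (z : ℂ)) ^ s * f z) :
    IsRealAnalyticModularForm r s f :=
  ⟨hf.analyticOnNhd, hf.growth, h, hf⟩

end

end ModIter

namespace ModIter

noncomputable section

/-! ### The periodic sums `∑ (z + n)⁻ᵖ (conj z + n)⁻ᵗ` -/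

/-- The sum `∑_{n ∈ ℤ} (z + n) ^ (-p) (conj z + n) ^ (-t)`. -/
def periodicSum (p t : ℤ) (z : ℍ) : ℂ :=
  ∑' n : ℤ, ((z : ℂ) + n) ^ (-p) * (conj (z : ℂ) + n) ^ (-t)

lemma add_intCast_ne_zero (z : ℍ) (n : ℤ) : (z : ℂ) + n ≠ 0 := fun h => by
  have := congrArg Complex.im h
  simp [z.im_ne_zero] at this

lemma conj_add_intCast_ne_zero (z : ℍ) (n : ℤ) : conj (z : ℂ) + n ≠ 0 := fun h =>
  add_intCast_ne_zero z n (by simpa using congrArg conj h)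

lemma norm_conj_add_intCast (z : ℍ) (n : ℤ) : ‖conj (z : ℂ) + n‖ = ‖(z : ℂ) + n‖ := by
  rw [← RCLike.norm_conj]; simp

lemma summable_periodicSum (z : ℍ) {p t : ℤ} (h : 2 ≤ p + t) :
    Summable fun n : ℤ => ((z : ℂ) + n) ^ (-p) * (conj (z : ℂ) + n) ^ (-t) := by
  refine Summable.of_norm ((EisensteinSeries.linear_right_summable z 1 h).norm.congr fun n => ?_)
  rw [norm_mul, norm_zpow, norm_zpow, norm_conj_add_intCast, norm_inv, norm_zpow,
    ← zpow_add₀ (norm_ne_zero_iff.2 (add_intCast_ne_zero z n)), ← zpow_neg]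
  simp [add_comm]

lemma conj_periodicSum (p t : ℤ) (z : ℍ) : conj (periodicSum p t z) = periodicSum t p z := by
  rw [periodicSum, periodicSum, Complex.conj_tsum]
  refine tsum_congr fun n => ?_
  simp [mul_comm]

lemma coe_sub_conj (z : ℍ) : (z : ℂ) - conj (z : ℂ) = 2 * Complex.I * z.im := by
  rw [Complex.sub_conj]
  simp only [UpperHalfPlane.coe_im]
  push_cast
  ring

/-- Partial fractions: with `u = z + n` and `v = conj z + n`, the difference `u - v = 2iy` does not
depend on `n`. The total exponent drops by one, so `3 ≤ p + t` keeps both new sums absolutely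
convergent. -/
lemma periodicSum_of_pos (z : ℍ) {p t : ℤ} (h : 3 ≤ p + t) :
    periodicSum p t z = (2 * Complex.I)⁻¹ * ((z.im : ℂ) ^ (-1 : ℤ) *
      (periodicSum (p - 1) t z - periodicSum p (t - 1) z)) := by
  have hy : (z.im : ℂ) ≠ 0 := by exact_mod_cast z.im_ne_zero
  rw [periodicSum, periodicSum, periodicSum, ← (summable_periodicSum z (by omega)).tsum_sub
    (summable_periodicSum z (by omega)), ← tsum_mul_left, ← tsum_mul_left]
  refine tsum_congr fun n => ?_
  have hu := add_intCast_ne_zero z n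
  have hv := conj_add_intCast_ne_zero z n
  have h1 : (z.im : ℂ) = (2 * Complex.I)⁻¹ * (((z : ℂ) + n) - (conj (z : ℂ) + n)) := by
    rw [add_sub_add_right_eq_sub, coe_sub_conj]
    field_simp
  rw [show -(p - 1) = -p + 1 by ring, show -(t - 1) = -t + 1 by ring, zpow_add_one₀ hu,
    zpow_add_one₀ hv, zpow_neg_one, show ∀ a b u v : ℂ, a * u * b - a * (b * v) = (u - v) * (a * b)
      by intros; ring, add_sub_add_right_eq_sub, coe_sub_conj]
  field_simp

/-- Here one factor `v = u - 2iy` is substituted, which moves a negative `t` towards `0`. -/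
lemma periodicSum_of_neg (z : ℍ) {p t : ℤ} (h : 2 ≤ p + t) :
    periodicSum p t z = periodicSum (p - 1) (t + 1) z -
      2 * Complex.I * ((z.im : ℂ) ^ (1 : ℤ) * periodicSum p (t + 1) z) := by
  rw [periodicSum, periodicSum, periodicSum, ← tsum_mul_left, ← tsum_mul_left,
    ← (summable_periodicSum z (by omega)).tsum_sub
      (((summable_periodicSum z (by omega)).mul_left _).mul_left _)]
  refine tsum_congr fun n => ?_
  have hu := add_intCast_ne_zero z n
  have hv := conj_add_intCast_ne_zero z n
  have h1 := coe_sub_conj z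
  rw [show -(p - 1) = -p + 1 by ring, show -t = -(t + 1) + 1 by ring, zpow_add_one₀ hu,
    zpow_add_one₀ hv, zpow_one]
  linear_combination -((z : ℂ) + n) ^ (-p) * (conj (z : ℂ) + n) ^ (-(t + 1)) * h1

lemma summable_norm_nome_pow (k : ℕ) (z : ℍ) :
    Summable fun n : ℕ => ((n : ℂ) ^ k * nome z ^ n) :=
  summable_pow_mul_geometric_of_norm_lt_one k (norm_nome_lt_one z)

lemma hasFourierExpansion_periodicSum_zero {p : ℤ} (h : 2 ≤ p) :
    HasFourierExpansion (periodicSum p 0) := by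
  lift p to ℕ using by omega
  obtain ⟨k, rfl⟩ : ∃ k, p = k + 1 := ⟨p - 1, by omega⟩
  have : IsDoubleSeries fun z : ℍ => ∑' n : ℕ, (n : ℂ) ^ k * nome z ^ n :=
    .of_powerSeries fun z => (summable_norm_nome_pow k z).hasSum
  convert this.hasFourierExpansion.const_mul
    ((-2 * Real.pi * Complex.I) ^ (k + 1) / k.factorial) using 1
  funext z
  refine Eq.trans (tsum_congr fun n => ?_) (EisensteinSeries.qExpansion_identity (by omega) z)
  rw [neg_zero, zpow_zero, mul_one, zpow_neg, zpow_natCast, one_div]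

/-- The one case where partial fractions leave absolute convergence: `∑ 1/(z+n)` must be summed
symmetrically, by pairing `n` with `-n`, and is then `π cot πz`, which has a `q`-expansion. -/
lemma hasFourierExpansion_periodicSum_one : HasFourierExpansion (periodicSum 1 1) := by
  let S : ℍ → ℂ := fun z => Real.pi * (Real.pi * (z : ℂ)).cot
  have hS : HasFourierExpansion S := by
    have h1 : IsDoubleSeries fun z : ℍ => ∑' n : ℕ, nome z ^ n :=
      .of_powerSeries (a := fun _ => 1) fun z => by
        simpa using (summable_geometric_of_norm_lt_one (norm_nome_lt_one z)).hasSum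
    have h2 := (HasFourierExpansion.const (Real.pi * Complex.I)).sub
      (h1.hasFourierExpansion.const_mul (2 * Real.pi * Complex.I))
    convert h2 using 1
    funext z
    exact pi_mul_cot_pi_q_exp z
  have key : ∀ z, periodicSum 1 1 z =
      (2 * Complex.I)⁻¹ * ((z.im : ℂ) ^ (-1 : ℤ) * (conj (S z) - S z)) := by
    intro z
    have hy : (z.im : ℂ) ≠ 0 := by exact_mod_cast z.im_ne_zero
    let f : ℤ → ℂ := fun n => 1 / (conj (z : ℂ) + n) - 1 / ((z : ℂ) + n)
    have hf : ∀ n : ℤ, f n = (2 * Complex.I * z.im) *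
        (((z : ℂ) + n) ^ (-1 : ℤ) * (conj (z : ℂ) + n) ^ (-1 : ℤ)) := fun n => by
      have hu := add_intCast_ne_zero z n
      have hv := conj_add_intCast_ne_zero z n
      simp only [f]
      rw [← coe_sub_conj, zpow_neg_one, zpow_neg_one]
      field_simp
      ring
    have hs : Summable f := ((summable_periodicSum z (p := 1) (t := 1) (by norm_num)).mul_left
      (2 * Complex.I * z.im)).congr fun n => (hf n).symm
    have hcot := summable_cotTerm z.coe_mem_integerComplement
    have hcot' : Summable fun n : ℕ+ => 1 / ((z : ℂ) - n) + 1 / ((z : ℂ) + n) := by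
      rw [summable_pnat_iff_summable_succ (f := fun n : ℕ => 1 / ((z : ℂ) - n) + 1 / ((z : ℂ) + n))]
      refine hcot.congr fun n => ?_
      simp [cotTerm]
    have hsum : ∑' n, f n = conj (S z) - S z := by
      have hp : Summable fun n : ℕ+ => f n :=
        hs.comp_injective (i := fun n : ℕ+ => ((n : ℕ) : ℤ)) fun a b h => by simpa using h
      have hm : Summable fun n : ℕ+ => f (-n) :=
        hs.comp_injective (i := fun n : ℕ+ => -((n : ℕ) : ℤ)) fun a b h => by simpa using h
      simp only [S, cot_series_rep z.coe_mem_integerComplement, map_add, Complex.conj_tsum]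
      rw [tsum_int_eq_zero_add_tsum_pnat hs, add_assoc, ← hp.tsum_add hm,
        add_sub_add_comm, ← Summable.tsum_sub
          ((hcot'.map (starRingEnd ℂ) Complex.continuous_conj).congr fun n => map_add _ _ _) hcot']
      congr 1
      · simp [f]
      · refine tsum_congr fun n => ?_
        simp [f]
        ring
    rw [← hsum, tsum_congr hf, tsum_mul_left, periodicSum, zpow_neg_one]
    field_simp
  rw [funext key]
  exact (hS.star.sub hS).im_zpow_mul (-1) |>.const_mul _

lemma hasFourierExpansion_periodicSum {p t : ℤ} (h : 2 ≤ p + t) :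
    HasFourierExpansion (periodicSum p t) := by
  have hstar : ∀ {p t : ℤ}, HasFourierExpansion (periodicSum p t) →
      HasFourierExpansion (periodicSum t p) := fun {p t} h => by
    simpa only [conj_periodicSum] using h.star
  have hneg : ∀ (m : ℕ) (p : ℤ), 2 ≤ p - m → HasFourierExpansion (periodicSum p (-m)) := by
    intro m
    induction m with
    | zero => intro p hp; simpa using hasFourierExpansion_periodicSum_zero (by simpa using hp)
    | succ m ih =>
      intro p hp
      push_cast at hp ⊢
      rw [funext fun z => periodicSum_of_neg z (p := p) (t := -(m + 1 : ℤ)) (by omega)]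
      rw [show -((m : ℤ) + 1) + 1 = -m by ring]
      exact (ih _ (by omega)).sub (((ih p (by omega)).im_zpow_mul 1).const_mul _)
  -- Induction on the excess of `p + t` over `2`. When `p + t = 2`, either `p = t = 1` or one
  -- exponent is nonpositive, which is `hneg` up to conjugation.
  have hpos : ∀ N : ℕ, ∀ p t : ℤ, p + t = N + 2 → HasFourierExpansion (periodicSum p t) := by
    intro N
    induction N with
    | zero =>
      intro p t h
      rcases lt_trichotomy p 1 with hp | rfl | hp
      · have := hneg (-p).toNat t (by omega)
        rw [Int.toNat_of_nonneg (by omega), neg_neg] at this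
        exact hstar this
      · obtain rfl : t = 1 := by omega
        exact hasFourierExpansion_periodicSum_one
      · have := hneg (-t).toNat p (by omega)
        rwa [Int.toNat_of_nonneg (by omega), neg_neg] at this
    | succ N ih =>
      intro p t h
      push_cast at h
      rw [funext fun z => periodicSum_of_pos z (p := p) (t := t) (by omega)]
      exact (((ih _ _ (by omega)).sub (ih _ _ (by omega))).im_zpow_mul (-1)).const_mul _
  exact hpos (p + t - 2).toNat p t (by omega)

end

end ModIter

namespace ModIter

noncomputable section

/-! ### The cosets `B \ Γ` -/

lemma exists_sign_of_mem_B {b : SL(2, ℤ)} (hb : b ∈ B) :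
    ∃ ε : ℤ, (ε = 1 ∨ ε = -1) ∧ ∀ (γ : SL(2, ℤ)) (i : Fin 2), (b * γ) 1 i = ε * γ 1 i := by
  obtain ⟨n, rfl | rfl⟩ := hb
  · refine ⟨1, .inl rfl, fun γ i => ?_⟩
    rw [Matrix.SpecialLinearGroup.coe_mul, ModularGroup.coe_T_zpow]
    simp [Matrix.mul_apply, Fin.sum_univ_two]
  · refine ⟨-1, .inr rfl, fun γ i => ?_⟩
    rw [Matrix.SpecialLinearGroup.coe_mul, Matrix.SpecialLinearGroup.coe_neg,
      ModularGroup.coe_T_zpow]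
    simp [Matrix.vecMul, dotProduct, Fin.sum_univ_two]

lemma mem_B_iff {γ : SL(2, ℤ)} : γ ∈ B ↔ γ 1 0 = 0 := by
  constructor
  · intro h
    obtain ⟨ε, -, h⟩ := exists_sign_of_mem_B h
    simpa using h 1 0
  · intro h
    have hdet := γ.det_coe
    rw [Matrix.det_fin_two, h, mul_zero, sub_zero] at hdet
    rcases Int.eq_one_or_neg_one_of_mul_eq_one' hdet with ⟨ha, hd⟩ | ⟨ha, hd⟩
    · refine ⟨γ 0 1, .inl ?_⟩
      ext i k
      rw [ModularGroup.coe_T_zpow]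
      fin_cases i <;> fin_cases k <;> simp [h, ha, hd]
    · refine ⟨-γ 0 1, .inr ?_⟩
      ext i k
      rw [Matrix.SpecialLinearGroup.coe_neg, ModularGroup.coe_T_zpow]
      fin_cases i <;> fin_cases k <;> simp [h, ha, hd]

lemma mul_inv_mem_B_iff {γ γ' : SL(2, ℤ)} :
    γ * γ'⁻¹ ∈ B ↔ γ 1 0 * γ' 1 1 = γ 1 1 * γ' 1 0 := by
  have h : (γ * γ'⁻¹) 1 0 = γ 1 0 * γ' 1 1 - γ 1 1 * γ' 1 0 := by
    rw [Matrix.SpecialLinearGroup.coe_mul, Matrix.SpecialLinearGroup.coe_inv,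
      Matrix.adjugate_fin_two, Matrix.mul_apply, Fin.sum_univ_two]
    simp [sub_eq_add_neg]
  rw [mem_B_iff, h]
  constructor <;> intro h <;> linarith

/-- A coset is determined by the bottom row up to sign; this is expressed as vanishing of the
lower-left entry of `γ γ'⁻¹`. -/
lemma mk_eq_mk_iff {γ γ' : SL(2, ℤ)} :
    (Quotient.mk (QuotientGroup.rightRel B) γ) = Quotient.mk _ γ' ↔
      γ 1 0 * γ' 1 1 = γ 1 1 * γ' 1 0 := by
  rw [Quotient.eq, QuotientGroup.rightRel_apply, mul_inv_mem_B_iff, mul_comm, eq_comm,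
    mul_comm (γ 1 0)]

lemma apply_out_mk {g : SL(2, ℤ) → ℂ} (hg : ∀ b ∈ B, ∀ γ : SL(2, ℤ), g (b * γ) = g γ)
    (γ : SL(2, ℤ)) : g (Quotient.mk (QuotientGroup.rightRel B) γ).out = g γ := by
  have h : Quotient.mk (QuotientGroup.rightRel B)
      (Quotient.mk (QuotientGroup.rightRel B) γ).out = Quotient.mk _ γ := Quotient.out_eq _
  rw [Quotient.eq, QuotientGroup.rightRel_apply] at h
  rw [← hg _ h, inv_mul_cancel_right]

/-- The pairs `(c, d)` of coprime integers with `0 < c`. -/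
abbrev CoprimePair : Type := {v : ℕ+ × ℤ // IsCoprime ((v.1 : ℕ) : ℤ) v.2}

lemma exists_bottom_row (v : CoprimePair) :
    ∃ γ : SL(2, ℤ), γ 1 0 = ((v.1.1 : ℕ) : ℤ) ∧ γ 1 1 = v.1.2 := by
  obtain ⟨γ, -, hγ⟩ := ModularGroup.bottom_row_surj (R := ℤ)
    (show ![((v.1.1 : ℕ) : ℤ), v.1.2] ∈ {cd : Fin 2 → ℤ | IsCoprime (cd 0) (cd 1)} from v.2)
  exact ⟨γ, congrFun hγ 0, congrFun hγ 1⟩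

/-- An element of `SL(2, ℤ)` with bottom row `(c, d)`. -/
def ofBottomRow (v : CoprimePair) : SL(2, ℤ) := (exists_bottom_row v).choose

lemma ofBottomRow_zero (v : CoprimePair) : ofBottomRow v 1 0 = ((v.1.1 : ℕ) : ℤ) :=
  (exists_bottom_row v).choose_spec.1

lemma ofBottomRow_one (v : CoprimePair) : ofBottomRow v 1 1 = v.1.2 :=
  (exists_bottom_row v).choose_spec.2

lemma mk_ofBottomRow_injective :
    Function.Injective fun v => Quotient.mk (QuotientGroup.rightRel B) (ofBottomRow v) := by
  intro v w h
  have h := mk_eq_mk_iff.1 h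
  simp only [ofBottomRow_zero, ofBottomRow_one] at h
  have h1 : ((v.1.1 : ℕ) : ℤ) ∣ (w.1.1 : ℕ) := v.2.dvd_of_dvd_mul_left ⟨w.1.2, h.symm⟩
  have h2 : ((w.1.1 : ℕ) : ℤ) ∣ (v.1.1 : ℕ) :=
    w.2.dvd_of_dvd_mul_right ⟨v.1.2, h.trans (mul_comm _ _)⟩
  have h3 : ((v.1.1 : ℕ) : ℤ) = (w.1.1 : ℕ) :=
    Int.dvd_antisymm (by positivity) (by positivity) h1 h2
  have h4 : v.1.1 = w.1.1 := PNat.coe_injective (by exact_mod_cast h3)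
  have h5 : v.1.2 = w.1.2 := by
    rw [h3, mul_comm] at h
    exact (mul_right_cancel₀ (by exact_mod_cast w.1.1.ne_zero) h).symm
  exact Subtype.ext (Prod.ext h4 h5)

lemma mem_range_mk_ofBottomRow {γ : SL(2, ℤ)} (h : γ ∉ B) :
    Quotient.mk (QuotientGroup.rightRel B) γ ∈
      Set.range fun v => Quotient.mk (QuotientGroup.rightRel B) (ofBottomRow v) := by
  rw [mem_B_iff] at h
  have hc : IsCoprime (γ 1 0) (γ 1 1) := ModularGroup.bottom_row_coprime γ
  rcases lt_or_gt_of_ne h with hn | hp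
  · refine ⟨⟨(⟨(-γ 1 0).toNat, by omega⟩, -γ 1 1), ?_⟩, mk_eq_mk_iff.2 ?_⟩
    · simpa [Int.toNat_of_nonneg (show 0 ≤ -γ 1 0 by omega)] using hc.neg_neg
    · simp only [ofBottomRow_zero, ofBottomRow_one, PNat.mk_coe]
      rw [Int.toNat_of_nonneg (by omega)]
      ring
  · refine ⟨⟨(⟨(γ 1 0).toNat, by omega⟩, γ 1 1), ?_⟩, mk_eq_mk_iff.2 ?_⟩
    · simpa [Int.toNat_of_nonneg hp.le] using hc
    · simp only [ofBottomRow_zero, ofBottomRow_one, PNat.mk_coe]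
      rw [Int.toNat_of_nonneg (by omega)]
      ring

/-- Each nontrivial coset contains matrices with exactly one bottom row having `0 < c`, so the
nontrivial cosets are parametrised by coprime pairs. -/
lemma hasSum_coset_iff {g : SL(2, ℤ) → ℂ} (hg : ∀ b ∈ B, ∀ γ : SL(2, ℤ), g (b * γ) = g γ)
    (h0 : ∀ γ ∈ B, g γ = 0) {s : ℂ} :
    HasSum (fun q : Cosets => g q.out) s ↔ HasSum (fun v => g (ofBottomRow v)) s := by
  rw [← mk_ofBottomRow_injective.hasSum_iff]
  · refine iff_of_eq (congrArg (fun F => HasSum F s) (funext fun v => ?_))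
    exact apply_out_mk hg _
  · intro q hq
    by_contra h
    refine hq ?_
    rw [← Quotient.out_eq q]
    exact mem_range_mk_ofBottomRow fun h' => h (h0 _ h')

lemma j_mul_of_sign {b : SL(2, ℤ)} {ε : ℤ}
    (h : ∀ (γ : SL(2, ℤ)) (i : Fin 2), (b * γ) 1 i = ε * γ 1 i) (γ : SL(2, ℤ)) (w : ℂ) :
    j (b * γ) w = ε * j γ w := by
  rw [j, j, h, h]
  push_cast
  ring

lemma invInfty_eq (γ : SL(2, ℤ)) : invInfty γ = -((γ 1 1 : ℚ) / (γ 1 0 : ℚ)) := by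
  rw [invInfty, Matrix.SpecialLinearGroup.SL2_inv_expl]
  simp [div_neg]

lemma sign_zpow_even {ε : ℤ} (hε : ε = 1 ∨ ε = -1) {n : ℤ} (hn : Even n) : (ε : ℂ) ^ n = 1 := by
  rcases hε with rfl | rfl
  · simp
  · push_cast
    exact hn.neg_one_zpow

lemma sign_ne_zero {ε : ℤ} (hε : ε = 1 ∨ ε = -1) : (ε : ℂ) ≠ 0 := by
  rcases hε with rfl | rfl <;> simp

lemma eisensteinTerm_mul {r s : ℤ} (hrs : Even (r + s)) (z : ℍ) {b : SL(2, ℤ)} (hb : b ∈ B)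
    (γ : SL(2, ℤ)) : eisensteinTerm r s z (b * γ) = eisensteinTerm r s z γ := by
  obtain ⟨ε, hε, h⟩ := exists_sign_of_mem_B hb
  rw [eisensteinTerm, eisensteinTerm, j_mul_of_sign h, j_mul_of_sign h, mul_zpow, mul_zpow,
    mul_mul_mul_comm, ← zpow_add₀ (sign_ne_zero hε), sign_zpow_even hε hrs, one_mul]

lemma twistedTerm_mul (u : ℚ → ℂ) {e p t : ℤ} (hept : Even (e + p + t)) (z : ℍ) {b : SL(2, ℤ)}
    (hb : b ∈ B) (γ : SL(2, ℤ)) : twistedTerm u e p t z (b * γ) = twistedTerm u e p t z γ := by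
  obtain ⟨ε, hε, h⟩ := exists_sign_of_mem_B hb
  have h0 := sign_ne_zero hε
  have hεq : (ε : ℚ) ≠ 0 := by exact_mod_cast h0
  have hi : invInfty (b * γ) = invInfty γ := by
    rw [invInfty_eq, invInfty_eq, h, h]
    push_cast
    rw [mul_div_mul_left _ _ hεq]
  rw [twistedTerm, twistedTerm, Subgroup.mul_mem_cancel_left _ hb]
  congr 1
  rw [hi, j_mul_of_sign h, j_mul_of_sign h, h, Int.cast_mul, mul_zpow, mul_zpow, mul_zpow,
    mul_mul_mul_comm ((ε : ℂ) ^ p), ← zpow_add₀ h0, mul_left_comm]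
  have h1 : (ε : ℂ) ^ e = ε ^ (p + t) := by
    have h2 : (ε : ℂ) ^ (e - (p + t)) = 1 := sign_zpow_even hε (by
      rw [show e - (p + t) = e + p + t - 2 * (p + t) by ring]
      exact hept.sub (even_two_mul _))
    rwa [zpow_sub₀ h0, div_eq_one_iff_eq (zpow_ne_zero _ h0)] at h2
  rw [h1, mul_div_mul_left _ _ (zpow_ne_zero _ h0)]

lemma twistedTerm_of_mem (u : ℚ → ℂ) (e p t : ℤ) (z : ℍ) {γ : SL(2, ℤ)} (h : γ ∈ B) :
    twistedTerm u e p t z γ = 0 := if_pos h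

open Classical in
-- Treats `𝓔_{r,s}` as `1` plus a twisted series with constant twist, so that one theory covers all
-- the series.
lemma eisensteinTerm_eq {r s : ℤ} (hrs : Even (r + s)) (z : ℍ) (γ : SL(2, ℤ)) :
    eisensteinTerm r s z γ =
      (if γ ∈ B then 1 else 0) + twistedTerm (fun _ => 1) 0 r s z γ := by
  by_cases h : γ ∈ B
  · rw [twistedTerm_of_mem _ _ _ _ _ h, if_pos h, add_zero, ← mul_one γ,
      eisensteinTerm_mul hrs z h]
    simp [eisensteinTerm, j]
  · simp [twistedTerm, h, eisensteinTerm]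

/-! ### Series over coprime pairs -/

open Classical in
/-- The term of the series for the pair `(c, d)`, extended by `0` to pairs which are not coprime. -/
def pairTerm (u : ℚ → ℂ) (e p t : ℤ) (z : ℍ) (v : ℕ+ × ℤ) : ℂ :=
  if IsCoprime ((v.1 : ℕ) : ℤ) v.2 then
    u (-((v.2 : ℚ) / (v.1 : ℕ))) * ((v.1 : ℕ) : ℂ) ^ e /
      ((((v.1 : ℕ) : ℂ) * z + v.2) ^ p * (((v.1 : ℕ) : ℂ) * conj (z : ℂ) + v.2) ^ t)
  else 0

lemma twistedTerm_ofBottomRow (u : ℚ → ℂ) (e p t : ℤ) (z : ℍ) (v : CoprimePair) :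
    twistedTerm u e p t z (ofBottomRow v) = pairTerm u e p t z v.1 := by
  have h : ofBottomRow v ∉ B := by
    rw [mem_B_iff, ofBottomRow_zero]
    exact_mod_cast v.1.1.ne_zero
  simp [twistedTerm, pairTerm, h, v.2, invInfty_eq, ofBottomRow_zero, ofBottomRow_one, j]

lemma hasSum_twistedTerm_iff (u : ℚ → ℂ) {e p t : ℤ} (hept : Even (e + p + t)) (z : ℍ) {s : ℂ} :
    HasSum (fun q : Cosets => twistedTerm u e p t z q.out) s ↔ HasSum (pairTerm u e p t z) s := by
  rw [hasSum_coset_iff (fun b hb γ => twistedTerm_mul u hept z hb γ)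
    fun γ h => twistedTerm_of_mem _ _ _ _ _ h]
  simp only [twistedTerm_ofBottomRow]
  refine (Subtype.val_injective (p := fun v : ℕ+ × ℤ => IsCoprime ((v.1 : ℕ) : ℤ) v.2)).hasSum_iff
    (f := pairTerm u e p t z) fun v hv => if_neg fun h => hv ⟨⟨v, h⟩, rfl⟩

lemma natCast_mul_add_ne_zero (z : ℍ) (c : ℕ+) (d : ℤ) : ((c : ℕ) : ℂ) * z + d ≠ 0 := fun h => by
  have := congrArg Complex.im h
  simp [z.im_ne_zero] at this

lemma norm_natCast_mul_conj_add (z : ℍ) (c : ℕ+) (d : ℤ) :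
    ‖((c : ℕ) : ℂ) * conj (z : ℂ) + d‖ = ‖((c : ℕ) : ℂ) * z + d‖ := by
  rw [← RCLike.norm_conj]; simp

/-- The conditions on the coefficients and the exponents under which the twisted series over
`B \ Γ` converge and have a Fourier expansion. -/
structure IsTwist (u : ℚ → ℂ) (e p t : ℤ) : Prop where
  even : Even (e + p + t)
  periodic : ∀ (x : ℚ) (n : ℤ), u (x + n) = u x
  bound : ∃ (C : ℝ) (E : ℕ), (E : ℤ) + 3 ≤ p + t ∧ ∀ (d : ℤ) (c : ℕ+),
    IsCoprime ((c : ℕ) : ℤ) d → ‖u ((d : ℚ) / (c : ℕ))‖ * ((c : ℕ) : ℝ) ^ e ≤ C * ((c : ℕ) : ℝ) ^ E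

variable {u : ℚ → ℂ} {e p t : ℤ}

/-- Since `c y ≤ |cz + d|`, the factor `c^E` is at most `(|cz + d| / y)^E`. The series is therefore
dominated by an Eisenstein series of weight `p + t - E ≥ 3`. -/
lemma IsTwist.summable_pairTerm (h : IsTwist u e p t) (z : ℍ) : Summable (pairTerm u e p t z) := by
  obtain ⟨C, E, hE, hC⟩ := h.bound
  have hC0 : 0 ≤ C := by
    have := hC 0 1 (by simp [isCoprime_one_left])
    simp only [PNat.one_coe, Nat.cast_one, one_zpow, mul_one, one_pow] at this
    exact (norm_nonneg _).trans this
  have h1 := (EisensteinSeries.summable_norm_eisSummand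
    (show (3 : ℤ) ≤ p + t - E by omega) z)
  have h2 := h1.comp_injective (i := fun v : ℕ+ × ℤ => ![((v.1 : ℕ) : ℤ), v.2]) (by
    intro v w hvw
    have h0 := congrFun hvw 0
    have h1 := congrFun hvw 1
    simp at h0 h1
    exact Prod.ext h0 h1)
  refine Summable.of_norm_bounded (g := fun v : ℕ+ × ℤ => C * (z.im⁻¹) ^ E *
    ‖EisensteinSeries.eisSummand (p + t - E) ![((v.1 : ℕ) : ℤ), v.2] z‖) (h2.mul_left _) ?_
  rintro ⟨c, d⟩
  simp only [pairTerm]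
  split_ifs with hcd
  · have hw := natCast_mul_add_ne_zero z c d
    set w : ℂ := ((c : ℕ) : ℂ) * z + d with hw'
    have hwn : 0 < ‖w‖ := norm_pos_iff.2 hw
    have hcw : ((c : ℕ) : ℝ) * z.im ≤ ‖w‖ := by
      refine le_trans (le_of_eq ?_) (Complex.abs_im_le_norm w)
      simp [hw', Complex.add_im, Complex.mul_im, abs_of_pos z.im_pos]
    have hcw' : ((c : ℕ) : ℝ) ≤ z.im⁻¹ * ‖w‖ := by
      rw [inv_mul_eq_div, le_div_iff₀ z.im_pos]
      exact hcw
    have hu : ‖u (-((d : ℚ) / (c : ℕ)))‖ * ((c : ℕ) : ℝ) ^ e ≤ C * ((c : ℕ) : ℝ) ^ E := by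
      simpa [neg_div] using hC (-d) c hcd.neg_right
    rw [norm_div, norm_mul, norm_mul, norm_zpow, norm_zpow, norm_zpow, norm_natCast_mul_conj_add,
      ← hw', ← zpow_add₀ hwn.ne', Complex.norm_natCast, div_eq_mul_inv]
    have he : ‖EisensteinSeries.eisSummand (p + t - E) ![((c : ℕ) : ℤ), d] z‖ =
        ‖w‖ ^ E * (‖w‖ ^ (p + t))⁻¹ := by
      rw [EisensteinSeries.eisSummand]
      simp only [Matrix.cons_val_zero, Matrix.cons_val_one, norm_zpow, Int.cast_natCast, ← hw']
      rw [neg_sub, zpow_sub₀ hwn.ne', zpow_natCast, div_eq_mul_inv]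
    rw [he]
    calc _ ≤ C * (z.im⁻¹ * ‖w‖) ^ E * (‖w‖ ^ (p + t))⁻¹ := by
          refine mul_le_mul_of_nonneg_right (hu.trans ?_) (by positivity)
          gcongr
      _ = _ := by rw [mul_pow]; ring
  · rw [norm_zero]
    have := z.im_pos
    positivity

/-- The bijection `(c, d₀, n) ↦ (c, d₀ + n c)`. -/
def residueEquiv : ((Σ c : ℕ+, Fin c) × ℤ) ≃ ℕ+ × ℤ :=
  (Equiv.sigmaProdDistrib (fun c : ℕ+ => Fin c) ℤ).trans <|
    (Equiv.sigmaCongrRight fun c : ℕ+ =>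
      (Equiv.prodComm (Fin c) ℤ).trans (Int.divModEquiv c).symm).trans (Equiv.sigmaEquivProd _ _)

lemma residueEquiv_apply (i : Σ c : ℕ+, Fin c) (n : ℤ) :
    residueEquiv (i, n) = (i.1, n * (i.1 : ℕ) + (i.2 : ℕ)) := rfl

open Classical in
/-- The weight of the residue class `d₀` modulo `c`. -/
def residueWeight (u : ℚ → ℂ) (e p t : ℤ) (i : Σ c : ℕ+, Fin c) : ℂ :=
  if IsCoprime ((i.1 : ℕ) : ℤ) (i.2 : ℕ) then
    u (-(((i.2 : ℕ) : ℚ) / (i.1 : ℕ))) * ((i.1 : ℕ) : ℂ) ^ (e - p - t) else 0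

/-- The translation by `d₀ / c`. -/
def residueShift (i : Σ c : ℕ+, Fin c) : ℝ := (i.2 : ℕ) / (i.1 : ℕ)

/-- For `d = d₀ + nc` one has `cz + d = c (z + d₀/c + n)`, while coprimality and, by periodicity,
the twist depend only on `d₀`. -/
lemma pairTerm_residueEquiv (hu : ∀ (x : ℚ) (n : ℤ), u (x + n) = u x) (z : ℍ)
    (i : Σ c : ℕ+, Fin c) (n : ℤ) :
    pairTerm u e p t z (residueEquiv (i, n)) = residueWeight u e p t i *
      (((residueShift i +ᵥ z : ℍ) + n : ℂ) ^ (-p) *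
        (conj ((residueShift i +ᵥ z : ℍ) : ℂ) + n) ^ (-t)) := by
  have hcop : IsCoprime ((i.1 : ℕ) : ℤ) (n * (i.1 : ℕ) + (i.2 : ℕ)) ↔
      IsCoprime ((i.1 : ℕ) : ℤ) (i.2 : ℕ) := by
    rw [add_comm]
    exact IsCoprime.add_mul_right_right_iff
  simp only [residueEquiv_apply, pairTerm, residueWeight, hcop]
  split_ifs
  · have hc : ((i.1 : ℕ) : ℂ) ≠ 0 := by exact_mod_cast i.1.ne_zero
    have h1 : u (-(((n * (i.1 : ℕ) + (i.2 : ℕ) : ℤ) : ℚ) / (i.1 : ℕ))) =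
        u (-(((i.2 : ℕ) : ℚ) / (i.1 : ℕ))) := by
      rw [← hu _ n]
      congr 1
      push_cast
      field_simp
      ring
    have h2 : ∀ w : ℂ, ((i.1 : ℕ) : ℂ) * w + ((n * (i.1 : ℕ) + (i.2 : ℕ) : ℤ) : ℂ) =
        (i.1 : ℕ) * ((residueShift i : ℂ) + w + n) := fun w => by
      rw [residueShift]
      push_cast
      field_simp
      ring
    rw [h1, h2, h2, UpperHalfPlane.coe_vadd, map_add, Complex.conj_ofReal, mul_zpow, mul_zpow,
      zpow_sub₀ hc, zpow_sub₀ hc, zpow_neg, zpow_neg]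
    have := zpow_ne_zero p hc
    have := zpow_ne_zero t hc
    field_simp
  · simp

/-- Each weight is `O(c⁻³)` and there are `c` residues modulo `c`, leaving the convergent sum of
`c⁻²`. -/
lemma IsTwist.summable_residueWeight (h : IsTwist u e p t) :
    Summable fun i => ‖residueWeight u e p t i‖ := by
  obtain ⟨C, E, hE, hC⟩ := h.bound
  have hC0 : 0 ≤ C := by
    have := hC 0 1 (by simp [isCoprime_one_left])
    simp only [PNat.one_coe, Nat.cast_one, one_zpow, mul_one, one_pow] at this
    exact (norm_nonneg _).trans this
  have hb : ∀ i, ‖residueWeight u e p t i‖ ≤ C * (((i.1 : ℕ) : ℝ) ^ 3)⁻¹ := by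
    intro i
    rw [residueWeight]
    split_ifs with hi
    · have hc : (1 : ℝ) ≤ (i.1 : ℕ) := by exact_mod_cast i.1.pos
      have hc0 : (0 : ℝ) < (i.1 : ℕ) := by linarith
      have hu := hC (-(i.2 : ℕ)) i.1 hi.neg_right
      rw [norm_mul, norm_zpow, Complex.norm_natCast, sub_sub, zpow_sub₀ hc0.ne', ← mul_div_assoc,
        div_eq_mul_inv (_ * _)]
      have hu' : ‖u (-(((i.2 : ℕ) : ℚ) / (i.1 : ℕ)))‖ * ((i.1 : ℕ) : ℝ) ^ e ≤
          C * ((i.1 : ℕ) : ℝ) ^ E := by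
        simpa [neg_div] using hu
      refine (mul_le_mul_of_nonneg_right hu' (by positivity)).trans ?_
      rw [mul_assoc]
      refine mul_le_mul_of_nonneg_left ?_ hC0
      rw [← div_eq_mul_inv, div_le_iff₀ (by positivity), inv_mul_eq_div, le_div_iff₀ (by positivity),
        ← pow_add, ← zpow_natCast]
      exact zpow_le_zpow_right₀ hc (by push_cast; omega)
    · rw [norm_zero]; positivity
  refine Summable.of_nonneg_of_le (fun _ => norm_nonneg _) hb (Summable.mul_left _ ?_)
  rw [summable_sigma_of_nonneg fun _ => by positivity]
  refine ⟨fun c => (hasSum_fintype _).summable, ?_⟩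
  have h2 : Summable fun n : ℕ => ((n : ℝ) ^ 2)⁻¹ := Real.summable_nat_pow_inv.2 (by norm_num)
  refine (h2.comp_injective PNat.coe_injective).congr fun c => ?_
  have hc0 : ((c : ℕ) : ℝ) ≠ 0 := by exact_mod_cast c.ne_zero
  rw [tsum_fintype]
  simp only [Finset.sum_const, Finset.card_univ, Fintype.card_fin, nsmul_eq_mul,
    Function.comp_apply]
  field_simp

lemma IsTwist.hasFourierExpansion (h : IsTwist u e p t) :
    HasFourierExpansion fun z => ∑' v, pairTerm u e p t z v := by
  have hpt : 2 ≤ p + t := by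
    obtain ⟨C, E, hE, -⟩ := h.bound
    omega
  have key : ∀ z, ∑' v, pairTerm u e p t z v =
      ∑' i, residueWeight u e p t i * periodicSum p t (residueShift i +ᵥ z) := fun z => by
    have hs := (residueEquiv.summable_iff.2 (h.summable_pairTerm z)).tsum_prod
    simp only [Function.comp_apply] at hs
    rw [← residueEquiv.tsum_eq, hs]
    refine tsum_congr fun i => ?_
    simp only [pairTerm_residueEquiv h.periodic, periodicSum]
    rw [tsum_mul_left]
  rw [funext key]
  exact (hasFourierExpansion_periodicSum hpt).tsum_vadd h.summable_residueWeight

lemma IsTwist.cosetSummable (h : IsTwist u e p t) (z : ℍ) :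
    CosetSummable (twistedTerm u e p t z) :=
  ⟨fun _ hb γ => twistedTerm_mul u h.even z hb γ,
    ((hasSum_twistedTerm_iff u h.even z).2 (h.summable_pairTerm z).hasSum).summable⟩

lemma IsTwist.hasFourierExpansion_cosetSum (h : IsTwist u e p t) :
    HasFourierExpansion fun z => cosetSum (twistedTerm u e p t z) := by
  have : (fun z => cosetSum (twistedTerm u e p t z)) = fun z => ∑' v, pairTerm u e p t z v :=
    funext fun z =>
      ((hasSum_twistedTerm_iff u h.even z).2 (h.summable_pairTerm z).hasSum).tsum_eq
  rw [this]
  exact h.hasFourierExpansion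

variable {r s : ℤ}

lemma isTwist_one (hrs : Even (r + s)) (h : 3 ≤ r + s) : IsTwist (fun _ => 1) 0 r s where
  even := by rwa [zero_add]
  periodic _ _ := rfl
  bound := ⟨1, 0, by simpa using h, fun d c _ => by simp⟩

open Classical in
lemma hasSum_trivial_coset :
    HasSum (fun q : Cosets => if q.out ∈ B then (1 : ℂ) else 0) 1 := by
  have h : ∀ q : Cosets, q.out ∈ B ↔ q = Quotient.mk _ 1 := fun q => by
    conv_rhs => rw [← Quotient.out_eq q]
    rw [mk_eq_mk_iff, mem_B_iff]
    simp
  simp only [h]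
  exact hasSum_ite_eq _ _

lemma hasSum_eisensteinTerm (hrs : Even (r + s)) (h : 3 ≤ r + s) (z : ℍ) :
    HasSum (fun q : Cosets => eisensteinTerm r s z q.out)
      (1 + cosetSum (twistedTerm (fun _ => 1) 0 r s z)) := by
  classical
  refine (hasSum_trivial_coset.add ((isTwist_one hrs h).cosetSummable z).2.hasSum).congr_fun
    fun q => eisensteinTerm_eq hrs z _

lemma cosetSummable_eisensteinTerm (hrs : Even (r + s)) (h : 3 ≤ r + s) (z : ℍ) :
    CosetSummable (eisensteinTerm r s z) :=
  ⟨fun _ hb γ => eisensteinTerm_mul hrs z hb γ, (hasSum_eisensteinTerm hrs h z).summable⟩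

lemma hasFourierExpansion_eisenstein (hrs : Even (r + s)) (h : 3 ≤ r + s) :
    HasFourierExpansion (eisenstein r s) := by
  have : eisenstein r s = (fun _ => 1) + fun z => cosetSum (twistedTerm (fun _ => 1) 0 r s z) :=
    funext fun z => (hasSum_eisensteinTerm hrs h z).tsum_eq
  rw [this]
  exact (HasFourierExpansion.const 1).add (isTwist_one hrs h).hasFourierExpansion_cosetSum

end

end ModIter

namespace ModIter

noncomputable section

open MeasureTheory Filter Topology

/-! ### Integrals along vertical half-lines -/

/-- The function `g` is holomorphic on the upper half-plane and `O(y⁻³)` on vertical strips. -/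
structure StripDecay (g : ℂ → ℂ) : Prop where
  differentiableOn : DifferentiableOn ℂ g {w | 0 < w.im}
  bound : ∀ (R δ : ℝ), 0 < δ → ∃ C : ℝ, 0 ≤ C ∧
    ∀ w : ℂ, |w.re| ≤ R → δ ≤ w.im → ‖g w‖ ≤ C * (w.im ^ 3)⁻¹

lemma isOpen_im_pos : IsOpen {w : ℂ | 0 < w.im} := isOpen_lt continuous_const Complex.continuous_im

lemma integrableOn_inv_add_sq {y : ℝ} (hy : 0 < y) :
    IntegrableOn (fun t : ℝ => ((y + t) ^ 2)⁻¹) (Set.Ioi 0) := by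
  refine (integrableOn_add_rpow_Ioi_of_lt (a := -2) (c := 0) (m := y) (by norm_num)
    (by linarith)).congr_fun (fun t ht => ?_) measurableSet_Ioi
  have ht : 0 < t := ht
  simp only
  rw [Real.rpow_neg (by linarith), add_comm]
  norm_num

/-- Explains the cube in `StripDecay`: two powers make the integrand integrable in `t`, and the
third makes the integral tend to `0` as `y → ∞`. -/
lemma inv_cube_le {y t δ : ℝ} (hδ : 0 < δ) (hy : δ ≤ y) (ht : 0 ≤ t) :
    ((y + t) ^ 3)⁻¹ ≤ y⁻¹ * ((δ + t) ^ 2)⁻¹ := by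
  rw [← mul_inv]
  have hy0 : 0 < y := by linarith
  refine inv_anti₀ (by positivity) ?_
  rw [pow_succ' (y + t)]
  exact mul_le_mul (by linarith) (pow_le_pow_left₀ (by positivity) (by linarith) 2) (by positivity)
    (by positivity)

lemma add_I_mul_im (z : ℂ) (t : ℝ) : (z + Complex.I * t).im = z.im + t := by simp

lemma add_I_mul_re (z : ℂ) (t : ℝ) : (z + Complex.I * t).re = z.re := by simp

lemma hasDerivAt_vertical (z : ℂ) (t : ℝ) :
    HasDerivAt (fun t : ℝ => z + Complex.I * t) Complex.I t := by
  simpa using ((hasDerivAt_id t).ofReal_comp.const_mul Complex.I).const_add z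

namespace StripDecay

variable {g : ℂ → ℂ}

lemma differentiableAt (hg : StripDecay g) {w : ℂ} (hw : 0 < w.im) : DifferentiableAt ℂ g w :=
  hg.differentiableOn.differentiableAt (isOpen_im_pos.mem_nhds hw)

lemma continuousOn_vertical (hg : StripDecay g) {z : ℂ} (hz : 0 < z.im) :
    ContinuousOn (fun t : ℝ => g (z + Complex.I * t)) (Set.Ici 0) := by
  refine hg.differentiableOn.continuousOn.comp (by fun_prop) fun t ht => ?_
  have ht : 0 ≤ t := ht
  change 0 < (z + Complex.I * t).im
  rw [add_I_mul_im]
  linarith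

lemma norm_vertical_le (hg : StripDecay g) (R δ : ℝ) (hδ : 0 < δ) : ∃ C : ℝ, 0 ≤ C ∧
    ∀ z : ℂ, |z.re| ≤ R → δ ≤ z.im → ∀ t : ℝ, 0 ≤ t →
      ‖g (z + Complex.I * t)‖ ≤ C * z.im⁻¹ * ((δ + t) ^ 2)⁻¹ := by
  obtain ⟨C, hC, h⟩ := hg.bound R δ hδ
  refine ⟨C, hC, fun z hz hz' t ht => ?_⟩
  have := h (z + Complex.I * t) (by rwa [add_I_mul_re]) (by rw [add_I_mul_im]; linarith)
  rw [add_I_mul_im] at this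
  rw [mul_assoc]
  exact this.trans (mul_le_mul_of_nonneg_left (inv_cube_le hδ hz' ht) hC)

lemma integrableOn (hg : StripDecay g) {z : ℂ} (hz : 0 < z.im) :
    IntegrableOn (fun t : ℝ => g (z + Complex.I * t)) (Set.Ioi 0) := by
  obtain ⟨C, hC, h⟩ := hg.norm_vertical_le |z.re| z.im hz
  refine Integrable.mono' ((integrableOn_inv_add_sq hz).const_mul (C * z.im⁻¹))
    ((hg.continuousOn_vertical hz).mono Set.Ioi_subset_Ici_self |>.aestronglyMeasurable
      measurableSet_Ioi) ?_
  filter_upwards [ae_restrict_mem measurableSet_Ioi] with t ht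
  exact h z le_rfl le_rfl t (le_of_lt ht)

lemma norm_intFromCusp_le (hg : StripDecay g) (R : ℝ) : ∃ C : ℝ,
    ∀ z : ℂ, |z.re| ≤ R → 1 ≤ z.im → ‖intFromCusp g z‖ ≤ C * z.im⁻¹ := by
  obtain ⟨C, hC, h⟩ := hg.norm_vertical_le R 1 one_pos
  refine ⟨C * ∫ t in Set.Ioi (0 : ℝ), ((1 + t) ^ 2)⁻¹, fun z hz hz' => ?_⟩
  rw [intFromCusp, norm_neg, mul_right_comm, ← integral_const_mul]
  refine norm_integral_le_of_norm_le ((integrableOn_inv_add_sq one_pos).const_mul _) ?_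
  filter_upwards [ae_restrict_mem measurableSet_Ioi] with t ht
  rw [norm_mul, Complex.norm_I, mul_one]
  exact h z hz hz' t (le_of_lt ht)

lemma tendsto_intFromCusp (hg : StripDecay g) {ι : Type*} {l : Filter ι} {w : ι → ℂ} {R : ℝ}
    (hre : ∀ᶠ i in l, |(w i).re| ≤ R) (him : Tendsto (fun i => (w i).im) l atTop) :
    Tendsto (fun i => intFromCusp g (w i)) l (𝓝 0) := by
  obtain ⟨C, h⟩ := hg.norm_intFromCusp_le R
  refine squeeze_zero_norm' (a := fun i => C * ((w i).im)⁻¹) ?_ ?_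
  · filter_upwards [hre, him.eventually_ge_atTop 1] with i h1 h2 using h _ h1 h2
  · simpa using (tendsto_inv_atTop_zero.comp him).const_mul C

lemma tendsto_vertical (hg : StripDecay g) {z : ℂ} (hz : 0 < z.im) :
    Tendsto (fun t : ℝ => g (z + Complex.I * t)) atTop (𝓝 0) := by
  obtain ⟨C, hC, h⟩ := hg.norm_vertical_le |z.re| z.im hz
  refine squeeze_zero_norm' (a := fun t : ℝ => C * z.im⁻¹ * ((z.im + t) ^ 2)⁻¹) ?_ ?_
  · filter_upwards [eventually_ge_atTop 0] with t ht using h z le_rfl le_rfl t ht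
  · have h1 : Tendsto (fun t : ℝ => (z.im + t) ^ 2) atTop atTop :=
      (tendsto_pow_atTop two_ne_zero).comp (tendsto_atTop_add_const_left _ _ tendsto_id)
    simpa using (tendsto_inv_atTop_zero.comp h1).const_mul (C * z.im⁻¹)

/-- Cauchy's estimate on circles of radius `y/4` gives a bound uniform for base points near `z`, as
needed to differentiate under the integral. -/
lemma norm_deriv_vertical_le (hg : StripDecay g) {z : ℂ} (hz : 0 < z.im) : ∃ C : ℝ,
    ∀ w ∈ Metric.ball z (z.im / 4), ∀ t : ℝ, 0 ≤ t →
      ‖deriv g (w + Complex.I * t)‖ ≤ C * ((z.im / 2 + t) ^ 2)⁻¹ := by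
  -- The base point moves by less than `y/4` and the circle adds `y/4`, so the imaginary part stays
  -- at least `y/2 + t`.
  obtain ⟨C, hC, h⟩ := hg.bound (|z.re| + z.im) (z.im / 2) (by linarith)
  refine ⟨C * (z.im / 2)⁻¹ / (z.im / 4), fun w hw t ht => ?_⟩
  have hw : ‖w - z‖ < z.im / 4 := by simpa [dist_eq_norm] using hw
  have hball : ∀ v, ‖v - (w + Complex.I * t)‖ ≤ z.im / 4 →
      |v.re| ≤ |z.re| + z.im ∧ z.im / 2 + t ≤ v.im := by
    intro v hv
    have h1 := (Complex.abs_re_le_norm _).trans hv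
    have h2 := (Complex.abs_im_le_norm _).trans hv
    have h3 := (Complex.abs_re_le_norm _).trans hw.le
    have h4 := (Complex.abs_im_le_norm _).trans hw.le
    rw [Complex.sub_re, add_I_mul_re] at h1
    rw [Complex.sub_im, add_I_mul_im] at h2
    rw [Complex.sub_re] at h3
    rw [Complex.sub_im] at h4
    constructor
    · have := abs_add_three (v.re - w.re) (w.re - z.re) z.re
      rw [show v.re - w.re + (w.re - z.re) + z.re = v.re by ring] at this
      linarith
    · have := (abs_le.1 h2).1
      have := (abs_le.1 h4).1
      linarith
  rw [div_mul_eq_mul_div]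
  refine Complex.norm_deriv_le_of_forall_mem_sphere_norm_le (by linarith) ?_ fun v hv => ?_
  · refine DifferentiableOn.diffContOnCl (hg.differentiableOn.mono fun v hv => ?_)
    have hv := Metric.closure_ball_subset_closedBall hv
    have := (hball v (by simpa [dist_eq_norm] using hv)).2
    change 0 < v.im
    linarith
  · obtain ⟨h1, h2⟩ := hball v (by simpa [dist_eq_norm] using (Metric.mem_sphere.1 hv).le)
    refine (h v h1 (by linarith)).trans ?_
    rw [mul_assoc]
    refine mul_le_mul_of_nonneg_left ?_ hC
    refine le_trans (inv_anti₀ (by positivity) (pow_le_pow_left₀ (by positivity) h2 3)) ?_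
    exact inv_cube_le (by linarith) le_rfl ht

lemma hasDerivAt_intFromCusp (hg : StripDecay g) {z : ℂ} (hz : 0 < z.im) :
    HasDerivAt (intFromCusp g) (g z) z := by
  obtain ⟨C, hC⟩ := hg.norm_deriv_vertical_le hz
  have him : ∀ w ∈ Metric.ball z (z.im / 4), 0 < w.im := fun w hw => by
    have hw : ‖w - z‖ < z.im / 4 := by simpa [dist_eq_norm] using hw
    have h4 := (Complex.abs_im_le_norm _).trans hw.le
    rw [Complex.sub_im] at h4
    have := (abs_le.1 h4).1
    linarith
  have hmem : Metric.ball z (z.im / 4) ∈ 𝓝 z := Metric.ball_mem_nhds _ (by linarith)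
  have hpos : ∀ {w : ℂ} {t : ℝ}, 0 < w.im → t ∈ Set.Ioi (0 : ℝ) →
      0 < (w + Complex.I * t).im := fun {w t} hw ht => by
    have : 0 < t := ht
    rw [add_I_mul_im]; linarith
  have hd : DifferentiableOn ℂ (deriv g) {w | 0 < w.im} :=
    hg.differentiableOn.deriv isOpen_im_pos
  have hderiv : ∀ {w : ℂ} {t : ℝ}, 0 < (w + Complex.I * t).im →
      HasDerivAt (fun t : ℝ => g (w + Complex.I * t)) (deriv g (w + Complex.I * t) * Complex.I) t :=
    fun h => (hg.differentiableAt h).hasDerivAt.comp_of_eq _ (hasDerivAt_vertical _ _) rfl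
  have hmeas : ∀ w : ℂ, 0 < w.im → AEStronglyMeasurable
      (fun t : ℝ => g (w + Complex.I * t) * Complex.I) (volume.restrict (Set.Ioi 0)) :=
    fun w hw => ((hg.integrableOn hw).mul_const _).aestronglyMeasurable
  have hmeas' : AEStronglyMeasurable
      (fun t : ℝ => deriv g (z + Complex.I * t) * Complex.I) (volume.restrict (Set.Ioi 0)) := by
    refine ContinuousOn.aestronglyMeasurable (ContinuousOn.mul ?_ continuousOn_const)
      measurableSet_Ioi
    exact hd.continuousOn.comp (by fun_prop) fun t ht => hpos hz ht
  have hmain := hasDerivAt_integral_of_dominated_loc_of_deriv_le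
    (μ := volume.restrict (Set.Ioi (0 : ℝ))) (F := fun (w : ℂ) (t : ℝ) => g (w + Complex.I * t) * Complex.I)
    (F' := fun (w : ℂ) (t : ℝ) => deriv g (w + Complex.I * t) * Complex.I)
    (bound := fun t => C * ((z.im / 2 + t) ^ 2)⁻¹) hmem
    (by filter_upwards [hmem] with w hw using hmeas w (him w hw))
    ((hg.integrableOn hz).mul_const _) hmeas'
    (by
      filter_upwards [ae_restrict_mem measurableSet_Ioi] with t ht w hw
      rw [norm_mul, Complex.norm_I, mul_one]
      exact hC w hw t (le_of_lt ht))
    ((integrableOn_inv_add_sq (by linarith)).const_mul _)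
    (by
      filter_upwards [ae_restrict_mem measurableSet_Ioi] with t ht w hw
      have h1 := (hg.differentiableAt (hpos (him w hw) ht)).hasDerivAt
      exact (h1.comp_add_const w _).mul_const _)
  -- The differentiated integrand `g'(z + it) i` is the `t`-derivative of `g(z + it)`, so its
  -- integral is `0 - g(z)`; the sign in `intFromCusp` turns this into `g(z)`.
  have hval := integral_Ioi_of_hasDerivAt_of_tendsto (a := 0)
    ((hg.continuousOn_vertical hz) 0 Set.self_mem_Ici)
    (fun t ht => hderiv (hpos hz ht)) hmain.1 (hg.tendsto_vertical hz)
  have h2 := hmain.2.neg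
  rw [hval] at h2
  simp only [Complex.ofReal_zero, mul_zero, add_zero, zero_sub, neg_neg] at h2
  exact h2

end StripDecay

lemma tendsto_intFromCusp_real {g : ℂ → ℂ} (x : ℝ)
    (hi : IntegrableOn (fun t : ℝ => g (x + Complex.I * t)) (Set.Ioi 0)) :
    Tendsto (fun n : ℕ => intFromCusp g (x + Complex.I * ((1 / (n + 1) : ℝ) : ℂ))) atTop
      (𝓝 (-∫ t in Set.Ioi (0 : ℝ), g (x + Complex.I * t) * Complex.I)) := by
  have hU : ⋃ n : ℕ, Set.Ioi (1 / ((n : ℝ) + 1)) = Set.Ioi 0 := by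
    ext t
    simp only [Set.mem_iUnion, Set.mem_Ioi]
    constructor
    · rintro ⟨n, hn⟩
      exact lt_trans (by positivity) hn
    · intro ht
      exact exists_nat_one_div_lt ht
  have h1 := tendsto_setIntegral_of_monotone (μ := volume)
    (f := fun t : ℝ => g (x + Complex.I * t) * Complex.I)
    (s := fun n : ℕ => Set.Ioi (1 / ((n : ℝ) + 1))) (fun _ => measurableSet_Ioi)
    (fun m n h => Set.Ioi_subset_Ioi (Nat.one_div_le_one_div h)) (by
      rw [hU]; exact hi.mul_const _)
  rw [hU] at h1
  refine h1.neg.congr fun n => ?_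
  rw [intFromCusp]
  congr 1
  have := (measurePreserving_add_right volume (1 / ((n : ℝ) + 1))).setIntegral_preimage_emb
    (measurableEmbedding_addRight _) (fun t : ℝ => g (x + Complex.I * t) * Complex.I)
    (Set.Ioi (1 / ((n : ℝ) + 1)))
  rw [← this]
  simp only [Set.preimage_add_const_Ioi, sub_self]
  refine setIntegral_congr_fun measurableSet_Ioi fun t _ => ?_
  congr 2
  push_cast
  ring

end

end ModIter

namespace ModIter

noncomputable section

open MeasureTheory Filter Topology

/-! ### Bounds for cusp forms -/

variable {k : ℕ} (f : CuspForm 𝒮ℒ (k : ℤ))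

lemma cuspForm_smul (γ : SL(2, ℤ)) (z : ℍ) : f (γ • z) = j γ z ^ k * f z := by
  have hγ : Matrix.SpecialLinearGroup.mapGL ℝ γ ∈ 𝒮ℒ := ⟨γ, rfl⟩
  have := SlashInvariantForm.slash_action_eqn'' f hγ z
  rw [zpow_natCast] at this
  refine this.trans ?_
  congr 2

lemma j_ne_zero (γ : SL(2, ℤ)) (z : ℍ) : j γ z ≠ 0 := by
  have := UpperHalfPlane.denom_ne_zero (Matrix.SpecialLinearGroup.mapGL ℝ γ) z
  rwa [show UpperHalfPlane.denom (Matrix.SpecialLinearGroup.mapGL ℝ γ) z = j γ z from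
    ModularGroup.denom_apply γ z] at this

lemma im_smul (γ : SL(2, ℤ)) (z : ℍ) : (γ • z).im = z.im / ‖j γ z‖ ^ 2 := by
  rw [ModularGroup.im_smul_eq_div_normSq, ModularGroup.denom_apply, Complex.normSq_eq_norm_sq]
  rfl

lemma coe_smul (γ : SL(2, ℤ)) (z : ℍ) :
    ((γ • z : ℍ) : ℂ) = ((γ 0 0 : ℂ) * z + (γ 0 1 : ℂ)) / ((γ 1 0 : ℂ) * z + (γ 1 1 : ℂ)) := by
  rw [UpperHalfPlane.specialLinearGroup_apply]
  simp

lemma ev_coe (f : ℍ → ℂ) (z : ℍ) : ev f z = f z := by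
  rw [ev, UpperHalfPlane.ofComplex_apply]

lemma ev_of_im_pos (f : ℍ → ℂ) {w : ℂ} (hw : 0 < w.im) : ev f w = f ⟨w, hw⟩ := ev_coe f ⟨w, hw⟩

lemma differentiableOn_ev : DifferentiableOn ℂ (ev f) {w | 0 < w.im} :=
  UpperHalfPlane.mdifferentiable_iff.1 (CuspFormClass.holo f)

/-- The Hecke bound `y^(-k/2)` suffices below a fixed height, where `y^(-A)` is larger up to a
constant; exponential decay at the cusp handles the rest. -/
lemma exists_norm_le_rpow {A : ℝ} (hA : (k : ℝ) / 2 ≤ A) :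
    ∃ C : ℝ, 0 ≤ C ∧ ∀ z : ℍ, ‖f z‖ ≤ C * z.im ^ (-A) := by
  obtain ⟨C₀, h0⟩ := CuspFormClass.exists_bound f
  have h1 := CuspFormClass.exp_decay_atImInfty (h := 1) f one_pos (by simp)
  have h2 : (fun z : ℍ => Real.exp (-2 * Real.pi * z.im / 1)) =O[UpperHalfPlane.atImInfty]
      fun z : ℍ => z.im ^ (-A) := by
    have := (isLittleO_exp_neg_mul_rpow_atTop (a := 2 * Real.pi) (by positivity) (-A)).isBigO
    refine (this.comp_tendsto (tendsto_comap (f := UpperHalfPlane.im))).congr_left fun z => ?_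
    simp
  obtain ⟨C₁, h3⟩ := (h1.trans h2).bound
  obtain ⟨Y, -, hY⟩ := (UpperHalfPlane.atImInfty_basis.eventually_iff).1 h3
  have hC₀ : 0 ≤ C₀ := by
    have h4 := (norm_nonneg _).trans (h0 UpperHalfPlane.I)
    simpa using h4
  refine ⟨|C₁| + C₀ * (max Y 1) ^ (A - k / 2), by positivity, fun z => ?_⟩
  have hz := z.im_pos
  rw [add_mul]
  rcases le_total Y z.im with h | h
  · have h4 := hY (show z ∈ UpperHalfPlane.im ⁻¹' Set.Ici Y from h)
    rw [Real.norm_of_nonneg (by positivity)] at h4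
    refine h4.trans (le_trans (mul_le_mul_of_nonneg_right (le_abs_self _) (by positivity))
      (le_add_of_nonneg_right (by positivity)))
  · refine (h0 z).trans (le_trans ?_ (le_add_of_nonneg_left (by positivity)))
    rw [div_eq_mul_inv, mul_assoc]
    refine mul_le_mul_of_nonneg_left ?_ hC₀
    have h5 : (z.im ^ (((k : ℤ) : ℝ) / 2))⁻¹ = z.im ^ (A - k / 2) * z.im ^ (-A) := by
      rw [← Real.rpow_neg hz.le, ← Real.rpow_add hz]
      congr 1
      push_cast
      ring
    rw [h5]
    refine mul_le_mul_of_nonneg_right ?_ (by positivity)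
    exact Real.rpow_le_rpow hz.le (h.trans (le_max_left _ _)) (by linarith)

lemma exists_norm_ev_le_pow {n : ℕ} (hn : k ≤ n) :
    ∃ C : ℝ, 0 ≤ C ∧ ∀ w : ℂ, 0 < w.im → ‖ev f w‖ ≤ C * (w.im ^ n)⁻¹ := by
  obtain ⟨C, hC, h⟩ := exists_norm_le_rpow f (A := n) (by
    have : (k : ℝ) ≤ n := by exact_mod_cast hn
    have : (0 : ℝ) ≤ k := by positivity
    linarith)
  refine ⟨C, hC, fun w hw => ?_⟩
  have := h ⟨w, hw⟩
  rw [Real.rpow_neg (UpperHalfPlane.im_pos _).le, Real.rpow_natCast] at this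
  rwa [ev_of_im_pos _ hw]

lemma polynomial_strip_bound (P : Polynomial ℂ) (R δ : ℝ) (hδ : 0 < δ) :
    ∃ (C : ℝ) (N : ℕ), 0 ≤ C ∧ ∀ w : ℂ, |w.re| ≤ R → δ ≤ w.im → ‖P.eval w‖ ≤ C * w.im ^ N := by
  have hw : ∀ w : ℂ, |w.re| ≤ R → δ ≤ w.im → 1 ≤ ((R + 1) / δ + 1 : ℝ) * w.im ∧
      ‖w‖ ≤ ((R + 1) / δ + 1 : ℝ) * w.im ∧ 0 ≤ (R + 1) / δ := fun w h1 h2 => by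
    have hR : 0 ≤ R := (abs_nonneg _).trans h1
    have h3 : 1 ≤ w.im / δ := (one_le_div hδ).2 h2
    have h4 : R + 1 ≤ (R + 1) * (w.im / δ) := le_mul_of_one_le_right (by linarith) h3
    have h5 : ((R + 1) / δ + 1 : ℝ) * w.im = (R + 1) * (w.im / δ) + w.im := by ring
    have h6 := Complex.norm_le_abs_re_add_abs_im w
    rw [abs_of_pos (hδ.trans_le h2)] at h6
    refine ⟨by linarith, by linarith, by positivity⟩
  refine ⟨(∑ i ∈ Finset.range (P.natDegree + 1), ‖P.coeff i‖) * |(R + 1) / δ + 1| ^ P.natDegree,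
    P.natDegree, by positivity, fun w h1 h2 => ?_⟩
  obtain ⟨h3, h4, h5⟩ := hw w h1 h2
  rw [Polynomial.eval_eq_sum_range, mul_assoc, ← mul_pow, Finset.sum_mul,
    abs_of_nonneg (by positivity)]
  refine (norm_sum_le _ _).trans (Finset.sum_le_sum fun i hi => ?_)
  rw [norm_mul, norm_pow]
  refine mul_le_mul_of_nonneg_left ?_ (norm_nonneg _)
  refine (pow_le_pow_left₀ (norm_nonneg _) h4 i).trans (pow_le_pow_right₀ h3 ?_)
  have := Finset.mem_range.1 hi
  omega

lemma stripDecay_mul_eval (P : Polynomial ℂ) : StripDecay fun w => ev f w * P.eval w where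
  differentiableOn := (differentiableOn_ev f).mul P.differentiable.differentiableOn
  bound R δ hδ := by
    obtain ⟨C₁, N, hC₁, h1⟩ := polynomial_strip_bound P R δ hδ
    -- `N` powers cancel the polynomial and `3` give the decay. The extra `k` only ensures `k ≤ n`,
    -- and is bounded by `δ^(-k)`.
    obtain ⟨C₂, hC₂, h2⟩ := exists_norm_ev_le_pow f (n := N + k + 3) (by omega)
    refine ⟨C₂ * C₁ * (δ ^ k)⁻¹, by positivity, fun w hw hw' => ?_⟩
    have hpos : 0 < w.im := hδ.trans_le hw'
    rw [norm_mul]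
    refine (mul_le_mul (h2 w hpos) (h1 w hw hw') (norm_nonneg _) (by positivity)).trans ?_
    have h3 : C₂ * (w.im ^ (N + k + 3))⁻¹ * (C₁ * w.im ^ N) =
        C₂ * C₁ * (w.im ^ k)⁻¹ * (w.im ^ 3)⁻¹ := by
      rw [pow_add, pow_add]
      field_simp
    rw [h3]
    gcongr

/-! ### Twisted L-values -/

lemma ratCast_add_I_mul_im (x : ℚ) (t : ℝ) : ((x : ℂ) + Complex.I * t).im = t := by simp

lemma exists_smul_eq (γ : SL(2, ℤ)) (hc : γ 1 0 ≠ 0) (z : ℍ) {t : ℝ}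
    (hz : (z : ℂ) = (invInfty γ : ℂ) + Complex.I * t) :
    j γ z = Complex.I * ((γ 1 0 : ℂ) * t) := by
  have hc' : (γ 1 0 : ℂ) ≠ 0 := by exact_mod_cast hc
  rw [j, hz, invInfty_eq]
  push_cast
  field_simp
  ring

lemma exists_invInfty_eq (x : ℚ) : ∃ γ : SL(2, ℤ), γ 1 0 = x.den ∧ invInfty γ = x := by
  obtain ⟨γ, hγ⟩ := exists_bottom_row ⟨(⟨x.den, x.pos⟩, -x.num), by
    rw [PNat.mk_coe, IsCoprime.neg_right_iff, Int.isCoprime_iff_nat_coprime]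
    exact x.reduced.symm⟩
  refine ⟨γ, hγ.1, ?_⟩
  rw [invInfty_eq, hγ.1, hγ.2]
  have := Rat.num_div_den x
  push_cast
  rw [neg_div, neg_neg]
  exact this

/-- If `γ` sends `x` to `∞` with lower-left entry `c`, then `|j(γ, x + it)| = ct` and `γ(x + it)`
has height `1/(c²t)`. The bound with exponent `A` at that point becomes `c^(2A-k) t^(A-k)`. -/
lemma exists_norm_ev_rat_le (hk : 0 < k) : ∃ C : ℝ, 0 ≤ C ∧ ∀ (x : ℚ) (t : ℝ), 0 < t →
    ‖ev f ((x : ℂ) + Complex.I * t)‖ ≤ C * (x.den : ℝ) ^ (k - 1) * t ^ (-(1 / 2) : ℝ) := by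
  have hk1 : (1 : ℝ) ≤ k := by exact_mod_cast hk
  -- This exponent makes `t^(A-k) = t^(-1/2)` integrable at `0`, at the price of only `c^(k-1)`.
  obtain ⟨C, hC, h⟩ := exists_norm_le_rpow f (A := k - 1 / 2) (by linarith)
  refine ⟨C, hC, fun x t ht => ?_⟩
  obtain ⟨γ, hγ, hx⟩ := exists_invInfty_eq x
  have him : 0 < ((x : ℂ) + Complex.I * t).im := by rwa [ratCast_add_I_mul_im]
  set z : ℍ := ⟨_, him⟩ with hzdef
  have hz : (z : ℂ) = (invInfty γ : ℂ) + Complex.I * t := by rw [hx]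
  have hc : (0 : ℝ) < x.den := by exact_mod_cast x.pos
  have hj := exists_smul_eq γ (by rw [hγ]; exact_mod_cast x.den_nz) z hz
  have hjn : ‖j γ z‖ = x.den * t := by
    rw [hj, hγ]
    simp [abs_of_pos ht]
  have hzim : z.im = t := ratCast_add_I_mul_im x t
  have h1 := h (γ • z)
  rw [cuspForm_smul, im_smul, norm_mul, norm_pow, hjn, hzim] at h1
  rw [ev_of_im_pos _ him, ← hzdef]
  have h2 : (t / (x.den * t) ^ 2) = ((x.den : ℝ) ^ 2 * t)⁻¹ := by field_simp
  have h3 : ((x.den : ℝ) ^ 2 * t)⁻¹ ^ (-((k : ℝ) - 1 / 2)) =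
      (x.den * t) ^ k * ((x.den : ℝ) ^ (k - 1) * t ^ (-(1 / 2) : ℝ)) := by
    rw [Real.inv_rpow (by positivity), ← Real.rpow_neg (by positivity), neg_neg,
      Real.mul_rpow (by positivity) ht.le, ← Real.rpow_natCast _ 2, ← Real.rpow_mul hc.le,
      mul_pow, mul_mul_mul_comm, ← pow_add]
    congr 1
    · rw [← Real.rpow_natCast]
      congr 1
      push_cast [Nat.cast_sub (show 1 ≤ k from hk)]
      ring
    · rw [← Real.rpow_natCast, ← Real.rpow_add ht]
      congr 1
  rw [h2, h3] at h1
  have h4 : 0 < (x.den * t) ^ k := by positivity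
  refine le_of_mul_le_mul_left (h1.trans (le_of_eq ?_)) h4
  ring

/-- The function dominating `f(x + i t) t ^ n`. -/
def dominant (t : ℝ) : ℝ := if t ≤ 1 then t ^ (-(1 / 2) : ℝ) else (t ^ 2)⁻¹

lemma integrableOn_dominant : IntegrableOn dominant (Set.Ioi 0) := by
  rw [← Set.Ioc_union_Ioi_eq_Ioi (zero_le_one' ℝ)]
  refine IntegrableOn.union ?_ ?_
  · have := (intervalIntegral.intervalIntegrable_rpow' (a := 0) (b := 1)
      (r := -(1 / 2)) (by norm_num)).1
    refine this.congr_fun (fun t ht => ?_) measurableSet_Ioc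
    simp only [dominant, if_pos ht.2]
  · have := integrableOn_Ioi_rpow_of_lt (a := -2) (c := 1) (by norm_num) one_pos
    refine this.congr_fun (fun t ht => ?_) measurableSet_Ioi
    have ht : 1 < t := ht
    simp only [dominant, if_neg (not_le.2 ht)]
    rw [Real.rpow_neg (by linarith)]
    norm_num

/-- A single integrable majorant for all rational `x`: the rational-point bound serves for `t ≤ 1`
and the decay of `f` for `t > 1`. -/
lemma exists_norm_ev_rat_mul_pow_le (hk : 0 < k) (n : ℕ) : ∃ C : ℝ, 0 ≤ C ∧ ∀ (x : ℚ) (t : ℝ), 0 < t →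
    ‖ev f ((x : ℂ) + Complex.I * t) * (t : ℂ) ^ n‖ ≤
      C * (x.den : ℝ) ^ (k - 1) * dominant t := by
  obtain ⟨C₁, hC₁, h1⟩ := exists_norm_ev_rat_le f hk
  obtain ⟨C₂, hC₂, h2⟩ := exists_norm_ev_le_pow f (n := n + k + 2) (by omega)
  refine ⟨max C₁ C₂, le_max_of_le_left hC₁, fun x t ht => ?_⟩
  have hd : (1 : ℝ) ≤ (x.den : ℝ) ^ (k - 1) := one_le_pow₀ (by exact_mod_cast x.pos)
  rw [norm_mul, norm_pow, Complex.norm_real, Real.norm_of_nonneg ht.le, dominant]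
  split_ifs with h
  · refine (mul_le_of_le_one_right (norm_nonneg _) (pow_le_one₀ ht.le h)).trans ?_
    refine (h1 x t ht).trans ?_
    gcongr
    exact le_max_left _ _
  · push Not at h
    have h3 := h2 ((x : ℂ) + Complex.I * t) (by rwa [ratCast_add_I_mul_im])
    rw [ratCast_add_I_mul_im] at h3
    refine (mul_le_mul_of_nonneg_right h3 (by positivity)).trans ?_
    have h4 : C₂ * (t ^ (n + k + 2))⁻¹ * t ^ n = C₂ * (t ^ k)⁻¹ * (t ^ 2)⁻¹ := by
      rw [pow_add, pow_add]
      field_simp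
    rw [h4]
    refine mul_le_mul_of_nonneg_right ?_ (by positivity)
    refine mul_le_mul (le_max_right _ _) ?_ (by positivity) (le_max_of_le_left hC₁)
    exact (inv_le_one_of_one_le₀ (one_le_pow₀ h.le)).trans hd

lemma continuousOn_ev_rat (x : ℚ) :
    ContinuousOn (fun t : ℝ => ev f ((x : ℂ) + Complex.I * t)) (Set.Ioi 0) := by
  refine (differentiableOn_ev f).continuousOn.comp (by fun_prop) fun t ht => ?_
  change 0 < ((x : ℂ) + Complex.I * t).im
  rwa [ratCast_add_I_mul_im]

lemma integrableOn_ev_rat_mul_pow (hk : 0 < k) (n : ℕ) (x : ℚ) :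
    IntegrableOn (fun t : ℝ => ev f ((x : ℂ) + Complex.I * t) * (t : ℂ) ^ n) (Set.Ioi 0) := by
  obtain ⟨C, -, h⟩ := exists_norm_ev_rat_mul_pow_le f hk n
  refine Integrable.mono' (integrableOn_dominant.const_mul (C * (x.den : ℝ) ^ (k - 1)))
    (((continuousOn_ev_rat f x).mul (by fun_prop)).aestronglyMeasurable measurableSet_Ioi) ?_
  filter_upwards [ae_restrict_mem measurableSet_Ioi] with t ht using h x t ht

lemma lambdaIntegrand_eq (f : ℍ → ℂ) (n : ℕ) (x : ℚ) (t : ℝ) :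
    lambdaIntegrand f ((n + 1 : ℕ) : ℂ) x t = ev f ((x : ℂ) + Complex.I * t) * (t : ℂ) ^ n := by
  rw [lambdaIntegrand]
  push_cast
  rw [add_sub_cancel_right, Complex.cpow_natCast]

lemma Lambda_eq (f : ℍ → ℂ) (n : ℕ) (x : ℚ) : Lambda f ((n + 1 : ℕ) : ℂ) x =
    ∫ t in Set.Ioi (0 : ℝ), ev f ((x : ℂ) + Complex.I * t) * (t : ℂ) ^ n := by
  simp only [Lambda, lambdaIntegrand_eq]

lemma exists_norm_Lambda_le (hk : 0 < k) (n : ℕ) : ∃ C : ℝ, ∀ x : ℚ,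
    ‖Lambda f ((n + 1 : ℕ) : ℂ) x‖ ≤ C * (x.den : ℝ) ^ (k - 1) := by
  obtain ⟨C, -, h⟩ := exists_norm_ev_rat_mul_pow_le f hk n
  refine ⟨C * ∫ t in Set.Ioi 0, dominant t, fun x => ?_⟩
  rw [Lambda_eq, mul_right_comm, ← integral_const_mul]
  refine norm_integral_le_of_norm_le (integrableOn_dominant.const_mul _) ?_
  filter_upwards [ae_restrict_mem measurableSet_Ioi] with t ht using h x t ht

lemma ev_add_intCast (n : ℤ) {w : ℂ} (hw : 0 < w.im) : ev f (w + n) = ev f w := by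
  have h := cuspForm_smul f (ModularGroup.T ^ n) ⟨w, hw⟩
  have h1 : j (ModularGroup.T ^ n) w = 1 := by
    simp [j, ModularGroup.coe_T_zpow]
  have h2 : ((ModularGroup.T ^ n • (⟨w, hw⟩ : ℍ) : ℍ) : ℂ) = w + n :=
    ModularGroup.coe_T_zpow_smul_eq _
  rw [← h2, ev_coe, ev_of_im_pos _ hw, h]
  change j (ModularGroup.T ^ n) w ^ k * _ = _
  rw [h1, one_pow, one_mul]

lemma Lambda_add_intCast (n : ℕ) (x : ℚ) (m : ℤ) :
    Lambda f ((n + 1 : ℕ) : ℂ) (x + m) = Lambda f ((n + 1 : ℕ) : ℂ) x := by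
  rw [Lambda_eq, Lambda_eq]
  refine setIntegral_congr_fun measurableSet_Ioi fun t ht => ?_
  have h := ev_add_intCast f m (w := (x : ℂ) + Complex.I * t) (by rwa [ratCast_add_I_mul_im])
  rw [← h]
  congr 2
  push_cast
  ring

lemma isTwist_Lambda (hk : 0 < k) {r s : ℤ} (hke : Even k) (hrs : Even (r + s))
    (hkrs : (k : ℤ) < r + s) (l m n : ℕ) :
    IsTwist (fun x => Lambda f ((m + n + 1 : ℕ) : ℂ) x)
      ((m : ℤ) + n - k + 2) (r + l + n + 2 - k) (s + m - l) where
  even := by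
    obtain ⟨a, ha⟩ := hrs
    obtain ⟨b, hb⟩ := hke
    exact ⟨m + n + 2 - b - b + a, by omega⟩
  periodic x N := Lambda_add_intCast f (m + n) x N
  bound := by
    obtain ⟨C, hC⟩ := exists_norm_Lambda_le f hk (m + n)
    -- The exponent is `(k - 1) + (m + n - k + 2)`. The requirement `E + 3 ≤ p + t` then reads `k +
    -- 2 ≤ r + s`, which is `k < r + s` improved by parity.
    refine ⟨C, m + n + 1, ?_, fun d c hdc => ?_⟩
    · obtain ⟨a, ha⟩ := hrs
      obtain ⟨b, hb⟩ := hke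
      push_cast
      omega
    · have h1 := hC ((d : ℚ) / (c : ℕ))
      have h2 : ((d : ℚ) / (c : ℕ)).den = (c : ℕ) := by
        have := Rat.den_div_eq_of_coprime (a := d) (b := ((c : ℕ) : ℤ)) (by exact_mod_cast c.pos)
          (by simpa using (Int.isCoprime_iff_nat_coprime.1 hdc).symm)
        exact_mod_cast this
      have hc : (0 : ℝ) < (c : ℕ) := by exact_mod_cast c.pos
      rw [h2] at h1
      refine (mul_le_mul_of_nonneg_right h1 (by positivity)).trans (le_of_eq ?_)
      rw [mul_assoc, ← zpow_natCast, ← zpow_natCast, ← zpow_add₀ hc.ne']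
      congr 2
      push_cast [Nat.cast_sub (show 1 ≤ k from hk)]
      ring

lemma IsTwist.star {u : ℚ → ℂ} {e p t : ℤ} (h : IsTwist u e p t) :
    IsTwist (fun x => conj (u x)) e p t where
  even := h.even
  periodic x n := by rw [h.periodic]
  bound := by simpa only [RCLike.norm_conj] using h.bound

end

end ModIter

namespace ModIter

noncomputable section

open MeasureTheory Filter Topology

variable {k : ℕ} (f : CuspForm 𝒮ℒ (k : ℤ))

/-! ### Fourier expansions of Eichler integrals -/

lemma exists_hasSum_nome : ∃ a : ℕ → ℂ, a 0 = 0 ∧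
    ∀ z : ℍ, HasSum (fun n => a n * nome z ^ n) (f z) := by
  refine ⟨fun n => (UpperHalfPlane.qExpansion 1 f).coeff n,
    CuspFormClass.qExpansion_coeff_zero f one_pos (by simp), fun z => ?_⟩
  have := ModularForm.hasSum_qExpansion f one_pos (by simp) z
  simpa [Function.Periodic.qParam, nome] using this

lemma integrableOn_pow_mul_exp (N : ℕ) {b : ℝ} (hb : 0 < b) :
    IntegrableOn (fun t : ℝ => t ^ N * Real.exp (-b * t)) (Set.Ioi 0) := by
  have := integrableOn_rpow_mul_exp_neg_mul_rpow (p := 1) (s := N) (b := b)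
    (by have : (0 : ℝ) ≤ N := by positivity
        linarith) one_pos hb
  simpa using this

/-- Translation of a point of the upper half-plane by `i t`. -/
def raise (z : ℍ) {t : ℝ} (ht : 0 < t) : ℍ :=
  ⟨z + Complex.I * t, by rw [add_I_mul_im]; exact add_pos z.im_pos ht⟩

lemma nome_raise (z : ℍ) {t : ℝ} (ht : 0 < t) :
    nome (raise z ht) = nome z * (Real.exp (-(2 * Real.pi) * t) : ℝ) := by
  rw [nome, nome, Complex.ofReal_exp, ← Complex.exp_add]
  congr 1
  simp only [raise]
  push_cast
  linear_combination 2 * Real.pi * t * Complex.I_mul_I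

/-- Termwise integration of the `q`-series. The constant term vanishes because `f` is cuspidal, and
for `n ≥ 1` the integral of `t^N e^(-2πnt)` is at most its value at `n = 1`, which justifies the
exchange. -/
lemma isDoubleSeries_moment (N : ℕ) :
    IsDoubleSeries fun z : ℍ => ∫ t in Set.Ioi (0 : ℝ), ev f (z + Complex.I * t) * (t : ℂ) ^ N := by
  obtain ⟨a, ha0, ha⟩ := exists_hasSum_nome f
  let h : ℕ → ℝ → ℝ := fun n t => t ^ N * Real.exp (-(2 * Real.pi * n) * t)
  have hint : ∀ n, n ≠ 0 → IntegrableOn (h n) (Set.Ioi 0) := fun n hn =>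
    integrableOn_pow_mul_exp N (by
      have : (0 : ℝ) < n := by exact_mod_cast Nat.pos_of_ne_zero hn
      have := Real.pi_pos
      positivity)
  refine .of_powerSeries (a := fun n => a n * ((∫ t in Set.Ioi (0 : ℝ), h n t : ℝ) : ℂ)) fun z => ?_
  let F : ℕ → ℝ → ℂ := fun n t => (a n * nome z ^ n) * (h n t : ℂ)
  have hF : ∀ n, IntegrableOn (F n) (Set.Ioi 0) := by
    intro n
    rcases eq_or_ne n 0 with rfl | hn
    · simp [F, ha0, IntegrableOn]
    · exact (hint n hn).ofReal.const_mul _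
  have hle : ∀ n, ∫ t in Set.Ioi (0 : ℝ), ‖F n t‖ ≤
      ‖a n * nome z ^ n‖ * ∫ t in Set.Ioi (0 : ℝ), h 1 t := by
    intro n
    rcases eq_or_ne n 0 with rfl | hn
    · simp [F, ha0]
    · simp only [F, norm_mul _ (Complex.ofReal _)]
      rw [integral_const_mul]
      refine mul_le_mul_of_nonneg_left ?_ (norm_nonneg _)
      refine setIntegral_mono_on ?_ (hint 1 one_ne_zero) measurableSet_Ioi fun t ht => ?_
      · exact (hint n hn).ofReal.norm
      · have ht : 0 < t := ht
        have hn1 : (1 : ℝ) ≤ n := by exact_mod_cast Nat.pos_of_ne_zero hn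
        rw [Complex.norm_real, Real.norm_of_nonneg (by positivity)]
        refine mul_le_mul_of_nonneg_left (Real.exp_le_exp.2 ?_) (by positivity)
        refine mul_le_mul_of_nonneg_right (neg_le_neg ?_) ht.le
        have := Real.pi_pos
        push_cast
        gcongr
  have hs : Summable fun n => ∫ t in Set.Ioi (0 : ℝ), ‖F n t‖ :=
    Summable.of_nonneg_of_le (fun n => integral_nonneg fun t => norm_nonneg _) hle
      ((ha z).summable.norm.mul_right _)
  have hsum := hasSum_integral_of_summable_integral_norm hF hs
  have h1 : ∫ t in Set.Ioi (0 : ℝ), ev f (z + Complex.I * t) * (t : ℂ) ^ N =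
      ∫ t in Set.Ioi (0 : ℝ), ∑' n, F n t := by
    refine setIntegral_congr_fun measurableSet_Ioi fun t ht => ?_
    have h2 := (ha (raise z ht)).mul_right ((t : ℂ) ^ N)
    have h3 : ev f (z + Complex.I * t) = f (raise z ht) := ev_coe f (raise z ht)
    have h4 : nome (raise z ht) = nome z * (Real.exp (-(2 * Real.pi) * t) : ℝ) := nome_raise z ht
    simp only [h3]
    rw [← h2.tsum_eq]
    refine tsum_congr fun n => ?_
    simp only [F, h]
    rw [h4, mul_pow, ← Complex.ofReal_pow, ← Real.exp_nat_mul, Complex.ofReal_mul, Complex.ofReal_pow,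
      show (n : ℝ) * (-(2 * Real.pi) * t) = -(2 * Real.pi * n) * t by ring]
    ring
  rw [h1]
  refine hsum.congr_fun fun n => ?_
  simp only [F]
  rw [integral_const_mul, integral_complex_ofReal]
  ring

lemma integrableOn_vertical (P : Polynomial ℂ) (z : ℍ) :
    IntegrableOn (fun t : ℝ => ev f (z + Complex.I * t) * P.eval ((z : ℂ) + Complex.I * t))
      (Set.Ioi 0) :=
  (stripDecay_mul_eval f P).integrableOn z.im_pos

lemma integrableOn_moment (N : ℕ) (z : ℍ) :
    IntegrableOn (fun t : ℝ => ev f (z + Complex.I * t) * (t : ℂ) ^ N) (Set.Ioi 0) := by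
  have := integrableOn_vertical f ((Polynomial.C (-Complex.I) *
    (Polynomial.X - Polynomial.C (z : ℂ))) ^ N) z
  refine this.congr_fun (fun t _ => ?_) measurableSet_Ioi
  simp only [Polynomial.eval_pow, Polynomial.eval_mul, Polynomial.eval_C, Polynomial.eval_sub,
    Polynomial.eval_X, add_sub_cancel_left]
  congr 2
  linear_combination -(t : ℂ) * Complex.I_mul_I

/-- On `w = z + it` one has `w - z = it` and `w - conj z = it + 2iy`, so the binomial theorem gives
powers of `y` times moments. -/
lemma hasFourierExpansion_intFromCusp (a b : ℕ) : HasFourierExpansion fun z : ℍ =>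
    intFromCusp (fun w => ev f w * (w - conj (z : ℂ)) ^ a * (w - z) ^ b) z := by
  have key : ∀ z : ℍ, intFromCusp (fun w => ev f w * (w - conj (z : ℂ)) ^ a * (w - z) ^ b) z =
      ∑ m ∈ Finset.range (a + 1), (-(Complex.I ^ (m + b + 1) * (2 * Complex.I) ^ (a - m) *
        (a.choose m : ℂ))) * ((z.im : ℂ) ^ ((a - m : ℕ) : ℤ) *
        ∫ t in Set.Ioi (0 : ℝ), ev f (z + Complex.I * t) * (t : ℂ) ^ (m + b)) := by
    intro z
    rw [intFromCusp]
    have h1 : ∀ t : ℝ, ev f (z + Complex.I * t) * (z + Complex.I * t - conj (z : ℂ)) ^ a *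
        (z + Complex.I * t - z) ^ b * Complex.I =
        ∑ m ∈ Finset.range (a + 1), (Complex.I ^ (m + b + 1) * (2 * Complex.I * z.im) ^ (a - m) *
          (a.choose m : ℂ)) * (ev f (z + Complex.I * t) * (t : ℂ) ^ (m + b)) := by
      intro t
      rw [show (z : ℂ) + Complex.I * t - conj (z : ℂ) = Complex.I * t + 2 * Complex.I * z.im by
        rw [← coe_sub_conj]; ring, add_pow, add_sub_cancel_left, Finset.mul_sum, Finset.sum_mul,
        Finset.sum_mul]
      refine Finset.sum_congr rfl fun m _ => ?_
      ring
    simp only [h1]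
    rw [integral_finsetSum _ fun m _ => (integrableOn_moment f (m + b) z).const_mul _,
      ← Finset.sum_neg_distrib]
    refine Finset.sum_congr rfl fun m _ => ?_
    rw [integral_const_mul, mul_pow, zpow_natCast]
    ring
  rw [funext key]
  exact HasFourierExpansion.sum fun m _ =>
    ((isDoubleSeries_moment f (m + b)).im_zpow_mul _).const_mul _

/-! ### Transformation of Eichler integrals -/

/-- The Möbius transformation attached to `γ`. -/
def mobius (γ : SL(2, ℤ)) (w : ℂ) : ℂ := ((γ 0 0 : ℂ) * w + (γ 0 1 : ℂ)) / j γ w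

lemma mobius_coe (γ : SL(2, ℤ)) (z : ℍ) : mobius γ z = (γ • z : ℍ) := (coe_smul γ z).symm

lemma det_eq (γ : SL(2, ℤ)) : (γ 0 0 : ℂ) * γ 1 1 - γ 0 1 * γ 1 0 = 1 := by
  have := γ.det_coe
  rw [Matrix.det_fin_two] at this
  exact_mod_cast this

lemma hasDerivAt_mobius (γ : SL(2, ℤ)) (z : ℍ) :
    HasDerivAt (mobius γ) (1 / j γ z ^ 2) z := by
  have hj := j_ne_zero γ z
  have h1 : HasDerivAt (fun w : ℂ => (γ 0 0 : ℂ) * w + (γ 0 1 : ℂ)) (γ 0 0 : ℂ) z := by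
    simpa using ((hasDerivAt_id (z : ℂ)).const_mul (γ 0 0 : ℂ)).add_const (γ 0 1 : ℂ)
  have h2 : HasDerivAt (j γ) (γ 1 0 : ℂ) z := by
    have := ((hasDerivAt_id (z : ℂ)).const_mul (γ 1 0 : ℂ)).add_const (γ 1 1 : ℂ)
    rwa [mul_one] at this
  refine (h1.div h2 hj).congr_deriv ?_
  congr 1
  rw [j]
  linear_combination det_eq γ

/-- The polynomials `P` and `Q` satisfy `Q = P | γ` in degree `k - 2`. -/
def IsSlash (k : ℕ) (γ : SL(2, ℤ)) (P Q : Polynomial ℂ) : Prop :=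
  ∀ z : ℍ, P.eval ((γ • z : ℍ) : ℂ) * j γ z ^ (k - 2) = Q.eval (z : ℂ)

variable {f} in
-- The difference has zero derivative in `z`: the weight `k` of `f` and the degree `k - 2` of the
-- polynomial cancel the factor `j^(-2)` from `d(γz)`.
lemma IsSlash.intFromCusp_sub_eq (hk : 2 ≤ k) {γ : SL(2, ℤ)} {P Q : Polynomial ℂ}
    (h : IsSlash k γ P Q) (z z' : ℍ) :
    intFromCusp (fun w => ev f w * P.eval w) (γ • z : ℍ) -
        intFromCusp (fun w => ev f w * Q.eval w) z =
      intFromCusp (fun w => ev f w * P.eval w) (γ • z' : ℍ) -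
        intFromCusp (fun w => ev f w * Q.eval w) z' := by
  let H : ℂ → ℂ := fun w => intFromCusp (fun w => ev f w * P.eval w) (mobius γ w) -
    intFromCusp (fun w => ev f w * Q.eval w) w
  have hH : ∀ w ∈ {w : ℂ | 0 < w.im}, HasDerivAt H 0 w := by
    intro w hw
    let z : ℍ := ⟨w, hw⟩
    have h1 := ((stripDecay_mul_eval f P).hasDerivAt_intFromCusp
      (γ • z : ℍ).im_pos).comp_of_eq w (hasDerivAt_mobius γ z) (mobius_coe γ z).symm
    have h2 := (stripDecay_mul_eval f Q).hasDerivAt_intFromCusp hw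
    refine (h1.sub h2).congr_deriv ?_
    have hj := j_ne_zero γ z
    have h3 : ev f w = f z := ev_of_im_pos f hw
    have h4 : Q.eval w = P.eval ((γ • z : ℍ) : ℂ) * j γ z ^ (k - 2) := (h z).symm
    rw [ev_coe, cuspForm_smul, h3, h4, sub_eq_zero]
    obtain ⟨n, rfl⟩ := Nat.exists_eq_add_of_le hk
    rw [Nat.add_sub_cancel_left, pow_add]
    field_simp
  have hconst := isOpen_im_pos.is_const_of_deriv_eq_zero (f := H)
    (convex_halfSpace_im_gt 0).isPreconnected
    (fun w hw => (hH w hw).differentiableAt.differentiableWithinAt)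
    (fun w hw => (hH w hw).deriv) z.im_pos z'.im_pos
  simpa only [H, mobius_coe] using hconst

variable {f} in
-- Such a `γ` acts as an integer translation. The constant difference is evaluated by moving `z` up
-- to `i∞`, where both integrals vanish.
lemma IsSlash.intFromCusp_of_mem (hk : 2 ≤ k) {γ : SL(2, ℤ)} {P Q : Polynomial ℂ}
    (h : IsSlash k γ P Q) (hγ : γ ∈ B) (z : ℍ) :
    intFromCusp (fun w => ev f w * P.eval w) (γ • z : ℍ) =
      intFromCusp (fun w => ev f w * Q.eval w) z := by
  rw [← sub_eq_zero]
  let w : ℕ → ℍ := fun n => raise UpperHalfPlane.I (t := n + 1) (by positivity)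
  have hw : Tendsto (fun n => (w n).im) atTop atTop := by
    have h1 : ∀ n, (w n).im = 1 + (n + 1) := fun n => by
      have := add_I_mul_im UpperHalfPlane.I ((n : ℝ) + 1)
      rw [UpperHalfPlane.coe_im, UpperHalfPlane.I_im] at this
      exact this
    simp only [h1]
    exact tendsto_atTop_add_const_left _ _
      (tendsto_atTop_add_const_right _ _ tendsto_natCast_atTop_atTop)
  have hre : ∀ n, (w n).re = 0 := fun n => add_I_mul_re UpperHalfPlane.I ((n : ℝ) + 1)
  rw [mem_B_iff] at hγ
  have hdet := det_eq γ
  rw [hγ, Int.cast_zero, mul_zero, sub_zero] at hdet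
  have had : (γ 0 0 : ℂ) = γ 1 1 := by
    have hdet' : (γ 0 0) * γ 1 1 = 1 := by exact_mod_cast hdet
    rcases Int.eq_one_or_neg_one_of_mul_eq_one' hdet' with h | h <;> rw [h.1, h.2]
  have hact : ∀ v : ℍ, ((γ • v : ℍ) : ℂ) = v + ((γ 0 0 * γ 0 1 : ℤ) : ℂ) := fun v => by
    rw [coe_smul, hγ, Int.cast_zero, zero_mul, zero_add,
      div_eq_iff (right_ne_zero_of_mul_eq_one hdet)]
    push_cast
    linear_combination (v : ℂ) * had - γ 0 1 * hdet
  have h1 : Tendsto (fun n => intFromCusp (fun w => ev f w * P.eval w) (γ • w n : ℍ)) atTop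
      (𝓝 0) := by
    refine (stripDecay_mul_eval f P).tendsto_intFromCusp (R := |((γ 0 0 * γ 0 1 : ℤ) : ℝ)|)
      (.of_forall fun n => le_of_eq ?_) (hw.congr fun n => ?_)
    · rw [hact, Complex.add_re, Complex.intCast_re, UpperHalfPlane.coe_re, hre, zero_add]
    · rw [hact, Complex.add_im, Complex.intCast_im, UpperHalfPlane.coe_im, add_zero]
  have h2 : Tendsto (fun n => intFromCusp (fun w => ev f w * Q.eval w) (w n : ℍ)) atTop
      (𝓝 0) :=
    (stripDecay_mul_eval f Q).tendsto_intFromCusp (R := 0)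
      (.of_forall fun n => by rw [UpperHalfPlane.coe_re, hre, abs_zero]) hw
  have h3 := (h1.sub h2).congr fun n => h.intFromCusp_sub_eq hk (w n) z
  rw [sub_zero] at h3
  exact tendsto_nhds_unique tendsto_const_nhds h3

lemma integrableOn_ev_rat_mul_eval (hk : 0 < k) (Q : Polynomial ℂ) (x : ℚ) :
    IntegrableOn (fun t : ℝ => ev f ((x : ℂ) + Complex.I * t) * Q.eval ((x : ℂ) + Complex.I * t))
      (Set.Ioi 0) := by
  let S : Polynomial ℂ := Q.comp (Polynomial.C (x : ℂ) + Polynomial.C Complex.I * Polynomial.X)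
  have h : ∀ t : ℝ, ev f ((x : ℂ) + Complex.I * t) * Q.eval ((x : ℂ) + Complex.I * t) =
      ∑ n ∈ Finset.range (S.natDegree + 1),
        S.coeff n * (ev f ((x : ℂ) + Complex.I * t) * (t : ℂ) ^ n) := fun t => by
    have h1 : Q.eval ((x : ℂ) + Complex.I * t) = S.eval (t : ℂ) := by simp [S]
    rw [h1, Polynomial.eval_eq_sum_range, Finset.mul_sum]
    exact Finset.sum_congr rfl fun n _ => by ring
  simp only [h]
  exact integrable_finsetSum _ fun n _ => (integrableOn_ev_rat_mul_pow f hk n x).const_mul _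

variable {f} in
-- The constant difference is evaluated as `z` descends vertically to `γ⁻¹∞`. Then `γz` climbs the
-- line of real part `a/c`, so the first integral vanishes and the second becomes the full period.
lemma IsSlash.intFromCusp_of_notMem (hk : 2 ≤ k) {γ : SL(2, ℤ)} {P Q : Polynomial ℂ}
    (h : IsSlash k γ P Q) (hγ : γ ∉ B) (z : ℍ) :
    intFromCusp (fun w => ev f w * P.eval w) (γ • z : ℍ) =
      intFromCusp (fun w => ev f w * Q.eval w) z +
        ∫ t in Set.Ioi (0 : ℝ), ev f ((invInfty γ : ℂ) + Complex.I * t) *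
          Q.eval ((invInfty γ : ℂ) + Complex.I * t) * Complex.I := by
  rw [← sub_eq_iff_eq_add']
  have hc : γ 1 0 ≠ 0 := fun h => hγ (mem_B_iff.2 h)
  have hc' : (γ 1 0 : ℂ) ≠ 0 := by exact_mod_cast hc
  let x : ℝ := (invInfty γ : ℚ)
  let w : ℕ → ℍ := fun n => ⟨(invInfty γ : ℂ) + Complex.I * ((1 / ((n : ℝ) + 1) : ℝ) : ℂ), by
    rw [ratCast_add_I_mul_im]; positivity⟩
  have hact : ∀ n, ((γ • w n : ℍ) : ℂ) = ((γ 0 0 / γ 1 0 : ℝ) : ℂ) +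
      Complex.I * (((n + 1) / (γ 1 0 : ℝ) ^ 2 : ℝ) : ℂ) := fun n => by
    have hj := exists_smul_eq γ hc (w n) rfl
    have hn : (n : ℂ) + 1 ≠ 0 := by exact_mod_cast n.succ_ne_zero
    have h1 : ((γ • w n : ℍ) : ℂ) = ((γ 0 0 : ℂ) * w n + (γ 0 1 : ℂ)) / j γ (w n) := coe_smul γ _
    rw [h1, hj, div_eq_iff (by
      refine mul_ne_zero Complex.I_ne_zero (mul_ne_zero hc' ?_)
      push_cast
      exact one_div_ne_zero hn)]
    simp only [w, invInfty_eq]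
    push_cast
    field_simp
    linear_combination (-((n : ℂ) + 1)) * Complex.I_mul_I - ((n : ℂ) + 1) * det_eq γ
  have h1 : Tendsto (fun n => intFromCusp (fun w => ev f w * P.eval w) (γ • w n : ℍ)) atTop
      (𝓝 0) := by
    refine (stripDecay_mul_eval f P).tendsto_intFromCusp (R := |(γ 0 0 / γ 1 0 : ℝ)|)
      (.of_forall fun n => le_of_eq ?_) ?_
    · rw [hact, add_I_mul_re, Complex.ofReal_re]
    · simp only [hact, add_I_mul_im, Complex.ofReal_im, zero_add]
      refine Tendsto.atTop_div_const (by positivity) ?_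
      exact tendsto_atTop_add_const_right _ _ tendsto_natCast_atTop_atTop
  have h2 := tendsto_intFromCusp_real (g := fun w => ev f w * Q.eval w) x
    (by simpa [x] using integrableOn_ev_rat_mul_eval f (by omega) Q (invInfty γ))
  simp only [x, Complex.ofReal_ratCast] at h2
  have h3 := (h1.sub h2).congr fun n => h.intFromCusp_sub_eq hk (w n) z
  rw [zero_sub, neg_neg] at h3
  exact tendsto_nhds_unique tendsto_const_nhds h3

end

end ModIter

namespace ModIter

noncomputable section

open Polynomial

/-! ### Linearity of sums over cosets -/

section CosetSum

variable {g h : SL(2, ℤ) → ℂ}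

lemma CosetSummable.const_mul (c : ℂ) (hg : CosetSummable g) : CosetSummable fun γ => c * g γ :=
  ⟨fun b hb γ => congrArg (c * ·) (hg.1 b hb γ), hg.2.mul_left c⟩

lemma CosetSummable.add (hg : CosetSummable g) (hh : CosetSummable h) :
    CosetSummable fun γ => g γ + h γ :=
  ⟨fun b hb γ => congrArg₂ (· + ·) (hg.1 b hb γ) (hh.1 b hb γ), hg.2.add hh.2⟩

lemma CosetSummable.sum {ι : Type*} {s : Finset ι} {g : ι → SL(2, ℤ) → ℂ}
    (hg : ∀ i ∈ s, CosetSummable (g i)) : CosetSummable fun γ => ∑ i ∈ s, g i γ :=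
  ⟨fun b hb γ => Finset.sum_congr rfl fun i hi => (hg i hi).1 b hb γ,
    summable_sum fun i hi => (hg i hi).2⟩

lemma cosetSum_const_mul (c : ℂ) (g : SL(2, ℤ) → ℂ) :
    cosetSum (fun γ => c * g γ) = c * cosetSum g := tsum_mul_left

lemma cosetSum_add (hg : CosetSummable g) (hh : CosetSummable h) :
    cosetSum (fun γ => g γ + h γ) = cosetSum g + cosetSum h := hg.2.tsum_add hh.2

lemma cosetSum_sum {ι : Type*} {s : Finset ι} {g : ι → SL(2, ℤ) → ℂ}
    (hg : ∀ i ∈ s, CosetSummable (g i)) :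
    cosetSum (fun γ => ∑ i ∈ s, g i γ) = ∑ i ∈ s, cosetSum (g i) :=
  Summable.tsum_finsetSum fun i hi => (hg i hi).2

lemma mk_mul_right_eq {x y : SL(2, ℤ)}
    (h : Quotient.mk (QuotientGroup.rightRel B) x = Quotient.mk _ y) (γ₀ : SL(2, ℤ)) :
    Quotient.mk (QuotientGroup.rightRel B) (x * γ₀) = Quotient.mk _ (y * γ₀) := by
  rw [Quotient.eq, QuotientGroup.rightRel_apply] at h ⊢
  simpa [mul_assoc] using h

/-- Right multiplication on the set of cosets. -/
def cosetMulRight (γ₀ : SL(2, ℤ)) : Cosets ≃ Cosets where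
  toFun q := Quotient.mk _ (q.out * γ₀)
  invFun q := Quotient.mk _ (q.out * γ₀⁻¹)
  left_inv q := by
    have h := mk_mul_right_eq (Quotient.out_eq (Quotient.mk (QuotientGroup.rightRel B)
      (q.out * γ₀))) γ₀⁻¹
    refine h.trans ?_
    rw [mul_inv_cancel_right, Quotient.out_eq]
  right_inv q := by
    have h := mk_mul_right_eq (Quotient.out_eq (Quotient.mk (QuotientGroup.rightRel B)
      (q.out * γ₀⁻¹))) γ₀
    refine h.trans ?_
    rw [inv_mul_cancel_right, Quotient.out_eq]

lemma cosetSum_mul_right (hg : ∀ b ∈ B, ∀ γ : SL(2, ℤ), g (b * γ) = g γ) (γ₀ : SL(2, ℤ)) :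
    cosetSum (fun γ => g (γ * γ₀)) = cosetSum g := by
  rw [cosetSum, cosetSum, ← (cosetMulRight γ₀).tsum_eq fun q => g q.out]
  exact tsum_congr fun q => (apply_out_mk hg _).symm

end CosetSum

/-! ### The action on polynomials -/

lemma eval_polySlash (n : ℕ) (γ : SL(2, ℤ)) (P : ℂ[X]) (x : ℂ) :
    (polySlash n γ P).eval x = ∑ i ∈ Finset.range (n + 1), P.coeff i *
      ((γ 0 0 : ℂ) * x + γ 0 1) ^ i * j γ x ^ (n - i) := by
  simp [polySlash, eval_finsetSum, j]

lemma natDegree_polySlash_le (n : ℕ) (γ : SL(2, ℤ)) (P : ℂ[X]) :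
    (polySlash n γ P).natDegree ≤ n := by
  refine natDegree_sum_le_of_forall_le _ _ fun i hi => ?_
  have hi : i ≤ n := by have := Finset.mem_range.1 hi; omega
  have h1 : ∀ a b : ℂ, (C a * X + C b).natDegree ≤ 1 := fun a b => natDegree_linear_le
  have h2 := natDegree_pow_le_of_le i (h1 (γ 0 0) (γ 0 1))
  have h3 := natDegree_pow_le_of_le (n - i) (h1 (γ 1 0) (γ 1 1))
  have h4 : (C (P.coeff i) * (C (γ 0 0 : ℂ) * X + C (γ 0 1 : ℂ)) ^ i).natDegree ≤ i * 1 :=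
    (natDegree_C_mul_le _ _).trans h2
  exact (natDegree_mul_le_of_le h4 h3).trans (by omega)

/-- The cocycle property of the action, in evaluated form to avoid composing polynomials with a
Möbius map; it drives the modularity of `phi`. -/
lemma eval_polySlash_mul (n : ℕ) (γ γ₀ : SL(2, ℤ)) (P : ℂ[X]) {x : ℂ} (hx : j γ₀ x ≠ 0) :
    (polySlash n γ P).eval (mobius γ₀ x) * j γ₀ x ^ n = (polySlash n (γ * γ₀) P).eval x := by
  have hm : ∀ u v : ℂ, (u * mobius γ₀ x + v) * j γ₀ x =
      u * ((γ₀ 0 0 : ℂ) * x + γ₀ 0 1) + v * j γ₀ x := fun u v => by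
    rw [mobius]
    field_simp
  have hmul : ∀ i k, (γ * γ₀) i k = γ i 0 * γ₀ 0 k + γ i 1 * γ₀ 1 k := fun i k => by
    rw [Matrix.SpecialLinearGroup.coe_mul, Matrix.mul_apply, Fin.sum_univ_two]
  rw [eval_polySlash, eval_polySlash, Finset.sum_mul]
  refine Finset.sum_congr rfl fun i hi => ?_
  have hi : i ≤ n := by have := Finset.mem_range.1 hi; omega
  have h1 : ((γ 0 0 : ℂ) * mobius γ₀ x + γ 0 1) * j γ₀ x =
      ((γ * γ₀) 0 0 : ℂ) * x + (γ * γ₀) 0 1 := by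
    rw [hm, hmul, hmul, j]
    push_cast
    ring
  have h2 : j γ (mobius γ₀ x) * j γ₀ x = j (γ * γ₀) x := by
    rw [j, hm, j, j, hmul, hmul]
    push_cast
    ring
  rw [← h1, ← h2, mul_pow, mul_pow, ← pow_mul_pow_sub (j γ₀ x) hi]
  ring

lemma j_mul_smul (γ γ₀ : SL(2, ℤ)) (z : ℍ) : j (γ * γ₀) z = j γ (γ₀ • z : ℍ) * j γ₀ z := by
  have hj := j_ne_zero γ₀ z
  have hmul : ∀ i k, (γ * γ₀) i k = γ i 0 * γ₀ 0 k + γ i 1 * γ₀ 1 k := fun i k => by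
    rw [Matrix.SpecialLinearGroup.coe_mul, Matrix.mul_apply, Fin.sum_univ_two]
  rw [← mobius_coe, mobius, j, j, hmul, hmul]
  field_simp
  rw [j]
  push_cast
  ring

lemma j_conj (γ : SL(2, ℤ)) (w : ℂ) : j γ (conj w) = conj (j γ w) := by simp [j]

lemma j_conj_ne_zero (γ : SL(2, ℤ)) (z : ℍ) : j γ (conj (z : ℂ)) ≠ 0 := by
  rw [j_conj]
  simpa using j_ne_zero γ z

lemma j_conj_mul_smul (γ γ₀ : SL(2, ℤ)) (z : ℍ) :
    j (γ * γ₀) (conj (z : ℂ)) = j γ (conj ((γ₀ • z : ℍ) : ℂ)) * j γ₀ (conj (z : ℂ)) := by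
  rw [j_conj, j_conj, j_conj, j_mul_smul, map_mul]

/-! ### Expansions in powers of `X - z` and `X - conj z` -/

/-- The polynomial `(X - z) ^ l (X - conj z) ^ (k - 2 - l)`. -/
def expBasis (k : ℕ) (z : ℍ) (l : ℕ) : ℂ[X] :=
  (X - C (z : ℂ)) ^ l * (X - C (conj (z : ℂ))) ^ (k - 2 - l)

lemma natDegree_expBasis_le {k l : ℕ} (hl : l ≤ k - 2) (z : ℍ) :
    (expBasis k z l).natDegree ≤ k - 2 := by
  refine (natDegree_mul_le_of_le (natDegree_pow_le_of_le l (natDegree_X_sub_C_le _))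
    (natDegree_pow_le_of_le _ (natDegree_X_sub_C_le _))).trans ?_
  omega

lemma isExpansion_iff {k : ℕ} {Φ : ℍ → ℂ[X]} {c : Fin (k - 1) → ℍ → ℂ} :
    IsExpansion k Φ c ↔ ∀ z, Φ z = ∑ i : Fin (k - 1), C (c i z) * expBasis k z i := by
  simp only [IsExpansion, expBasis, mul_assoc]

lemma conj_ne_self (z : ℍ) : (z : ℂ) - conj (z : ℂ) ≠ 0 := by
  rw [coe_sub_conj]
  have : (z.im : ℂ) ≠ 0 := by exact_mod_cast z.im_ne_zero
  exact mul_ne_zero (mul_ne_zero two_ne_zero Complex.I_ne_zero) this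

/-- Evaluation where `(X - z)/(X - conj z) = t` turns a relation into `∑ a_i t^i = 0`, up to a
nonzero factor, for every `t ≠ 1`. -/
lemma expBasis_independent {k : ℕ} (z : ℍ) {a : Fin (k - 1) → ℂ}
    (h : ∑ i : Fin (k - 1), C (a i) * expBasis k z i = 0) : a = 0 := by
  let P : ℂ[X] := ∑ i : Fin (k - 1), C (a i) * X ^ (i : ℕ)
  have hP : P = 0 := by
    refine eq_zero_of_infinite_isRoot P ((Set.finite_singleton (1 : ℂ)).infinite_compl.mono ?_)
    intro t ht
    have ht : 1 - t ≠ 0 := sub_ne_zero.2 fun h => ht h.symm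
    have hz := conj_ne_self z
    have h1 := congrArg (eval (((z : ℂ) - t * conj (z : ℂ)) / (1 - t))) h
    have e1 : ((z : ℂ) - t * conj (z : ℂ)) / (1 - t) - z =
        t * (((z : ℂ) - conj (z : ℂ)) / (1 - t)) := by field_simp; ring
    have e2 : ((z : ℂ) - t * conj (z : ℂ)) / (1 - t) - conj (z : ℂ) =
        ((z : ℂ) - conj (z : ℂ)) / (1 - t) := by field_simp; ring
    simp only [expBasis, eval_finsetSum, eval_mul, eval_C, eval_pow, eval_sub, eval_X, e1, e2,
      eval_zero] at h1
    have h2 : ∀ i : Fin (k - 1), a i * ((t * (((z : ℂ) - conj (z : ℂ)) / (1 - t))) ^ (i : ℕ) *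
        (((z : ℂ) - conj (z : ℂ)) / (1 - t)) ^ (k - 2 - (i : ℕ))) =
        a i * t ^ (i : ℕ) * (((z : ℂ) - conj (z : ℂ)) / (1 - t)) ^ (k - 2) := fun i => by
      have hi : (i : ℕ) ≤ k - 2 := by omega
      rw [mul_pow, ← pow_mul_pow_sub _ hi]
      ring
    simp only [h2] at h1
    rw [← Finset.sum_mul] at h1
    have h3 := (mul_eq_zero.1 h1).resolve_right (pow_ne_zero _ (div_ne_zero hz ht))
    simpa [P, IsRoot, eval_finsetSum] using h3
  funext i
  have h1 := congrArg (fun p => coeff p (i : ℕ)) hP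
  simpa [P, finsetSum_coeff, coeff_X_pow, Fin.val_inj, Finset.sum_ite_eq] using h1

lemma IsExpansion.unique {k : ℕ} {Φ : ℍ → ℂ[X]} {c c' : Fin (k - 1) → ℍ → ℂ}
    (h : IsExpansion k Φ c) (h' : IsExpansion k Φ c') : c = c' := by
  funext i z
  have h1 : ∑ i : Fin (k - 1), C (c i z - c' i z) * expBasis k z i = 0 := by
    simp only [C_sub, sub_mul, Finset.sum_sub_distrib]
    rw [← isExpansion_iff.1 h z, ← isExpansion_iff.1 h' z, sub_self]
  exact sub_eq_zero.1 (congrFun (expBasis_independent z h1) i)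

/-! ### Summation over the cosets and modularity of the coefficients -/

section Phi

variable {k : ℕ} {r s : ℤ} {F : ℍ → ℂ[X]}

lemma coeff_phi (z : ℍ) (i : ℕ) (hi : i < k - 1) :
    (phi k r s F z).coeff i = cosetSum (phiTerm k r s F z i) := by
  simp [phi, coeff_monomial, hi]

lemma coeff_phi_eq_zero (z : ℍ) (i : ℕ) (hi : ¬ i < k - 1) : (phi k r s F z).coeff i = 0 := by
  simp only [phi, finsetSum_coeff, coeff_monomial]
  refine Finset.sum_eq_zero fun m hm => if_neg ?_
  rintro rfl
  exact hi (Finset.mem_range.1 hm)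

/-- A termwise expansion in powers of `X - z` and `X - conj z` can be summed over the cosets. -/
lemma isExpansion_phi {T : ℕ → ℍ → SL(2, ℤ) → ℂ} (hT : ∀ l ≤ k - 2, ∀ z, CosetSummable (T l z))
    (h : ∀ z γ i, phiTerm k r s F z i γ =
      ∑ l : Fin (k - 1), (expBasis k z l).coeff i * T l z γ) :
    (∀ z i, CosetSummable (phiTerm k r s F z i)) ∧
      IsExpansion k (phi k r s F) fun l z => cosetSum (T l z) := by
  have hl : ∀ l : Fin (k - 1), (l : ℕ) ≤ k - 2 := fun l => by omega
  have h1 : ∀ z i, ∀ l ∈ (Finset.univ : Finset (Fin (k - 1))),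
      CosetSummable fun γ => (expBasis k z l).coeff i * T l z γ :=
    fun z i l _ => (hT l (hl l) z).const_mul _
  have h2 : ∀ z i, phiTerm k r s F z i = fun γ =>
    ∑ l : Fin (k - 1), (expBasis k z l).coeff i * T l z γ := fun z i => funext fun γ => h z γ i
  refine ⟨fun z i => h2 z i ▸ CosetSummable.sum (h1 z i), isExpansion_iff.2 fun z => ?_⟩
  ext i
  simp only [finsetSum_coeff, coeff_C_mul]
  by_cases hi : i < k - 1
  · rw [coeff_phi z i hi, h2, cosetSum_sum (h1 z i)]
    refine Finset.sum_congr rfl fun l _ => ?_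
    rw [cosetSum_const_mul, mul_comm]
  · rw [coeff_phi_eq_zero z i hi, Finset.sum_eq_zero]
    intro l _
    rw [coeff_eq_zero_of_natDegree_lt, mul_zero]
    exact (natDegree_expBasis_le (hl l) z).trans_lt (by have := l.2; omega)

lemma eval_phi (hk : 2 ≤ k) (hs : ∀ z i, CosetSummable (phiTerm k r s F z i)) (z : ℍ) (x : ℂ) :
    (phi k r s F z).eval x = cosetSum fun γ => (polySlash (k - 2) γ (F (γ • z))).eval x /
      (j γ z ^ r * j γ (conj (z : ℂ)) ^ s) := by
  have h1 : ∀ γ : SL(2, ℤ), (polySlash (k - 2) γ (F (γ • z))).eval x /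
      (j γ z ^ r * j γ (conj (z : ℂ)) ^ s) =
      ∑ i ∈ Finset.range (k - 1), x ^ i * phiTerm k r s F z i γ := fun γ => by
    rw [eval_eq_sum_range' (n := k - 1)
      ((natDegree_polySlash_le _ _ _).trans_lt (by omega)), Finset.sum_div]
    refine Finset.sum_congr rfl fun i _ => ?_
    rw [phiTerm]
    ring
  simp only [h1]
  rw [cosetSum_sum fun i _ => (hs z i).const_mul _, phi, eval_finsetSum]
  refine Finset.sum_congr rfl fun i _ => ?_
  rw [eval_monomial, cosetSum_const_mul, mul_comm]

/-- Right multiplication by `γ₀` permutes the cosets, and the cocycle relations extract the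
automorphy factors. -/
lemma eval_phi_smul (hk : 2 ≤ k) (hs : ∀ z i, CosetSummable (phiTerm k r s F z i))
    (γ₀ : SL(2, ℤ)) (z : ℍ) {x : ℂ} (hx : j γ₀ x ≠ 0) :
    (phi k r s F (γ₀ • z)).eval (mobius γ₀ x) * j γ₀ x ^ (k - 2) =
      j γ₀ z ^ r * j γ₀ (conj (z : ℂ)) ^ s * (phi k r s F z).eval x := by
  let g : SL(2, ℤ) → ℂ := fun γ => (polySlash (k - 2) γ (F (γ • z))).eval x /
      (j γ z ^ r * j γ (conj (z : ℂ)) ^ s)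
  have hg : ∀ b ∈ B, ∀ γ : SL(2, ℤ), g (b * γ) = g γ := by
    intro b hb γ
    have h1 : ∀ γ : SL(2, ℤ), g γ =
        ∑ i ∈ Finset.range (k - 1), x ^ i * phiTerm k r s F z i γ := fun γ => by
      simp only [g]
      rw [eval_eq_sum_range' (n := k - 1)
        ((natDegree_polySlash_le _ _ _).trans_lt (by omega)), Finset.sum_div]
      refine Finset.sum_congr rfl fun i _ => ?_
      rw [phiTerm]
      ring
    rw [h1, h1]
    exact Finset.sum_congr rfl fun i _ => by rw [(hs z i).1 b hb]
  rw [eval_phi hk hs, eval_phi hk hs, ← cosetSum_mul_right hg γ₀, ← cosetSum_const_mul,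
    mul_comm _ (j γ₀ x ^ (k - 2)), ← cosetSum_const_mul]
  congr 1
  funext γ
  simp only [g]
  rw [← eval_polySlash_mul _ _ _ _ hx, mul_smul, j_mul_smul, j_conj_mul_smul, mul_zpow, mul_zpow]
  have h1 := zpow_ne_zero r (j_ne_zero γ₀ z)
  have h2 := zpow_ne_zero s (j_conj_ne_zero γ₀ z)
  have h3 := zpow_ne_zero r (j_ne_zero γ (γ₀ • z))
  have h4 := zpow_ne_zero s (j_conj_ne_zero γ (γ₀ • z))
  field_simp

lemma mobius_sub_mobius (γ : SL(2, ℤ)) {x w : ℂ} (hx : j γ x ≠ 0) (hw : j γ w ≠ 0) :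
    mobius γ x - mobius γ w = (x - w) * (j γ x)⁻¹ * (j γ w)⁻¹ := by
  rw [mobius, mobius]
  field_simp
  rw [j, j]
  linear_combination (x - w) * det_eq γ

lemma infinite_j_ne_zero (γ : SL(2, ℤ)) : {x : ℂ | j γ x ≠ 0}.Infinite := by
  refine Set.Infinite.mono (s := Set.range fun z : ℍ => (z : ℂ)) ?_ ?_
  · rintro _ ⟨z, rfl⟩
    exact j_ne_zero γ z
  · have : Infinite ℍ := Infinite.of_injective (fun n : ℕ => (⟨n + Complex.I, by simp⟩ : ℍ))
      fun m n h => by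
        have := congrArg (fun z : ℍ => (z : ℂ)) h
        simpa using this
    exact Set.infinite_range_of_injective fun z w h => UpperHalfPlane.ext h

/-- Replacing `X - z` by `γX - γz` divides it by `j(γ, X) j(γ, z)`. The `X`-factors have total
degree `k - 2` and cancel, the `z`-factors shift the weights, and independence of the basis
separates the coefficients. -/
lemma IsExpansion.smul_eq (hk : 2 ≤ k) (hs : ∀ z i, CosetSummable (phiTerm k r s F z i))
    {c : Fin (k - 1) → ℍ → ℂ} (hc : IsExpansion k (phi k r s F) c) (l : Fin (k - 1))
    (γ : SL(2, ℤ)) (z : ℍ) :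
    c l (γ • z) = j γ z ^ (r + (l : ℕ)) * j γ (conj (z : ℂ)) ^ (s + k - 2 - (l : ℕ)) * c l z := by
  have hj := j_ne_zero γ z
  have hj' := j_conj_ne_zero γ z
  have hmc : conj (mobius γ z) = mobius γ (conj (z : ℂ)) := by
    rw [mobius, mobius, j_conj]
    simp
  let a : Fin (k - 1) → ℂ := fun l => c l (γ • z) * (j γ z ^ (l : ℕ))⁻¹ *
    (j γ (conj (z : ℂ)) ^ (k - 2 - (l : ℕ)))⁻¹ - j γ z ^ r * j γ (conj (z : ℂ)) ^ s * c l z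
  have ha : ∑ i : Fin (k - 1), C (a i) * expBasis k z i = 0 := by
    refine eq_of_infinite_eval_eq _ _ ((infinite_j_ne_zero γ).mono fun x hx => ?_)
    have hx : j γ x ≠ 0 := hx
    have h1 := eval_phi_smul hk hs γ z hx
    rw [isExpansion_iff.1 hc, isExpansion_iff.1 hc, eval_finsetSum, eval_finsetSum,
      Finset.mul_sum, Finset.sum_mul, ← sub_eq_zero, ← Finset.sum_sub_distrib] at h1
    change eval x _ = eval x 0
    rw [eval_zero, ← h1, eval_finsetSum]
    refine Finset.sum_congr rfl fun i _ => ?_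
    have hi : (i : ℕ) ≤ k - 2 := by omega
    simp only [expBasis, eval_mul, eval_C, eval_pow, eval_sub, eval_X, a]
    rw [← mobius_coe, hmc,
      mobius_sub_mobius γ hx hj, mobius_sub_mobius γ hx hj', mul_pow, mul_pow, mul_pow, mul_pow,
      ← pow_mul_pow_sub (j γ x) hi]
    simp only [inv_pow]
    have h2 := pow_ne_zero (i : ℕ) hx
    have h3 := pow_ne_zero (k - 2 - (i : ℕ)) hx
    field_simp
  have h2 := congrFun (expBasis_independent z ha) l
  simp only [a, Pi.zero_apply, sub_eq_zero] at h2
  have h3 := pow_ne_zero (l : ℕ) hj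
  have h4 := pow_ne_zero (k - 2 - (l : ℕ)) hj'
  have h5 : s + k - 2 - (l : ℕ) = s + ((k - 2 - (l : ℕ) : ℕ) : ℤ) := by
    have : (l : ℕ) < k - 1 := l.2
    omega
  rw [h5, zpow_add₀ hj, zpow_add₀ hj', zpow_natCast, zpow_natCast]
  field_simp at h2
  rw [h2]
  ring

end Phi

end

end ModIter

namespace ModIter

noncomputable section

open Polynomial MeasureTheory

/-! ### From termwise expansions to real-analytic modular forms -/

section Expansion

variable {k : ℕ} {r s : ℤ}

/-- The term at `γ` of the `l`-th coefficient of the expansion of `φ^±_{r,s}`; here `E` is the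
Eichler integral, and `a`, `u` are the coefficients and the twisted L-values. -/
def expTerm (k : ℕ) (r s : ℤ) (E : ℂ) (a : ℕ → ℕ → ℂ) (u : ℕ → ℚ → ℂ) (l : ℕ) (z : ℍ)
    (γ : SL(2, ℤ)) : ℂ :=
  (-1) ^ l * ((k - 2).choose l : ℂ) * (2 * Complex.I * z.im) ^ (2 - (k : ℤ)) * E *
      eisensteinTerm r s z γ +
    ∑ m ∈ Finset.range (l + 1), ∑ n ∈ Finset.range (k - 2 - l + 1),
      a m n * (2 * Complex.I * z.im) ^ (2 - (k : ℤ)) *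
        twistedTerm (u (m + n)) ((m : ℤ) + n - k + 2) (r + l + n + 2 - k) (s + m - l) z γ

variable {E : ℕ → ℍ → ℂ} {a : ℕ → ℕ → ℕ → ℂ} {u : ℕ → ℚ → ℂ}

lemma cosetSummable_sum_twistedTerm {l : ℕ} (A : ℕ → ℕ → ℂ)
    (hu : ∀ m n, IsTwist (u (m + n)) ((m : ℤ) + n - k + 2) (r + l + n + 2 - k) (s + m - l))
    (z : ℍ) (m : ℕ) (S : Finset ℕ) : CosetSummable fun γ => ∑ n ∈ S,
      A m n * twistedTerm (u (m + n)) ((m : ℤ) + n - k + 2) (r + l + n + 2 - k) (s + m - l) z γ :=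
  CosetSummable.sum fun n _ => ((hu m n).cosetSummable z).const_mul _

lemma cosetSummable_expTerm (hrs : Even (r + s)) (h3 : 3 ≤ r + s) {l : ℕ}
    (hu : ∀ m n, IsTwist (u (m + n)) ((m : ℤ) + n - k + 2) (r + l + n + 2 - k) (s + m - l))
    (e : ℂ) (A : ℕ → ℕ → ℂ) (z : ℍ) : CosetSummable (expTerm k r s e A u l z) :=
  ((cosetSummable_eisensteinTerm hrs h3 z).const_mul _).add
    (CosetSummable.sum fun m _ => cosetSummable_sum_twistedTerm
      (fun m n => A m n * (2 * Complex.I * z.im) ^ (2 - (k : ℤ))) hu z m _)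

lemma cosetSum_expTerm (hrs : Even (r + s)) (h3 : 3 ≤ r + s) {l : ℕ}
    (hu : ∀ m n, IsTwist (u (m + n)) ((m : ℤ) + n - k + 2) (r + l + n + 2 - k) (s + m - l))
    (e : ℂ) (A : ℕ → ℕ → ℂ) (z : ℍ) : cosetSum (expTerm k r s e A u l z) =
      (-1) ^ l * ((k - 2).choose l : ℂ) * (2 * Complex.I * z.im) ^ (2 - (k : ℤ)) * e *
        eisenstein r s z +
      ∑ m ∈ Finset.range (l + 1), ∑ n ∈ Finset.range (k - 2 - l + 1),
        A m n * (2 * Complex.I * z.im) ^ (2 - (k : ℤ)) * cosetSum (twistedTerm (u (m + n))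
          ((m : ℤ) + n - k + 2) (r + l + n + 2 - k) (s + m - l) z) := by
  have h1 := cosetSummable_sum_twistedTerm
      (fun m n => A m n * (2 * Complex.I * z.im) ^ (2 - (k : ℤ))) hu z
  refine (cosetSum_add ((cosetSummable_eisensteinTerm hrs h3 z).const_mul _)
    (CosetSummable.sum fun m _ => h1 m _)).trans ?_
  rw [cosetSum_const_mul, cosetSum_sum fun m _ => h1 m _]
  refine congrArg _ (Finset.sum_congr rfl fun m _ => ?_)
  rw [cosetSum_sum fun n _ => ((hu m n).cosetSummable z).const_mul _]
  exact Finset.sum_congr rfl fun n _ => cosetSum_const_mul _ _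

lemma hasFourierExpansion_cosetSum_expTerm (hrs : Even (r + s)) (h3 : 3 ≤ r + s) {l : ℕ}
    (hu : ∀ m n, IsTwist (u (m + n)) ((m : ℤ) + n - k + 2) (r + l + n + 2 - k) (s + m - l))
    {e : ℍ → ℂ} (he : HasFourierExpansion e) (A : ℕ → ℕ → ℂ) :
    HasFourierExpansion fun z => cosetSum (expTerm k r s (e z) A u l z) := by
  let p : ℤ := 2 - k
  have h1 : HasFourierExpansion ((fun z : ℍ => (-1) ^ l * ((k - 2).choose l : ℂ) *
      (2 * Complex.I) ^ p * ((z.im : ℂ) ^ p * (e z * eisenstein r s z))) +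
      fun z : ℍ => ∑ m ∈ Finset.range (l + 1), ∑ n ∈ Finset.range (k - 2 - l + 1),
        A m n * (2 * Complex.I) ^ p * ((z.im : ℂ) ^ p * cosetSum (twistedTerm (u (m + n))
          ((m : ℤ) + n - k + 2) (r + l + n + 2 - k) (s + m - l) z))) :=
    (((he.mul (hasFourierExpansion_eisenstein hrs h3)).im_zpow_mul p).const_mul _).add
      (HasFourierExpansion.sum fun m _ => HasFourierExpansion.sum fun n _ =>
        (((hu m n).hasFourierExpansion_cosetSum).im_zpow_mul p).const_mul _)
  convert h1 using 1
  funext z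
  rw [cosetSum_expTerm hrs h3 hu]
  simp only [Pi.add_apply, mul_zpow _ (z.im : ℂ), p]
  refine congrArg₂ _ (by ring) (Finset.sum_congr rfl fun m _ => Finset.sum_congr rfl fun n _ => ?_)
  ring

/-- The consequences of a termwise expansion of `φ^±_{r,s}`. -/
lemma expansion_of_phiTerm_eq (hk : 2 ≤ k) (hrs : Even (r + s)) (h3 : 3 ≤ r + s)
    {F : ℍ → ℂ[X]}
    (hu : ∀ l m n, IsTwist (u (m + n)) ((m : ℤ) + n - k + 2) (r + (l : ℕ) + n + 2 - k) (s + m - l))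
    (hE : ∀ l, HasFourierExpansion (E l))
    (h : ∀ z γ i, phiTerm k r s F z i γ = ∑ l : Fin (k - 1), (expBasis k z l).coeff i *
      expTerm k r s (E l z) (a l) u l z γ) :
    (∀ z i, CosetSummable (phiTerm k r s F z i)) ∧
    (∃! c : Fin (k - 1) → ℍ → ℂ, IsExpansion k (phi k r s F) c) ∧
    ∀ c : Fin (k - 1) → ℍ → ℂ, IsExpansion k (phi k r s F) c → ∀ l : Fin (k - 1),
      (∀ z, c l z = (-1) ^ (l : ℕ) * ((k - 2).choose l : ℂ) *
          (2 * Complex.I * z.im) ^ (2 - (k : ℤ)) * E l z * eisenstein r s z +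
        ∑ m ∈ Finset.range ((l : ℕ) + 1), ∑ n ∈ Finset.range (k - 2 - (l : ℕ) + 1),
          a l m n * (2 * Complex.I * z.im) ^ (2 - (k : ℤ)) * cosetSum (twistedTerm (u (m + n))
            ((m : ℤ) + n - k + 2) (r + (l : ℕ) + n + 2 - k) (s + m - (l : ℕ)) z)) ∧
      IsRealAnalyticModularForm (r + (l : ℕ)) (s + k - 2 - (l : ℕ)) (c l) := by
  obtain ⟨h1, h2⟩ := isExpansion_phi (T := fun l z => expTerm k r s (E l z) (a l) u l z)
    (fun l _ z => cosetSummable_expTerm hrs h3 (hu l) _ _ z) h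
  refine ⟨h1, ⟨_, h2, fun c hc => hc.unique h2⟩, fun c hc l => ?_⟩
  have hcl : c l = fun z => cosetSum (expTerm k r s (E l z) (a l) u l z) :=
    congrFun (hc.unique h2) l
  refine ⟨fun z => ?_, ?_⟩
  · rw [congrFun hcl z]
    exact cosetSum_expTerm hrs h3 (hu l) _ _ z
  · refine HasFourierExpansion.isRealAnalyticModularForm ?_ (hc.smul_eq hk h1 l)
    rw [hcl]
    exact hasFourierExpansion_cosetSum_expTerm hrs h3 (hu l) (hE l) _

end Expansion

/-! ### The polynomials attached to Eichler integrals -/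

variable {k : ℕ} (f : CuspForm 𝒮ℒ (k : ℤ))

/-- Exhibits each coefficient as a polynomial in `w`, so that the results on integrals of `f` times
a polynomial apply to `eichlerPlus`. -/
lemma coeff_C_sub_X_pow (d i : ℕ) (w : ℂ) : ((C w - X) ^ d : ℂ[X]).coeff i =
    (C ((-1) ^ d * (d.choose i : ℂ)) * (-X) ^ (d - i) : ℂ[X]).eval w := by
  rw [← neg_sub X (C w), neg_pow, show ((-1) ^ d : ℂ[X]) = C ((-1) ^ d) by simp, coeff_C_mul,
    sub_eq_add_neg, ← C_neg, coeff_X_add_C_pow]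
  simp only [eval_mul, eval_C, eval_pow, eval_neg, eval_X]
  ring

lemma sum_coeff_C_sub_X_pow (d : ℕ) (w a b : ℂ) :
    ∑ i ∈ Finset.range (d + 1), ((C w - X) ^ d : ℂ[X]).coeff i * a ^ i * b ^ (d - i) =
      (b * w - a) ^ d := by
  rw [← neg_sub a, neg_pow, sub_eq_add_neg a, add_pow, Finset.mul_sum]
  refine Finset.sum_congr rfl fun i _ => ?_
  rw [coeff_C_sub_X_pow, show -(b * w) = -w * b by ring, mul_pow (-w) b]
  simp only [eval_mul, eval_C, eval_pow, eval_neg, eval_X]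
  ring

lemma intFromCusp_sum_mul_eval {ι : Type*} (S : Finset ι) (a : ι → ℂ) (P : ι → ℂ[X]) (z : ℍ) :
    intFromCusp (fun w => ev f w * (∑ i ∈ S, C (a i) * P i).eval w) z =
      ∑ i ∈ S, a i * intFromCusp (fun w => ev f w * (P i).eval w) z := by
  have h1 : ∀ t : ℝ, ev f (z + Complex.I * t) * (∑ i ∈ S, C (a i) * P i).eval
      ((z : ℂ) + Complex.I * t) * Complex.I = ∑ i ∈ S, a i * (ev f (z + Complex.I * t) *
        (P i).eval ((z : ℂ) + Complex.I * t) * Complex.I) := fun t => by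
    simp only [eval_finsetSum, eval_mul, eval_C, Finset.mul_sum, Finset.sum_mul]
    exact Finset.sum_congr rfl fun i _ => by ring
  simp only [intFromCusp, h1]
  rw [integral_finsetSum _ fun i _ => ((integrableOn_vertical f (P i) z).mul_const _).const_mul _,
    ← Finset.sum_neg_distrib]
  refine Finset.sum_congr rfl fun i _ => ?_
  rw [integral_const_mul, mul_neg]

lemma eval_polySlash_eichlerPlus (hk : 2 ≤ k) (γ : SL(2, ℤ)) (z : ℍ) (x : ℂ) :
    (polySlash (k - 2) γ (eichlerPlus k f z)).eval x = intFromCusp (fun w => ev f w *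
      ((C (j γ x) * X - C ((γ 0 0 : ℂ) * x + γ 0 1)) ^ (k - 2)).eval w) z := by
  have hk1 : k - 2 + 1 = k - 1 := by omega
  let P : ℕ → ℂ[X] := fun i => C ((-1) ^ (k - 2) * ((k - 2).choose i : ℂ)) * (-X) ^ (k - 2 - i)
  have h1 : ∀ i ∈ Finset.range (k - 1), (eichlerPlus k f z).coeff i =
      intFromCusp (fun w => ev f w * (P i).eval w) z := by
    intro i hi
    simp only [eichlerPlus, finsetSum_coeff, coeff_monomial, coeff_C_sub_X_pow]
    rw [Finset.sum_ite_eq', if_pos hi]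
  have h2 : ((C (j γ x) * X - C ((γ 0 0 : ℂ) * x + γ 0 1)) ^ (k - 2) : ℂ[X]) =
      ∑ i ∈ Finset.range (k - 1),
        C (((γ 0 0 : ℂ) * x + γ 0 1) ^ i * j γ x ^ (k - 2 - i)) * P i := by
    refine Polynomial.funext fun w => ?_
    rw [eval_pow, eval_sub, eval_mul, eval_C, eval_C, eval_X, ← sum_coeff_C_sub_X_pow, hk1,
      eval_finsetSum]
    refine Finset.sum_congr rfl fun i _ => ?_
    rw [eval_mul, eval_C, coeff_C_sub_X_pow]
    ring
  rw [h2, intFromCusp_sum_mul_eval, eval_polySlash, hk1]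
  refine Finset.sum_congr rfl fun i hi => ?_
  rw [h1 i hi]
  ring

open Classical in
/-- The integral of `f(w) Q(w)` along the vertical line from `γ⁻¹ ∞` to `i ∞`. -/
def cuspPeriod (f : ℍ → ℂ) (γ : SL(2, ℤ)) (Q : ℂ[X]) : ℂ :=
  if γ ∈ B then 0 else ∫ t in Set.Ioi (0 : ℝ), ev f ((invInfty γ : ℂ) + Complex.I * t) *
    Q.eval ((invInfty γ : ℂ) + Complex.I * t) * Complex.I

lemma cuspPeriod_sum {ι : Type*} (hk : 2 ≤ k) (γ : SL(2, ℤ)) (S : Finset ι) (a : ι → ℂ)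
    (P : ι → ℂ[X]) :
    cuspPeriod f γ (∑ i ∈ S, C (a i) * P i) = ∑ i ∈ S, a i * cuspPeriod f γ (P i) := by
  unfold cuspPeriod
  split_ifs
  · simp
  · have h1 : ∀ w : ℂ, ev f w * (∑ i ∈ S, C (a i) * P i).eval w * Complex.I =
        ∑ i ∈ S, a i * (ev f w * (P i).eval w * Complex.I) := fun w => by
      simp only [eval_finsetSum, eval_mul, eval_C, Finset.mul_sum, Finset.sum_mul]
      exact Finset.sum_congr rfl fun i _ => by ring
    simp only [h1]
    rw [integral_finsetSum _ fun i _ =>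
      ((integrableOn_ev_rat_mul_eval f (by omega) (P i) _).mul_const _).const_mul _]
    exact Finset.sum_congr rfl fun i _ => integral_const_mul _ _

/-- The central identity. The integrand polynomials are related by `IsSlash`, since `γw - γx` is `w
- x` divided by both automorphy factors; clearing the factor at `x` removes any need for `j(γ, x) ≠
0`. -/
lemma eval_polySlash_eichlerPlus_smul (hk : 2 ≤ k) (γ : SL(2, ℤ)) (z : ℍ) (x : ℂ) :
    (polySlash (k - 2) γ (eichlerPlus k f (γ • z))).eval x =
      intFromCusp (fun w => ev f w * ((X - C x) ^ (k - 2)).eval w) z +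
        cuspPeriod f γ ((X - C x) ^ (k - 2)) := by
  have h : IsSlash k γ ((C (j γ x) * X - C ((γ 0 0 : ℂ) * x + γ 0 1)) ^ (k - 2))
      ((X - C x) ^ (k - 2)) := fun z => by
    simp only [eval_pow, eval_sub, eval_mul, eval_C, eval_X]
    rw [← mul_pow, ← mobius_coe, mobius]
    congr 1
    have hj := j_ne_zero γ z
    field_simp
    rw [j, j]
    linear_combination ((z : ℂ) - x) * det_eq γ
  rw [eval_polySlash_eichlerPlus f hk, cuspPeriod]
  split_ifs with hγ
  · rw [h.intFromCusp_of_mem hk hγ, add_zero]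
  · rw [h.intFromCusp_of_notMem hk hγ]

/-- The polynomial `(X - conj z) ^ l (X - z) ^ (k - 2 - l)`. -/
def dualBasis (k : ℕ) (z : ℍ) (l : ℕ) : ℂ[X] :=
  (X - C (conj (z : ℂ))) ^ l * (X - C (z : ℂ)) ^ (k - 2 - l)

/-- The coefficients of `(X - x) ^ (k - 2)` in terms of `expBasis` and `dualBasis`. -/
def pairing (k : ℕ) (z : ℍ) (l : ℕ) : ℂ :=
  (-1) ^ l * ((k - 2).choose l : ℂ) * (2 * Complex.I * z.im) ^ (2 - (k : ℤ))

lemma X_sub_C_pow_eq (hk : 2 ≤ k) (z : ℍ) (x : ℂ) : ((X - C x) ^ (k - 2) : ℂ[X]) =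
    ∑ l : Fin (k - 1), C (pairing k z l * (expBasis k z l).eval x) * dualBasis k z l := by
  refine Polynomial.funext fun w => ?_
  have hz := conj_ne_self z
  have h1 : w - x = ((z : ℂ) - conj (z : ℂ))⁻¹ * (-((x - z) * (w - conj (z : ℂ))) +
      (x - conj (z : ℂ)) * (w - z)) := by
    field_simp
    ring
  have h2 : (((z : ℂ) - conj (z : ℂ))⁻¹) ^ (k - 2) = (2 * Complex.I * z.im) ^ (2 - (k : ℤ)) := by
    rw [coe_sub_conj, inv_pow, ← zpow_natCast, ← zpow_neg]
    congr 1
    omega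
  rw [Fin.sum_univ_eq_sum_range fun l => C (pairing k z l * (expBasis k z l).eval x) *
    dualBasis k z l, show k - 1 = k - 2 + 1 by omega]
  simp only [eval_finsetSum, eval_pow, eval_sub, eval_X, eval_C, eval_mul, expBasis, dualBasis]
  rw [h1, mul_pow, add_pow, Finset.mul_sum, h2]
  refine Finset.sum_congr rfl fun l _ => ?_
  rw [pairing, neg_pow, mul_pow, mul_pow]
  ring

/-- The expansion of the terms of `φ^+_{r,s}`. -/
lemma polySlash_eichlerPlus_smul (hk : 2 ≤ k) (γ : SL(2, ℤ)) (z : ℍ) :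
    polySlash (k - 2) γ (eichlerPlus k f (γ • z)) = ∑ l : Fin (k - 1), C (pairing k z l *
      (intFromCusp (fun w => ev f w * (dualBasis k z l).eval w) z +
        cuspPeriod f γ (dualBasis k z l))) * expBasis k z l := by
  refine Polynomial.funext fun x => ?_
  rw [eval_polySlash_eichlerPlus_smul f hk, X_sub_C_pow_eq hk z x, intFromCusp_sum_mul_eval,
    cuspPeriod_sum f hk, ← Finset.sum_add_distrib]
  simp only [eval_finsetSum, eval_mul, eval_C]
  exact Finset.sum_congr rfl fun l _ => by ring

/-- Because `γ⁻¹∞ - w = -j(γ, w)/c`, both factors of the basis polynomial are binomials in `it`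
along the line of integration. -/
lemma cuspPeriod_dualBasis (hk : 2 ≤ k) {γ : SL(2, ℤ)} (hγ : γ ∉ B) (z : ℍ) (l : ℕ) :
    cuspPeriod f γ (dualBasis k z l) = ∑ m ∈ Finset.range (l + 1),
      ∑ n ∈ Finset.range (k - 2 - l + 1), (l.choose m : ℂ) * ((k - 2 - l).choose n : ℂ) *
        Complex.I ^ (m + n + 1) * (-(j γ (conj (z : ℂ)) / γ 1 0)) ^ (l - m) *
        (-(j γ z / γ 1 0)) ^ (k - 2 - l - n) * Lambda f ((m + n + 1 : ℕ) : ℂ) (invInfty γ) := by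
  have hc : (γ 1 0 : ℂ) ≠ 0 := by exact_mod_cast fun h => hγ (mem_B_iff.2 h)
  have h1 : ∀ w : ℂ, (invInfty γ : ℂ) - w = -(j γ w / γ 1 0) := fun w => by
    rw [invInfty_eq, j]
    push_cast
    field_simp
    ring
  have h2 : ∀ (t : ℝ) (w : ℂ), (invInfty γ : ℂ) + Complex.I * t - w =
      Complex.I * t + -(j γ w / γ 1 0) := fun t w => by rw [← h1]; ring
  have h3 : ∀ t : ℝ, ev f ((invInfty γ : ℂ) + Complex.I * t) *
      (dualBasis k z l).eval ((invInfty γ : ℂ) + Complex.I * t) * Complex.I =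
      ∑ m ∈ Finset.range (l + 1), ∑ n ∈ Finset.range (k - 2 - l + 1),
        (l.choose m : ℂ) * ((k - 2 - l).choose n : ℂ) *
        Complex.I ^ (m + n + 1) * (-(j γ (conj (z : ℂ)) / γ 1 0)) ^ (l - m) *
        (-(j γ z / γ 1 0)) ^ (k - 2 - l - n) *
        (ev f ((invInfty γ : ℂ) + Complex.I * t) * (t : ℂ) ^ (m + n)) := fun t => by
    simp only [dualBasis, eval_mul, eval_pow, eval_sub, eval_X, eval_C, h2]
    rw [add_pow, add_pow, Finset.sum_mul_sum]
    simp only [Finset.mul_sum, Finset.sum_mul]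
    refine Finset.sum_congr rfl fun m _ => Finset.sum_congr rfl fun n _ => ?_
    ring
  have h4 := fun m n => (integrableOn_ev_rat_mul_pow f (by omega) (m + n) (invInfty γ)).const_mul
    ((l.choose m : ℂ) * ((k - 2 - l).choose n : ℂ) *
        Complex.I ^ (m + n + 1) * (-(j γ (conj (z : ℂ)) / γ 1 0)) ^ (l - m) *
        (-(j γ z / γ 1 0)) ^ (k - 2 - l - n))
  rw [cuspPeriod, if_neg hγ]
  simp only [h3]
  rw [integral_finsetSum _ fun m _ => integrable_finsetSum _ fun n _ => h4 m n]
  refine Finset.sum_congr rfl fun m _ => ?_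
  rw [integral_finsetSum _ fun n _ => h4 m n]
  refine Finset.sum_congr rfl fun n _ => ?_
  rw [integral_const_mul, Lambda_eq]

/-- Comparison of the terms of a cusp period with those of the twisted series. -/
lemma pairing_mul_div_eq (hk : 2 ≤ k) (hke : Even k) {r s : ℤ} {i : ℂ} (hi : i ^ 2 = -1)
    {γ : SL(2, ℤ)} (hγ : γ ∉ B) (u : ℚ → ℂ) (z : ℍ) {l m n : ℕ} (hm : m ≤ l) (hl : l ≤ k - 2)
    (hn : n ≤ k - 2 - l) :
    pairing k z l * ((l.choose m : ℂ) * ((k - 2 - l).choose n : ℂ) * i ^ (m + n + 1) *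
        (-(j γ (conj (z : ℂ)) / γ 1 0)) ^ (l - m) * (-(j γ z / γ 1 0)) ^ (k - 2 - l - n) *
        u (invInfty γ)) / (j γ z ^ r * j γ (conj (z : ℂ)) ^ s) =
      i ^ (1 - 2 * (l : ℤ) - m - n) * ((k - 2).choose l : ℂ) * (l.choose m : ℂ) *
        ((k - 2 - l).choose n : ℂ) * (2 * Complex.I * z.im) ^ (2 - (k : ℤ)) *
        twistedTerm u ((m : ℤ) + n - k + 2) (r + l + n + 2 - k) (s + m - l) z γ := by
  have hc : (γ 1 0 : ℂ) ≠ 0 := by exact_mod_cast fun h => hγ (mem_B_iff.2 h)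
  have hj := j_ne_zero γ z
  have hj' := j_conj_ne_zero γ z
  have hi0 : i ≠ 0 := by
    rintro rfl
    norm_num at hi
  obtain ⟨p, rfl⟩ := Nat.exists_eq_add_of_le hm
  obtain ⟨q, hq⟩ := Nat.exists_eq_add_of_le hn
  have hkq : k = m + p + n + q + 2 := by omega
  -- The two exponents of `i` differ by a multiple of `4`; this is where evenness of `k` enters the
  -- shape of `α_{m,n}`.
  have hsign : (-1 : ℂ) ^ (m + p) * ((-1) ^ p * (-1) ^ q) * i ^ (m + n + 1) =
      i ^ (1 - 2 * ((m + p : ℕ) : ℤ) - m - n) := by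
    have h4 : ∀ a : ℕ, (-1 : ℂ) ^ a = i ^ (2 * a : ℤ) := fun a => by
      rw [zpow_mul, zpow_natCast, zpow_ofNat, hi]
    have h5 : i ^ (4 : ℤ) = 1 := by
      norm_cast
      rw [show 4 = 2 * 2 from rfl, pow_mul, hi]
      norm_num
    rw [h4, h4, h4, ← zpow_natCast i, ← zpow_add₀ hi0, ← zpow_add₀ hi0, ← zpow_add₀ hi0]
    obtain ⟨k', rfl⟩ := hke
    have h6 : (2 * ((m + p : ℕ) : ℤ) + (2 * (p : ℤ) + 2 * (q : ℤ)) + ((m + n + 1 : ℕ) : ℤ)) =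
        (1 - 2 * ((m + p : ℕ) : ℤ) - m - n) + 4 * ((m : ℤ) + p + k' - 1) := by
      push_cast
      omega
    rw [h6, zpow_add₀ hi0, zpow_mul, h5, one_zpow, mul_one]
  rw [twistedTerm, if_neg hγ, ← hsign, pairing, hq, Nat.add_sub_cancel_left, Nat.add_sub_cancel_left,
    neg_pow (j γ (conj (z : ℂ)) / _), neg_pow (j γ z / _), div_pow, div_pow,
    show ((m : ℤ) + n - k + 2) = -p - q by rw [hkq]; push_cast; ring,
    show r + ((m + p : ℕ) : ℤ) + n + 2 - k = r - q by rw [hkq]; push_cast; ring,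
    show s + (m : ℤ) - ((m + p : ℕ) : ℤ) = s - p by push_cast; ring,
    zpow_sub₀ hc, zpow_sub₀ hj, zpow_sub₀ hj', zpow_neg, zpow_natCast, zpow_natCast, zpow_natCast,
    zpow_natCast]
  field_simp

end

end ModIter

namespace ModIter

noncomputable section

open Polynomial MeasureTheory

variable {k : ℕ} (f : CuspForm 𝒮ℒ (k : ℤ))

/-! ### The termwise expansions in the plus and minus cases, and the theorem -/

lemma pairing_mul_div_eq_expTerm (hk : 2 ≤ k) (hke : Even k) {r s : ℤ} {i : ℂ} (hi : i ^ 2 = -1)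
    {γ : SL(2, ℤ)} {u : ℕ → ℚ → ℂ} {z : ℍ} {l : ℕ} (hl : l ≤ k - 2) (E : ℂ) {R : ℂ}
    {a : ℕ → ℕ → ℂ} (ha : ∀ m n, a m n = i ^ (1 - 2 * (l : ℤ) - m - n) *
      ((k - 2).choose l : ℂ) * (l.choose m : ℂ) * ((k - 2 - l).choose n : ℂ))
    (hR : γ ∈ B → R = 0) (hR' : γ ∉ B → R = ∑ m ∈ Finset.range (l + 1),
      ∑ n ∈ Finset.range (k - 2 - l + 1), (l.choose m : ℂ) * ((k - 2 - l).choose n : ℂ) *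
        i ^ (m + n + 1) * (-(j γ (conj (z : ℂ)) / γ 1 0)) ^ (l - m) *
        (-(j γ z / γ 1 0)) ^ (k - 2 - l - n) * u (m + n) (invInfty γ)) :
    pairing k z l * (E + R) / (j γ z ^ r * j γ (conj (z : ℂ)) ^ s) = expTerm k r s E a u l z γ := by
  rw [expTerm, mul_add, add_div, eisensteinTerm, mul_one_div, pairing, ← pairing]
  congr 1
  by_cases hγ : γ ∈ B
  · rw [hR hγ, mul_zero, zero_div]
    simp [twistedTerm_of_mem _ _ _ _ _ hγ]
  · rw [hR' hγ, Finset.mul_sum, Finset.sum_div]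
    refine Finset.sum_congr rfl fun m hm => ?_
    rw [Finset.mul_sum, Finset.sum_div]
    refine Finset.sum_congr rfl fun n hn => ?_
    rw [pairing_mul_div_eq hk hke hi hγ _ z (Finset.mem_range_succ_iff.1 hm) hl
      (Finset.mem_range_succ_iff.1 hn), ha]

lemma phiTerm_eichlerPlus (hk : 2 ≤ k) (hke : Even k) (r s : ℤ) (z : ℍ) (γ : SL(2, ℤ)) (i : ℕ) :
    phiTerm k r s (eichlerPlus k f) z i γ = ∑ l : Fin (k - 1), (expBasis k z l).coeff i *
      expTerm k r s (intFromCusp (fun w => ev f w * (w - conj (z : ℂ)) ^ (l : ℕ) *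
        (w - z) ^ (k - 2 - (l : ℕ))) z) (alpha k l)
        (fun N x => Lambda f ((N + 1 : ℕ) : ℂ) x) l z γ := by
  rw [phiTerm, polySlash_eichlerPlus_smul f hk, finsetSum_coeff, Finset.sum_div]
  refine Finset.sum_congr rfl fun l _ => ?_
  have hl : (l : ℕ) ≤ k - 2 := by omega
  have h1 := pairing_mul_div_eq_expTerm (r := r) (s := s) (γ := γ) (z := z) (a := alpha k l)
    (u := fun N x => Lambda f ((N + 1 : ℕ) : ℂ) x) (R := cuspPeriod f γ (dualBasis k z l))
    hk hke Complex.I_sq hl (intFromCusp (fun w => ev f w * (w - conj (z : ℂ)) ^ (l : ℕ) *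
      (w - z) ^ (k - 2 - (l : ℕ))) z) (fun _ _ => by rw [alpha]) (fun hγ => by
        rw [cuspPeriod, if_pos hγ]) (fun hγ => cuspPeriod_dualBasis f hk hγ z l)
  rw [coeff_C_mul, ← h1]
  simp only [dualBasis, eval_mul, eval_pow, eval_sub, eval_X, eval_C, mul_assoc]
  ring

lemma map_conj_polySlash (n : ℕ) (γ : SL(2, ℤ)) (P : ℂ[X]) :
    polySlash n γ (P.map (starRingEnd ℂ)) = (polySlash n γ P).map (starRingEnd ℂ) := by
  simp [polySlash, Polynomial.map_sum]

lemma map_conj_expBasis {l : ℕ} (hl : l ≤ k - 2) (z : ℍ) :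
    (expBasis k z l).map (starRingEnd ℂ) = expBasis k z (k - 2 - l) := by
  simp [expBasis, Nat.sub_sub_self hl, mul_comm]

/-- Conjugation sends `2iy` to `-2iy`, harmless in an even power, and `(-1)^(k-2-l) = (-1)^l` for
the same reason. -/
lemma conj_pairing_rev (hk : 2 ≤ k) (hke : Even k) {l : ℕ} (hl : l ≤ k - 2) (z : ℍ) :
    conj (pairing k z (k - 2 - l)) = pairing k z l := by
  have h1 : (-1 : ℂ) ^ (k - 2 - l) = (-1) ^ l := by
    obtain ⟨k', rfl⟩ := hke
    rw [neg_one_pow_eq_pow_mod_two, neg_one_pow_eq_pow_mod_two (n := l)]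
    congr 1
    omega
  have h2 : Even (2 - (k : ℤ)) := by
    obtain ⟨k', rfl⟩ := hke
    exact ⟨1 - k', by push_cast; ring⟩
  rw [pairing, pairing, h1, Nat.choose_symm hl]
  simp only [map_mul, map_pow, map_neg, map_one, map_natCast, map_zpow₀, map_ofNat, Complex.conj_I,
    Complex.conj_ofReal]
  rw [mul_neg, neg_mul, h2.neg_zpow]

/-- Conjugating the expansion of the plus case exchanges `X - z` with `X - conj z`, so the basis
index is reversed. The comparison with `expTerm` is then made with `-i` as the square root of `-1`.
-/
lemma phiTerm_eichlerMinus (hk : 2 ≤ k) (hke : Even k) (r s : ℤ) (z : ℍ) (γ : SL(2, ℤ)) (i : ℕ) :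
    phiTerm k r s (eichlerMinus k f) z i γ = ∑ l : Fin (k - 1), (expBasis k z l).coeff i *
      expTerm k r s (conj (intFromCusp (fun w => ev f w * (w - conj (z : ℂ)) ^ (k - 2 - (l : ℕ)) *
        (w - z) ^ (l : ℕ)) z)) (fun m n => conj (alpha k l m n))
        (fun N x => conj (Lambda f ((N + 1 : ℕ) : ℂ) x)) l z γ := by
  have h1 : polySlash (k - 2) γ (eichlerMinus k f (γ • z)) = ∑ l : Fin (k - 1), C (pairing k z l *
      (conj (intFromCusp (fun w => ev f w * (dualBasis k z (k - 2 - l)).eval w) z) +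
        conj (cuspPeriod f γ (dualBasis k z (k - 2 - l))))) * expBasis k z l := by
    rw [eichlerMinus, map_conj_polySlash, polySlash_eichlerPlus_smul f hk, Polynomial.map_sum,
      ← Equiv.sum_comp Fin.revPerm]
    refine Finset.sum_congr rfl fun l _ => ?_
    have hl : (l : ℕ) ≤ k - 2 := by omega
    have hl' : ((Fin.revPerm l : Fin (k - 1)) : ℕ) = k - 2 - l := by
      rw [Fin.revPerm_apply, Fin.val_rev]
      omega
    rw [hl', Polynomial.map_mul, map_C, map_conj_expBasis (by omega), map_mul, map_add,
      conj_pairing_rev hk hke hl, Nat.sub_sub_self hl]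
  rw [phiTerm, h1, finsetSum_coeff, Finset.sum_div]
  refine Finset.sum_congr rfl fun l _ => ?_
  have hl : (l : ℕ) ≤ k - 2 := by omega
  have hI : (-Complex.I) ^ 2 = -1 := by rw [neg_sq, Complex.I_sq]
  have h2 := pairing_mul_div_eq_expTerm (r := r) (s := s) (γ := γ) (z := z)
    (a := fun m n => conj (alpha k l m n)) (u := fun N x => conj (Lambda f ((N + 1 : ℕ) : ℂ) x))
    (R := conj (cuspPeriod f γ (dualBasis k z (k - 2 - l)))) hk hke hI hl
    (conj (intFromCusp (fun w => ev f w * (w - conj (z : ℂ)) ^ (k - 2 - (l : ℕ)) *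
      (w - z) ^ (l : ℕ)) z)) (fun m n => by simp [alpha])
    (fun hγ => by rw [cuspPeriod, if_pos hγ, map_zero]) (fun hγ => by
      -- Passing from `l` to `k - 2 - l` interchanges the roles of `m` and `n`, and conjugation
      -- interchanges `j(γ, z)` and `j(γ, conj z)` back.
      rw [cuspPeriod_dualBasis f hk hγ, Nat.sub_sub_self hl, Finset.sum_comm, map_sum]
      refine Finset.sum_congr rfl fun m _ => ?_
      rw [map_sum]
      refine Finset.sum_congr rfl fun n _ => ?_
      simp only [map_mul, map_pow, map_neg, map_div₀, map_natCast, map_intCast, Complex.conj_I,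
        ← j_conj, Complex.conj_conj, Nat.add_comm n m]
      ring)
  rw [coeff_C_mul, ← h2]
  simp only [dualBasis, eval_mul, eval_pow, eval_sub, eval_X, eval_C, mul_assoc,
    Nat.sub_sub_self hl]
  ring

end

end ModIter

theorem mainTheorem4 (k : ℕ) (hk0 : 0 < k) (hk : Even k) (r s : ℤ) (hrs : Even (r + s))
    (hkrs : (k : ℤ) < r + s) (f : CuspForm 𝒮ℒ (k : ℤ)) :
    -- all integrals and all series involved converge, the series being over `B \ Γ`
    (∀ (z : ℍ) (P : Polynomial ℂ), MeasureTheory.IntegrableOn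
      (fun t : ℝ => ev f (z + Complex.I * t) * P.eval ((z : ℂ) + Complex.I * t))
      (Set.Ioi 0)) ∧
    (∀ (n : ℕ) (x : ℚ), MeasureTheory.IntegrableOn
      (lambdaIntegrand f ((n + 1 : ℕ) : ℂ) x) (Set.Ioi 0)) ∧
    (∀ z : ℍ, CosetSummable (eisensteinTerm r s z)) ∧
    (∀ (z : ℍ) (i : ℕ), CosetSummable (phiTerm k r s (eichlerPlus k f) z i) ∧
      CosetSummable (phiTerm k r s (eichlerMinus k f) z i)) ∧
    (∀ (z : ℍ) (l m n : ℕ), l ≤ k - 2 → m ≤ l → n ≤ k - 2 - l →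
      CosetSummable (twistedTerm (fun x => Lambda f ((m + n + 1 : ℕ) : ℂ) x)
        ((m : ℤ) + n - k + 2) (r + l + n + 2 - k) (s + m - l) z) ∧
      CosetSummable (twistedTerm (fun x => conj (Lambda f ((m + n + 1 : ℕ) : ℂ) x))
        ((m : ℤ) + n - k + 2) (r + l + n + 2 - k) (s + m - l) z)) ∧
    -- the coefficients `φ^±_{r,s}(l; z)` exist and are unique
    (∃! c : Fin (k - 1) → ℍ → ℂ, IsExpansion k (phi k r s (eichlerPlus k f)) c) ∧
    (∃! c : Fin (k - 1) → ℍ → ℂ, IsExpansion k (phi k r s (eichlerMinus k f)) c) ∧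
    -- the plus case
    (∀ c : Fin (k - 1) → ℍ → ℂ, IsExpansion k (phi k r s (eichlerPlus k f)) c →
      ∀ l : Fin (k - 1),
        (∀ z : ℍ, c l z =
          (-1) ^ (l : ℕ) * ((k - 2).choose l : ℂ) * (2 * Complex.I * z.im) ^ (2 - (k : ℤ)) *
            intFromCusp (fun w => ev f w * (w - conj (z : ℂ)) ^ (l : ℕ) *
              (w - z) ^ (k - 2 - (l : ℕ))) z * eisenstein r s z +
          ∑ m ∈ Finset.range ((l : ℕ) + 1), ∑ n ∈ Finset.range (k - 2 - (l : ℕ) + 1),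
            alpha k l m n * (2 * Complex.I * z.im) ^ (2 - (k : ℤ)) *
              cosetSum (twistedTerm (fun x => Lambda f ((m + n + 1 : ℕ) : ℂ) x)
                ((m : ℤ) + n - k + 2) (r + (l : ℕ) + n + 2 - k) (s + m - (l : ℕ)) z)) ∧
        IsRealAnalyticModularForm (r + (l : ℕ)) (s + k - 2 - (l : ℕ)) (c l)) ∧
    -- the minus case
    (∀ c : Fin (k - 1) → ℍ → ℂ, IsExpansion k (phi k r s (eichlerMinus k f)) c →
      ∀ l : Fin (k - 1),
        (∀ z : ℍ, c l z =
          (-1) ^ (l : ℕ) * ((k - 2).choose l : ℂ) * (2 * Complex.I * z.im) ^ (2 - (k : ℤ)) *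
            conj (intFromCusp (fun w => ev f w * (w - conj (z : ℂ)) ^ (k - 2 - (l : ℕ)) *
              (w - z) ^ (l : ℕ)) z) * eisenstein r s z +
          ∑ m ∈ Finset.range ((l : ℕ) + 1), ∑ n ∈ Finset.range (k - 2 - (l : ℕ) + 1),
            conj (alpha k l m n) * (2 * Complex.I * z.im) ^ (2 - (k : ℤ)) *
              cosetSum (twistedTerm (fun x => conj (Lambda f ((m + n + 1 : ℕ) : ℂ) x))
                ((m : ℤ) + n - k + 2) (r + (l : ℕ) + n + 2 - k) (s + m - (l : ℕ)) z)) ∧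
        IsRealAnalyticModularForm (r + (l : ℕ)) (s + k - 2 - (l : ℕ)) (c l)) := by
  have hk2 : 2 ≤ k := by
    obtain ⟨k', rfl⟩ := hk
    omega
  have h3 : 3 ≤ r + s := by omega
  have hu := fun l m n => isTwist_Lambda f hk0 hk hrs hkrs l m n
  obtain ⟨p1, p2, p3⟩ := expansion_of_phiTerm_eq (F := eichlerPlus k f) (a := alpha k)
    (E := fun l z => intFromCusp (fun w => ev f w * (w - conj (z : ℂ)) ^ l *
      (w - z) ^ (k - 2 - l)) z) (u := fun N x => Lambda f ((N + 1 : ℕ) : ℂ) x) hk2 hrs h3 hu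
    (fun l => hasFourierExpansion_intFromCusp f l (k - 2 - l)) (phiTerm_eichlerPlus f hk2 hk r s)
  obtain ⟨m1, m2, m3⟩ := expansion_of_phiTerm_eq (F := eichlerMinus k f)
    (a := fun l m n => conj (alpha k l m n)) (E := fun l z => conj (intFromCusp (fun w =>
      ev f w * (w - conj (z : ℂ)) ^ (k - 2 - l) * (w - z) ^ l) z))
    (u := fun N x => conj (Lambda f ((N + 1 : ℕ) : ℂ) x)) hk2 hrs h3 (fun l m n => (hu l m n).star)
    (fun l => (hasFourierExpansion_intFromCusp f (k - 2 - l) l).star)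
    (phiTerm_eichlerMinus f hk2 hk r s)
  refine ⟨fun z P => integrableOn_vertical f P z, fun n x => ?_,
    cosetSummable_eisensteinTerm hrs h3, fun z i => ⟨p1 z i, m1 z i⟩,
    fun z l m n _ _ _ => ⟨(hu l m n).cosetSummable z, (hu l m n).star.cosetSummable z⟩,
    p2, m2, p3, m3⟩
  exact (integrableOn_ev_rat_mul_pow f hk0 n x).congr_fun
    (fun t _ => (lambdaIntegrand_eq f n x t).symm) measurableSet_Ioi
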